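/- Let $q\in\mathbb C$ with $0<|q|<1$. For $a\in\mathbb C$ put $(a)_k=\prod_{i=0}^{k-1}(1-aq^i)$ for integers $k\ge 0$, $(a)_k=\prod_{i=1}^{-k}(1-aq^{-i})^{-1}$ for integers $k<0$, $(a)_\infty=\prod_{i\ge 0}(1-aq^i)$, and $\theta(x)=(x)_\infty(q/x)_\infty$. Repeated arguments denote products, e.g. $(bz^{\pm})_k=(bz)_k(b/z)_k$, $\theta(\lambda z^\pm)=\theta(\lambda z)\theta(\lambda/z)$, and $(z^{\pm2})_\infty=(z^2)_\infty(z^{-2})_\infty$. Let $b_1,\dots,b_6\in\mathbb C$ satisfy $b_1\cdots b_6=q$, $b_i/b_j\notin q^{\mathbb Z}$ for $1\le i<j\le 6$, and $b_ib_j\notin q^{\mathbb Z}$ for $1\le i\le j\le 6$. Let $V$ be the complex vector space of rational functions $f$ of the variable $x=(z+z^{-1})/2$ that are regular at $x=\infty$ (the degree of the numerator is at most that of the denominator) and regular elsewhere except for possible simple poles at points $x=(z+z^{-1})/2$ with $z=b_jq^{n}$, $1\le j\le 6$, $n\in\mathbb Z_{<0}$. Proposition. The space $V$ is spanned by the functions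 $\prod_{j=1}^6(b_jz^\pm)_{k_j}$ with $k_j\in\mathbb Z$, $k_1+\dots+k_6=0$. There is a linear functional $\mathbf J:V\to\mathbb C$ such that, for all such $k_1,\dots,k_6$, $$\mathbf J\Bigl(\prod_{j=1}^6(b_jz^\pm)_{k_j}\Bigr)=\frac{\prod_{1\le i<j\le 6}(b_ib_j)_{k_i+k_j}}{\prod_{j=1}^6q^{\binom{k_j}2}b_j^{k_j}}.$$ For $\lambda\in\mathbb C\setminus\{0\}$ let $$D(\lambda)=\prod_{j=1}^6\theta(\lambda b_j)-q\lambda^{-2}\prod_{j=1}^6\theta(\lambda/b_j).$$ The zeros of $D$ form a closed discrete subset of $\mathbb C\setminus\{0\}$. Whenever $\lambda\neq 0$, $D(\lambda)\ne 0$ and $f\in V$, one has $$\mathbf J(f)=\frac{(q)_\infty\,\theta(\lambda^2)\prod_{1\le i<j\le 6}(b_ib_j)_\infty}{2D(\lambda)}\oint f\Bigl(\frac{z+z^{-1}}2\Bigr)\frac{(z^{\pm2})_\infty\,\theta(\lambda z^\pm)}{\prod_{j=1}^6(b_jz^\pm)_\infty}\,\frac{dz}{2\pi\mathrm i z},$$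 where the integral may be taken over any closed piecewise $C^1$ path in $\mathbb C\setminus\{0\}$ that avoids the poles of the integrand, has winding number $1$ around every pole of the integrand of the form $b_jq^n$ and winding number $0$ around every pole of the integrand of the form $b_j^{-1}q^n$ ($1\le j\le 6$, $n\in\mathbb Z$). For all such $\lambda$ and $f$, at least one such path exists. -/

import Mathlib

open scoped BigOperators Topology

noncomputable section

namespace Rahman

/-- The `q`-shifted factorial `(a)_k` for an arbitrary integer `k`:
`(1 - a)(1 - aq) ⋯ (1 - aq^(k-1))` for `k ≥ 0`, and
`((1 - aq⁻¹)(1 - aq⁻²) ⋯ (1 - aq^k))⁻¹` for `k < 0`. -/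
def qPoch (q a : ℂ) : ℤ → ℂ
  | Int.ofNat n => ∏ i ∈ Finset.range n, (1 - a * q ^ i)
  | Int.negSucc n => (∏ i ∈ Finset.range (n + 1), (1 - a * (q ^ (i + 1))⁻¹))⁻¹

/-- The infinite `q`-shifted factorial `(a)_∞ = ∏_{j ≥ 0} (1 - a q^j)`
(the product converges absolutely when `|q| < 1`). -/
def qPochInf (q a : ℂ) : ℂ := ∏' j : ℕ, (1 - a * q ^ j)

/-- The theta function `θ(x) = (x)_∞ (q/x)_∞`. -/
def theta (q x : ℂ) : ℂ := qPochInf q x * qPochInf q (q / x)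

/-- The point `(z + z⁻¹)/2`. -/
def joukowski (z : ℂ) : ℂ := (z + z⁻¹) / 2

/-- The points `(z + z⁻¹)/2` with `z = b_j q^n`, `n` a negative integer, `1 ≤ j ≤ 6`. -/
def poleSet (q : ℂ) (b : Fin 6 → ℂ) : Set ℂ :=
  {x | ∃ (j : Fin 6) (n : ℤ), n < 0 ∧ x = joukowski (b j * q ^ n)}

/-- Membership in the space `V`: a rational function in the variable `x` that is regular at
infinity (the degree of the numerator is at most that of the denominator), and whose
only other singularities are at most simple poles at points of `poleSet q b`. The numerator and
denominator are those of the reduced fraction. -/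
def MemV (q : ℂ) (b : Fin 6 → ℂ) (f : RatFunc ℂ) : Prop :=
  f.num.natDegree ≤ f.denom.natDegree ∧
    ∀ x : ℂ, f.denom.IsRoot x → x ∈ poleSet q b ∧ f.denom.rootMultiplicity x ≤ 1

lemma num_le_iff (f : RatFunc ℂ) :
    f.num.natDegree ≤ f.denom.natDegree ↔ f.intDegree ≤ 0 := by
  unfold RatFunc.intDegree; omega

lemma memV_smul {q : ℂ} {b : Fin 6 → ℂ} (c : ℂ) {f : RatFunc ℂ} (hf : MemV q b f) :
    MemV q b (c • f) := by
  by_cases hc : c = 0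
  · subst hc; simp [MemV]
  by_cases hf0 : f = 0
  · subst hf0; simp [MemV]
  have h1 : c • f = RatFunc.C c * f := by rw [RatFunc.smul_eq_C_mul]
  have hC : RatFunc.C c ≠ 0 := by simpa using hc
  have hd : (c • f).denom ∣ f.denom := by
    have := RatFunc.denom_mul_dvd (RatFunc.C c) f
    rw [h1]; simpa using this
  refine ⟨?_, fun x hx => ⟨(hf.2 x (hx.dvd hd)).1, ?_⟩⟩
  · rw [num_le_iff, h1, RatFunc.intDegree_mul hC hf0, RatFunc.intDegree_C, zero_add,
      ← num_le_iff]
    exact hf.1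
  · exact (Polynomial.rootMultiplicity_le_rootMultiplicity_of_dvd f.denom_ne_zero hd x).trans
      (hf.2 x (hx.dvd hd)).2

lemma memV_add {q : ℂ} {b : Fin 6 → ℂ} {f g : RatFunc ℂ} (hf : MemV q b f)
    (hg : MemV q b g) : MemV q b (f + g) := by
  obtain ⟨m, hm⟩ := EuclideanDomain.gcd_dvd_left f.denom g.denom
  obtain ⟨n, hn⟩ := EuclideanDomain.gcd_dvd_right f.denom g.denom
  set G := EuclideanDomain.gcd f.denom g.denom with hG
  have hf0 := f.denom_ne_zero
  have hg0 := g.denom_ne_zero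
  have hn0 : n ≠ 0 := by rintro rfl; exact hg0 (by rw [hn, mul_zero])
  have hG0 : G ≠ 0 := by intro h; exact hg0 (by rw [hn, h, zero_mul])
  have hL0 : f.denom * n ≠ 0 := mul_ne_zero hf0 hn0
  have hmul : ∀ x, ((f + g).denom).IsRoot x →
      (f.denom.IsRoot x ∨ g.denom.IsRoot x) ∧ (f + g).denom.rootMultiplicity x ≤ 1 := by
    have hd : (f + g).denom ∣ f.denom * n := by
      rw [RatFunc.denom_dvd hL0]
      refine ⟨f.num * n + g.num * m, ?_⟩
      have e1 : f = algebraMap _ _ f.num / algebraMap _ _ f.denom := f.num_div_denom.symm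
      have e2 : g = algebraMap _ _ g.num / algebraMap _ _ g.denom := g.num_div_denom.symm
      have a1 : algebraMap (Polynomial ℂ) (RatFunc ℂ) f.denom ≠ 0 :=
        RatFunc.algebraMap_ne_zero hf0
      have a2 : algebraMap (Polynomial ℂ) (RatFunc ℂ) g.denom ≠ 0 :=
        RatFunc.algebraMap_ne_zero hg0
      have a3 : algebraMap (Polynomial ℂ) (RatFunc ℂ) n ≠ 0 :=
        RatFunc.algebraMap_ne_zero hn0
      have key : f.denom * n = g.denom * m := by
        rw [hm, hn]; ring
      have key' : algebraMap (Polynomial ℂ) (RatFunc ℂ) f.denom * algebraMap _ _ n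
          = algebraMap _ _ g.denom * algebraMap _ _ m := by
        rw [← map_mul, key, map_mul]
      conv_lhs => rw [e1, e2]
      rw [map_add, map_mul, map_mul, map_mul]
      rw [div_add_div _ _ a1 a2, div_eq_div_iff (mul_ne_zero a1 a2) (mul_ne_zero a1 a3)]
      linear_combination (algebraMap (Polynomial ℂ) (RatFunc ℂ) f.denom
        * algebraMap (Polynomial ℂ) (RatFunc ℂ) g.num) * key'
    intro x hx
    have hx1 : (f.denom * n).IsRoot x := hx.dvd hd
    have hor : f.denom.IsRoot x ∨ g.denom.IsRoot x := by
      rcases Polynomial.root_mul.mp hx1 with h | h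
      · exact Or.inl h
      · exact Or.inr (h.dvd ⟨G, by rw [hn]; ring⟩)
    refine ⟨hor, ?_⟩
    refine (Polynomial.rootMultiplicity_le_rootMultiplicity_of_dvd hL0 hd x).trans ?_
    rw [Polynomial.rootMultiplicity_mul hL0]
    have hgm : g.denom.rootMultiplicity x = G.rootMultiplicity x + n.rootMultiplicity x := by
      conv_lhs => rw [hn]
      rw [Polynomial.rootMultiplicity_mul (mul_ne_zero hG0 hn0)]
    have hg1 : g.denom.rootMultiplicity x ≤ 1 := by
      by_cases h : g.denom.IsRoot x
      · exact (hg.2 x h).2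
      · rw [Polynomial.rootMultiplicity_eq_zero h]; omega
    by_cases h : f.denom.IsRoot x
    · have hf1 := (hf.2 x h).2
      by_cases h' : g.denom.IsRoot x
      · have hGr : G.IsRoot x := by
          rw [← Polynomial.dvd_iff_isRoot] at h h' ⊢
          exact EuclideanDomain.dvd_gcd h h'
        have := (Polynomial.rootMultiplicity_pos hG0).mpr hGr
        omega
      · have := Polynomial.rootMultiplicity_eq_zero h'
        omega
    · rw [Polynomial.rootMultiplicity_eq_zero h]; omega
  refine ⟨?_, fun x hx => ⟨?_, (hmul x hx).2⟩⟩
  · by_cases h0 : g = 0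
    · subst h0; simpa using hf.1
    by_cases h1 : f + g = 0
    · rw [h1]; simp
    rw [num_le_iff]
    exact (RatFunc.intDegree_add_le h0 h1).trans
      (max_le ((num_le_iff f).mp hf.1) ((num_le_iff g).mp hg.1))
  · rcases (hmul x hx).1 with h | h
    · exact (hf.2 x h).1
    · exact (hg.2 x h).1

/-- The vector space `V` of rational functions. -/
def V (q : ℂ) (b : Fin 6 → ℂ) : Submodule ℂ (RatFunc ℂ) where
  carrier := {f | MemV q b f}
  add_mem' := memV_add
  zero_mem' := by simp [MemV]
  smul_mem' := fun c _ hf => memV_smul c hf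

/-- The value of the rational function `f` at the point `(z + z⁻¹)/2`. -/
def evalAt (f : RatFunc ℂ) (z : ℂ) : ℂ := f.eval (RingHom.id ℂ) (joukowski z)

/-- `f` is the rational function of `(z + z⁻¹)/2` given by `∏_j (b_j z)_{k_j} (b_j/z)_{k_j}`: the two
sides agree at every nonzero `z` such that neither `z` nor `z⁻¹` is of the form `b_j q^n`
with `n < 0`. -/
def IsProductFun (q : ℂ) (b : Fin 6 → ℂ) (k : Fin 6 → ℤ) (f : RatFunc ℂ) : Prop :=
  ∀ z : ℂ, z ≠ 0 → (∀ (j : Fin 6) (n : ℤ), n < 0 → z ≠ b j * q ^ n ∧ z⁻¹ ≠ b j * q ^ n) →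
    evalAt f z = ∏ j, (qPoch q (b j * z) (k j) * qPoch q (b j / z) (k j))

/-- The value `∏_{i<j} (b_i b_j)_{k_i+k_j} / ∏_j q^(k_j(k_j-1)/2) b_j^{k_j}`; the integer
`k_j (k_j - 1)` is even, so the division is exact. -/
def productValue (q : ℂ) (b : Fin 6 → ℂ) (k : Fin 6 → ℤ) : ℂ :=
  (∏ i, ∏ j ∈ Finset.Ioi i, qPoch q (b i * b j) (k i + k j)) /
    ∏ j, (q ^ (k j * (k j - 1) / 2) * b j ^ k j)

/-- `θ(lb_1, …, lb_6) - q l⁻² θ(l/b_1, …, l/b_6)`. -/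
def thetaDiff (q : ℂ) (b : Fin 6 → ℂ) (l : ℂ) : ℂ :=
  (∏ j, theta q (l * b j)) - q * (l ^ 2)⁻¹ * ∏ j, theta q (l / b j)

/-- The integrand `f((z + z⁻¹)/2) (z^{±2})_∞ θ(l z^±) / ∏_j (b_j z^±)_∞ · 1/(2πi z)`. -/
def integrand (q : ℂ) (b : Fin 6 → ℂ) (l : ℂ) (f : RatFunc ℂ) (z : ℂ) : ℂ :=
  evalAt f z *
    ((qPochInf q (z ^ 2) * qPochInf q ((z ^ 2)⁻¹)) * (theta q (l * z) * theta q (l / z)) /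
      ∏ j, (qPochInf q (b j * z) * qPochInf q (b j / z))) *
    (1 / (2 * Real.pi * Complex.I * z))

/-- A closed piecewise continuously differentiable path, parametrized by `[0, 1]`. -/
def IsClosedPath (γ : ℝ → ℂ) : Prop :=
  ContinuousOn γ (Set.Icc 0 1) ∧ γ 0 = γ 1 ∧
    ∃ (n : ℕ) (t : Fin (n + 1) → ℝ), StrictMono t ∧ t 0 = 0 ∧ t (Fin.last n) = 1 ∧
      ∀ i : Fin n, ContDiffOn ℝ 1 γ (Set.Icc (t i.castSucc) (t i.succ))

/-- The integral `∮_γ F(z) dz`. -/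
def contourIntegral (γ : ℝ → ℂ) (F : ℂ → ℂ) : ℂ :=
  ∫ t in (0 : ℝ)..1, F (γ t) * deriv γ t

/-- The winding number of `γ` around `a`, as a complex number. -/
def windingNumber (γ : ℝ → ℂ) (a : ℂ) : ℂ :=
  (2 * Real.pi * Complex.I)⁻¹ * contourIntegral γ (fun z => (z - a)⁻¹)

/-- `F` has a pole at `a`: it is meromorphic there, of negative order. -/
def IsPole (F : ℂ → ℂ) (a : ℂ) : Prop := MeromorphicAt F a ∧ meromorphicOrderAt F a < 0

/-- A closed path in `ℂ ∖ {0}` that avoids the poles of `F`, winds once in the positive direction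
around every pole of `F` of the form `b_j q^n` with `n ∈ ℤ`, and does not wind around any pole of
`F` of the form `b_j⁻¹ q^n` with `n ∈ ℤ`. -/
def IsContour (q : ℂ) (b : Fin 6 → ℂ) (F : ℂ → ℂ) (γ : ℝ → ℂ) : Prop :=
  IsClosedPath γ ∧ (∀ t ∈ Set.Icc (0 : ℝ) 1, γ t ≠ 0 ∧ ¬ IsPole F (γ t)) ∧
    ∀ (j : Fin 6) (n : ℤ),
      (IsPole F (b j * q ^ n) → windingNumber γ (b j * q ^ n) = 1) ∧
      (IsPole F ((b j)⁻¹ * q ^ n) → windingNumber γ ((b j)⁻¹ * q ^ n) = 0)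

end Rahman

end

open scoped BigOperators Topology

noncomputable section

namespace Rahman

open Set MeasureTheory

/-! Everything rests on one evaluation, valid for all generic balanced parameters: the integral of
the weight `weight q b l` against `dz/z` equals, in multiplied-out form, `2 · 2πi · D(l)` divided by
`(q)_∞ θ(l²) ∏_{i<j} (b_i b_j)_∞` (`logIntegral_weight_eq`). Multiplying the weight by `∏_j (b_j
z^±)_{k_j}` merely replaces `b_j` by `b_j q^{k_j}` (`evalAt_mul_weight`), and `∑ k_j = 0` keeps the
parameters balanced, so the same evaluation gives the integral of every product function. Under this
shift `D(l)` is multiplied by a factor free of `l` (`thetaDiff_mul_zpow`). The normalized integral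
of a product function is therefore the prescribed value, whatever `l` is (`logIntegral_prodFun`). As
the product functions span `V` (`prodSpan_eq`, by partial fractions), the functional defined by the
integral with `l = b 0` coincides with the one defined by any other admissible `l`
(`exists_functional`).

The evaluation has two ingredients. For `l = b m` the theta factors in the numerator cancel one pair
of factors in the denominator, leaving the five-parameter Nassrallah–Rahman integral
(`logIntegral_weight_apply`). For general `l`, the three-term theta relation expands `θ(l z^±)` in
`θ(b 0 z^±)` and `θ(b 1 z^±)` (`thetaPair_three_term`), while `D(l)` satisfies the matching
interpolation formula after division by `θ(l²)` (`thetaDiff_eq`). Both relations come from the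
principle that theta-like functions with the same multiplier are proportional when the zeros of one
are simple and are zeros of the other (`exists_eq_const_mul`), which is Liouville's theorem.

The Nassrallah–Rahman integral is found by contiguity. Replacing one `a i` by `q a i` changes the
integrand, up to known constants, by terms whose integrals vanish by antisymmetry under `z ↦ 1/(qz)`
or `z ↦ q/z` (`logIntegral_nrWeight_contiguity`). Hence a suitably normalized integral is invariant
under all shifts (`nrRatio_mul_pow`). Letting all parameters tend to `0` reduces it to the integral
of `(z²)_∞ (z⁻²)_∞` over the unit circle, that is, to the constant term of a theta function
(`logIntegral_weight`), obtained from a recursion for finite theta products.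

Integrals are compared by a residue theorem on `ℂ ∖ {0}` for simple poles (`residue_theorem`): only
the winding numbers around `0` and around the actual poles matter. A separating path is a circle
through a generic point with finitely many loops attached (`exists_separates`). The definition of a
contour says nothing about the winding number around `0`. For `f ≠ 0` it is forced to be `1` because
genuine poles `b_j q^n` accumulate there (`exists_isPole_integrand`). -/

/-- Piecewise continuously differentiable paths on an interval, built piece by piece. -/
inductive PiecewiseC1 (γ : ℝ → ℂ) (a : ℝ) : ℝ → Prop
  | single {b : ℝ} : a < b → ContDiffOn ℝ 1 γ (Icc a b) → PiecewiseC1 γ a b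
  | snoc {b c : ℝ} : PiecewiseC1 γ a b → b < c → ContDiffOn ℝ 1 γ (Icc b c) → PiecewiseC1 γ a c

/-! ### Piecewise C¹ paths and integration along them. -/

namespace PiecewiseC1

variable {γ : ℝ → ℂ} {a b c : ℝ}

lemma lt (h : PiecewiseC1 γ a b) : a < b := by
  induction h with
  | single h _ => exact h
  | snoc _ h _ ih => exact ih.trans h

lemma trans (h : PiecewiseC1 γ a b) (h' : PiecewiseC1 γ b c) : PiecewiseC1 γ a c := by
  induction h' with
  | single h1 h2 => exact h.snoc h1 h2
  | snoc _ h1 h2 ih => exact ih.snoc h1 h2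

lemma continuousOn (h : PiecewiseC1 γ a b) : ContinuousOn γ (Icc a b) := by
  induction h with
  | single _ h => exact h.continuousOn
  | @snoc b c h1 h2 h3 ih =>
    have := ih.union_of_isClosed h3.continuousOn isClosed_Icc isClosed_Icc
    rwa [Icc_union_Icc_eq_Icc h1.lt.le h2.le] at this

lemma exists_partition (h : PiecewiseC1 γ a b) : ∃ (n : ℕ) (t : ℕ → ℝ), t 0 = a ∧ t n = b ∧
    (∀ i < n, t i < t (i + 1)) ∧ ∀ i < n, ContDiffOn ℝ 1 γ (Icc (t i) (t (i + 1))) := by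
  induction h with
  | @single b h1 h2 =>
    refine ⟨1, fun i => if i = 0 then a else b, by simp, by simp, ?_, ?_⟩ <;>
    · intro i hi
      obtain rfl : i = 0 := by omega
      simpa
  | @snoc b c h1 h2 h3 ih =>
    obtain ⟨n, t, h0, hn, hlt, hC⟩ := ih
    refine ⟨n + 1, fun i => if i ≤ n then t i else c, by simpa, by simp, ?_, ?_⟩ <;>
    · intro i hi
      rcases Nat.lt_succ_iff_lt_or_eq.mp hi with h | rfl
      · have h' : i + 1 ≤ n := h
        simpa [h.le, h'] using by first | exact hlt i h | exact hC i h
      · simpa [hn]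

lemma comp_affine (h : PiecewiseC1 γ a b) {k : ℝ} (hk : 0 < k) (m : ℝ) :
    PiecewiseC1 (fun t => γ (k * t + m)) ((a - m) / k) ((b - m) / k) := by
  have key : ∀ {x y : ℝ}, ContDiffOn ℝ 1 γ (Icc x y) →
      ContDiffOn ℝ 1 (fun t => γ (k * t + m)) (Icc ((x - m) / k) ((y - m) / k)) := by
    intro x y h
    refine h.comp (by fun_prop) ?_
    intro t ht
    rw [mem_Icc, div_le_iff₀ hk, le_div_iff₀ hk] at ht
    constructor <;> nlinarith [ht.1, ht.2]
  induction h with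
  | single h1 h2 => exact .single (by gcongr) (key h2)
  | snoc _ h1 h2 ih => exact .snoc ih (by gcongr) (key h2)

lemma comp_neg (h : PiecewiseC1 γ a b) (m : ℝ) :
    PiecewiseC1 (fun t => γ (m - t)) (m - b) (m - a) := by
  have key : ∀ {x y : ℝ}, ContDiffOn ℝ 1 γ (Icc x y) →
      ContDiffOn ℝ 1 (fun t => γ (m - t)) (Icc (m - y) (m - x)) := by
    intro x y h
    refine h.comp (by fun_prop) ?_
    intro t ht
    constructor <;> linarith [ht.1, ht.2]
  induction h with
  | single h1 h2 => exact .single (by linarith) (key h2)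
  | snoc _ h1 h2 ih => exact (single (by linarith) (key h2)).trans ih

lemma congr {γ' : ℝ → ℂ} (h : PiecewiseC1 γ a b) (hγ : ∀ t ∈ Icc a b, γ' t = γ t) :
    PiecewiseC1 γ' a b := by
  induction h with
  | single h1 h2 => exact .single h1 (h2.congr hγ)
  | snoc h0 h1 h2 ih =>
    exact .snoc (ih fun t ht => hγ t ⟨ht.1, ht.2.trans h1.le⟩) h1
      (h2.congr fun t ht => hγ t ⟨h0.lt.le.trans ht.1, ht.2⟩)

lemma comp_contDiffOn {φ : ℂ → ℂ} {U : Set ℂ} (h : PiecewiseC1 γ a b) (hφ : ContDiffOn ℝ 1 φ U)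
    (hU : ∀ t ∈ Icc a b, γ t ∈ U) : PiecewiseC1 (fun t => φ (γ t)) a b := by
  induction h with
  | single h1 h2 => exact .single h1 (hφ.comp h2 hU)
  | snoc h0 h1 h2 ih =>
    exact .snoc (ih fun t ht => hU t ⟨ht.1, ht.2.trans h1.le⟩) h1
      (hφ.comp h2 fun t ht => hU t ⟨h0.lt.le.trans ht.1, ht.2⟩)

lemma ae_differentiableAt (h : PiecewiseC1 γ a b) :
    ∃ s : Set ℝ, s.Finite ∧ ∀ t ∈ Ioo a b, t ∉ s → DifferentiableAt ℝ γ t := by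
  have key : ∀ {x y : ℝ}, ContDiffOn ℝ 1 γ (Icc x y) → ∀ t ∈ Ioo x y, DifferentiableAt ℝ γ t :=
    fun h t ht => (h.differentiableOn one_ne_zero).differentiableAt (Icc_mem_nhds ht.1 ht.2)
  induction h with
  | single h1 h2 => exact ⟨∅, finite_empty, fun t ht _ => key h2 t ht⟩
  | @snoc b c h0 h1 h2 ih =>
    obtain ⟨s, hs, h⟩ := ih
    refine ⟨insert b s, hs.insert b, fun t ht hts => ?_⟩
    rw [mem_insert_iff, not_or] at hts
    rcases lt_or_gt_of_ne hts.1 with hlt | hlt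
    · exact h t ⟨ht.1, hlt⟩ hts.2
    · exact key h2 t ⟨hlt, ht.2⟩

/-- On each piece `deriv` agrees, off the two endpoints, with the continuous function `derivWithin`;
its values at the break points are irrelevant because these are a null set. -/
lemma intervalIntegrable (h : PiecewiseC1 γ a b) {F : ℂ → ℂ}
    (hF : ContinuousOn F (γ '' Icc a b)) :
    IntervalIntegrable (fun t => F (γ t) * deriv γ t) volume a b := by
  have key : ∀ {x y : ℝ}, x < y → ContDiffOn ℝ 1 γ (Icc x y) → ContinuousOn F (γ '' Icc x y) →
      IntervalIntegrable (fun t => F (γ t) * deriv γ t) volume x y := by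
    intro x y hxy h hF
    have h1 : ContinuousOn (fun t => F (γ t) * derivWithin γ (Icc x y) t) (Icc x y) :=
      (hF.comp h.continuousOn (mapsTo_image _ _)).mul
        (h.continuousOn_derivWithin (uniqueDiffOn_Icc hxy) le_rfl)
    have h2 := h1.intervalIntegrable_of_Icc (μ := volume) hxy.le
    refine h2.congr_ae ?_
    rw [uIoc_of_le hxy.le, ← restrict_Ioo_eq_restrict_Ioc]
    filter_upwards [ae_restrict_mem measurableSet_Ioo] with t ht
    rw [derivWithin_of_mem_nhds (Icc_mem_nhds ht.1 ht.2)]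
  induction h with
  | single h1 h2 => exact key h1 h2 hF
  | snoc h0 h1 h2 ih =>
    refine (ih (hF.mono (image_mono (Icc_subset_Icc_right h1.le)))).trans
      (key h1 h2 (hF.mono (image_mono (Icc_subset_Icc_left h0.lt.le))))

lemma integral_deriv (h : PiecewiseC1 γ a b) {F M : ℂ → ℂ}
    (hF : ContinuousOn F (γ '' Icc a b)) (hM : ∀ t ∈ Icc a b, HasDerivAt M (F (γ t)) (γ t)) :
    ∫ t in a..b, F (γ t) * deriv γ t = M (γ b) - M (γ a) := by
  have key : ∀ {x y : ℝ}, x < y → ContDiffOn ℝ 1 γ (Icc x y) → ContinuousOn F (γ '' Icc x y) →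
      (∀ t ∈ Icc x y, HasDerivAt M (F (γ t)) (γ t)) →
      ∫ t in x..y, F (γ t) * deriv γ t = M (γ y) - M (γ x) := by
    intro x y hxy h hF hM
    refine intervalIntegral.integral_eq_sub_of_hasDerivAt_of_le (f := fun t => M (γ t)) hxy.le ?_
      (fun t ht => ?_) ((single hxy h).intervalIntegrable hF)
    · intro t ht
      exact ((hM t ht).continuousAt.comp_continuousWithinAt (h.continuousOn t ht))
    · have := (h.differentiableOn one_ne_zero).differentiableAt (Icc_mem_nhds ht.1 ht.2)
      exact (hM t (Ioo_subset_Icc_self ht)).comp_of_eq t this.hasDerivAt rfl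
  induction h with
  | single h1 h2 => exact key h1 h2 hF hM
  | @snoc b c h0 h1 h2 ih =>
    have hF1 := hF.mono (image_mono (Icc_subset_Icc_right h1.le))
    have hF2 := hF.mono (image_mono (Icc_subset_Icc_left h0.lt.le))
    have hM1 : ∀ t ∈ Icc a b, HasDerivAt M (F (γ t)) (γ t) :=
      fun t ht => hM t ⟨ht.1, ht.2.trans h1.le⟩
    have hM2 : ∀ t ∈ Icc b c, HasDerivAt M (F (γ t)) (γ t) :=
      fun t ht => hM t ⟨h0.lt.le.trans ht.1, ht.2⟩
    rw [← intervalIntegral.integral_add_adjacent_intervals (h0.intervalIntegrable hF1)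
      ((single h1 h2).intervalIntegrable hF2), ih hF1 hM1, key h1 h2 hF2 hM2]
    ring

end PiecewiseC1

lemma isClosedPath_iff {γ : ℝ → ℂ} : IsClosedPath γ ↔ PiecewiseC1 γ 0 1 ∧ γ 0 = γ 1 := by
  constructor
  · rintro ⟨-, h01, n, t, ht, h0, h1, hC⟩
    refine ⟨?_, h01⟩
    have key : ∀ k (hk : k < n), PiecewiseC1 γ 0 (t ⟨k + 1, by omega⟩) := by
      intro k
      induction k with
      | zero =>
        intro hk
        have := hC ⟨0, hk⟩
        refine .single ?_ ?_
        · rw [← h0]; exact ht (by simp [Fin.lt_def])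
        · rw [← h0]; exact this
      | succ k ih =>
        intro hk
        exact (ih (by omega)).snoc (ht (by simp [Fin.lt_def])) (hC ⟨k + 1, hk⟩)
    cases n with
    | zero => 
      have : (0 : ℝ) = 1 := by rw [← h0, ← h1]; rfl
      norm_num at this
    | succ n =>
      have := key n (by omega)
      rw [← h1]; exact this
  · rintro ⟨h, h01⟩
    refine ⟨h.continuousOn, h01, ?_⟩
    obtain ⟨n, t, h0, hn, hlt, hC⟩ := h.exists_partition
    refine ⟨n, fun i => t i, Fin.strictMono_iff_lt_succ.mpr fun i => hlt i i.2, h0, by simpa, ?_⟩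
    exact fun i => hC i i.2

/-- A parameter at which the path takes a given value with nonzero derivative is isolated among such
parameters, so for each value there are only countably many of them. -/
lemma ae_deriv_eq_zero_of_mem (γ : ℝ → ℂ) {E : Set ℂ} (hE : E.Countable) :
    ∀ᵐ t : ℝ, γ t ∈ E → deriv γ t = 0 := by
  have key : ∀ s : ℂ, {t | γ t = s ∧ deriv γ t ≠ 0}.Countable := by
    intro s
    have : DiscreteTopology {t | γ t = s ∧ deriv γ t ≠ 0} := by
      rw [discreteTopology_subtype_iff]
      rintro t ⟨-, ht⟩
      have h1 := (differentiableAt_of_deriv_ne_zero ht).hasDerivAt.eventually_ne (c := s) ht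
      rw [← disjoint_iff, Filter.disjoint_principal_right]
      filter_upwards [h1] with u hu hu'
      exact hu hu'.1
    exact countable_of_Lindelof_of_discrete
  have h2 : (⋃ s ∈ E, {t | γ t = s ∧ deriv γ t ≠ 0}).Countable := hE.biUnion fun s _ => key s
  filter_upwards [h2.ae_notMem volume] with t ht hE'
  by_contra h
  exact ht (mem_biUnion hE' ⟨rfl, h⟩)

/-- Lets an integrand be altered at countably many points, such as removable singularities, even if
the path runs through them or rests there: almost everywhere on such parameters the derivative is
zero. -/
lemma contourIntegral_congr {γ : ℝ → ℂ} {F G : ℂ → ℂ} {E : Set ℂ} (hE : E.Countable)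
    (h : ∀ t ∈ Icc (0 : ℝ) 1, γ t ∉ E → F (γ t) = G (γ t)) :
    contourIntegral γ F = contourIntegral γ G := by
  refine intervalIntegral.integral_congr_ae ?_
  filter_upwards [ae_deriv_eq_zero_of_mem γ hE] with t ht ht'
  rw [uIoc_of_le zero_le_one] at ht'
  by_cases hm : γ t ∈ E
  · rw [ht hm, mul_zero, mul_zero]
  · rw [h t (Ioc_subset_Icc_self ht') hm]

/-! ### Residues in the punctured plane. -/

/-- A function holomorphic in an annulus around `0` is, up to a multiple of `1/z`, a derivative. -/
lemma exists_primitive_annulus {G : ℂ → ℂ} {ρ R : ℝ} (hρ : 0 < ρ)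
    (hG : ∀ z : ℂ, ρ < ‖z‖ → ‖z‖ < R → DifferentiableAt ℂ G z) :
    ∃ (c : ℂ) (M : ℂ → ℂ), ∀ z : ℂ, ρ < ‖z‖ → ‖z‖ < R → HasDerivAt M (G z - c * z⁻¹) z := by
  -- The exponential map covers the annulus by this vertical strip, which is convex, so that the
  -- pulled-back form has a primitive there.
  set A : Set ℂ := {u | Real.log ρ < u.re ∧ u.re < Real.log R} with hA
  have hAopen : IsOpen A := (isOpen_lt continuous_const Complex.continuous_re).inter
    (isOpen_lt Complex.continuous_re continuous_const)
  have hAconv : Convex ℝ A := by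
    have h1 : Convex ℝ {u : ℂ | Real.log ρ < u.re} := convex_halfSpace_re_gt _
    have h2 : Convex ℝ {u : ℂ | u.re < Real.log R} := convex_halfSpace_re_lt _
    exact h1.inter h2
  rcases le_or_gt R ρ with hR | hR
  · exact ⟨0, 0, fun z h1 h2 => absurd (h1.trans h2) (not_lt.mpr hR)⟩
  have hR0 : 0 < R := hρ.trans hR
  have hexp : ∀ u ∈ A, ρ < ‖Complex.exp u‖ ∧ ‖Complex.exp u‖ < R := by
    intro u hu
    rw [Complex.norm_exp]
    exact ⟨(Real.log_lt_iff_lt_exp hρ).mp hu.1, (Real.lt_log_iff_exp_lt hR0).mp hu.2⟩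
  have hlog : ∀ u : ℂ, ρ < ‖Complex.exp u‖ → ‖Complex.exp u‖ < R → u ∈ A := by
    intro u h1 h2
    rw [Complex.norm_exp] at h1 h2
    exact ⟨(Real.log_lt_iff_lt_exp hρ).mpr h1, (Real.lt_log_iff_exp_lt hR0).mpr h2⟩
  have hd : DifferentiableOn ℂ (fun u => G (Complex.exp u) * Complex.exp u) A := by
    intro u hu
    have h := hG _ (hexp u hu).1 (hexp u hu).2
    exact ((h.comp u Complex.differentiableAt_exp).mul
      Complex.differentiableAt_exp).differentiableWithinAt
  obtain ⟨K, hK'⟩ := hAconv.exists_forall_hasDerivWithinAt hd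
  have hK : ∀ u ∈ A, HasDerivAt K (G (Complex.exp u) * Complex.exp u) u :=
    fun u hu => (hK' u hu).hasDerivAt (hAopen.mem_nhds hu)
  set τ : ℂ := 2 * Real.pi * Complex.I with hτ
  have hτ0 : τ ≠ 0 := by simp [hτ, Real.pi_ne_zero]
  have hτA : ∀ u, u + τ ∈ A ↔ u ∈ A := by
    intro u; simp [hA, hτ]
  -- The increment of the primitive over a period is constant. Subtracting the linear function with
  -- the same increment makes it periodic, at the price of the term `c/z` with `c = κ/τ`.
  obtain ⟨κ, hκ⟩ : ∃ κ, ∀ u ∈ A, K (u + τ) - K u = κ := by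
    refine hAopen.exists_is_const_of_deriv_eq_zero hAconv.isPreconnected (f := fun u => K (u + τ) - K u) ?_ ?_
    · intro u hu
      exact (((hK _ ((hτA u).mpr hu)).comp_add_const u τ).sub
        (hK u hu)).differentiableAt.differentiableWithinAt
    · intro u hu
      refine (((hK _ ((hτA u).mpr hu)).comp_add_const u τ).sub (hK u hu)).deriv.trans ?_
      simp [hτ, Complex.exp_add]
  classical
  set Φ : ℂ → ℂ := fun u => if u ∈ A then K u - κ / τ * u else 0 with hΦ
  have hper : Function.Periodic Φ τ := by
    intro u
    by_cases hu : u ∈ A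
    · simp only [hΦ, (hτA u).mpr hu, hu, if_true]
      have := hκ u hu
      field_simp
      linear_combination τ * this
    · have : u + τ ∉ A := fun h => hu ((hτA u).mp h)
      simp [hΦ, hu, this]
  have hΦd : ∀ u ∈ A, HasDerivAt Φ (G (Complex.exp u) * Complex.exp u - κ / τ) u := by
    intro u hu
    have h1 := (hK u hu).sub ((hasDerivAt_id u).const_mul (κ / τ))
    rw [mul_one] at h1
    refine h1.congr_of_eventuallyEq ?_
    filter_upwards [hAopen.mem_nhds hu] with v hv
    simp [hΦ, hv]
  have hMexp : ∀ u, Φ (Complex.log (Complex.exp u)) = Φ u := by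
    intro u
    obtain ⟨n, hn⟩ := Complex.exp_eq_exp_iff_exists_int.mp
      (Complex.exp_log (Complex.exp_ne_zero u))
    rw [hn]
    exact hper.int_mul n u
  refine ⟨κ / τ, fun z => Φ (Complex.log z), fun z h1 h2 => ?_⟩
  have hz : z ≠ 0 := by rintro rfl; simp at h1; linarith
  have hexpz := Complex.exp_log hz
  have hmem : Complex.log z ∈ A := hlog _ (by rwa [hexpz]) (by rwa [hexpz])
  -- This branch of the logarithm is differentiable at `z` even on the cut of `Complex.log`; by
  -- periodicity of `Φ` the choice of branch does not affect the primitive.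
  have hℓ : HasDerivAt (fun w => Complex.log (w / z) + Complex.log z) z⁻¹ z := by
    have h3 : HasDerivAt (fun w => w / z) (1 / z) z := (hasDerivAt_id z).div_const z
    have h4 := (h3.clog (by simp [hz])).add_const (Complex.log z)
    simpa [hz] using h4
  have h5 := (hΦd _ hmem)
  rw [hexpz] at h5
  have h6 : HasDerivAt (fun w => Φ (Complex.log (w / z) + Complex.log z))
      ((G z * z - κ / τ) * z⁻¹) z := by
    refine HasDerivAt.comp_of_eq z h5 hℓ ?_
    simp [hz]
  have h7 : (G z * z - κ / τ) * z⁻¹ = G z - κ / τ * z⁻¹ := by field_simp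
  rw [h7] at h6
  refine h6.congr_of_eventuallyEq ?_
  filter_upwards [isOpen_ne.mem_nhds hz] with w hw
  rw [← hMexp (Complex.log (w / z) + Complex.log z), Complex.exp_add, hexpz,
    Complex.exp_log (div_ne_zero hw hz), div_mul_cancel₀ _ hz]

/-- Near `a`, the function `F` is holomorphic except for at most a simple pole at `a`. -/
def SimplePoleAt (F : ℂ → ℂ) (a : ℂ) : Prop :=
  ∃ g : ℂ → ℂ, AnalyticAt ℂ g a ∧ ∀ᶠ z in 𝓝[≠] a, F z = g z / (z - a)

/-- `F` is holomorphic on `ℂ ∖ {0}` except for at most simple poles at points of `P`. -/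
structure GoodOn (P : Set ℂ) (F : ℂ → ℂ) : Prop where
  analyticAt : ∀ z, z ≠ 0 → z ∉ P → AnalyticAt ℂ F z
  simplePoleAt : ∀ z ∈ P, SimplePoleAt F z

/-- Subsets of `ℂ ∖ {0}` whose only possible accumulation points are `0` and `∞`. -/
structure LocFin (P : Set ℂ) : Prop where
  zero_notMem : (0 : ℂ) ∉ P
  finite : ∀ ρ R : ℝ, 0 < ρ → (P ∩ {z | ρ ≤ ‖z‖ ∧ ‖z‖ ≤ R}).Finite

lemma LocFin.countable {P : Set ℂ} (hP : LocFin P) : P.Countable := by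
  have h : P ⊆ ⋃ n : ℕ, P ∩ {z | (1 / ((n : ℝ) + 1)) ≤ ‖z‖ ∧ ‖z‖ ≤ n} := by
    intro z hz
    have hz0 : 0 < ‖z‖ := norm_pos_iff.mpr fun h => hP.zero_notMem (h ▸ hz)
    obtain ⟨n, hn⟩ := exists_nat_one_div_lt hz0
    obtain ⟨m, hm⟩ := exists_nat_ge ‖z‖
    refine mem_iUnion.mpr ⟨max n m, hz, ?_, ?_⟩
    · refine le_trans ?_ hn.le
      gcongr
      exact le_max_left _ _
    · exact hm.trans (by exact_mod_cast le_max_right _ _)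
  exact (countable_iUnion fun n => (hP.finite _ _ (by positivity)).countable).mono h

/-- If the numerator vanishes at `a`, the quotient is `dslope g a` and the singularity is removable;
otherwise the order is exactly `-1`. -/
lemma isPole_iff_of_eventually_eq {F g : ℂ → ℂ} {a : ℂ} (hg : AnalyticAt ℂ g a)
    (h : ∀ᶠ z in 𝓝[≠] a, F z = g z / (z - a)) : IsPole F a ↔ g a ≠ 0 := by
  constructor
  · rintro ⟨-, hlt⟩ h0
    have h1 : AnalyticAt ℂ (dslope g a) a := by
      obtain ⟨p, hp⟩ := hg
      exact ⟨_, hp.has_fpower_series_dslope_fslope⟩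
    have h2 : meromorphicOrderAt F a = meromorphicOrderAt (dslope g a) a := by
      refine meromorphicOrderAt_congr ?_
      filter_upwards [h, self_mem_nhdsWithin] with z hz hza
      rw [hz, dslope_of_ne _ hza, slope_def_field, h0, sub_zero]
    rw [h2] at hlt
    exact absurd h1.meromorphicOrderAt_nonneg (not_le.mpr hlt)
  · intro h0
    have hm : MeromorphicAt F a := by
      have : MeromorphicAt (fun z => g z / (z - a)) a :=
        hg.meromorphicAt.div (analyticAt_id.sub analyticAt_const).meromorphicAt
      exact this.congr (by filter_upwards [h] with z hz using hz.symm)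
    refine ⟨hm, ?_⟩
    have : meromorphicOrderAt F a = ((-1 : ℤ) : WithTop ℤ) := by
      rw [meromorphicOrderAt_eq_int_iff hm]
      refine ⟨g, hg, h0, ?_⟩
      filter_upwards [h] with z hz
      rw [hz, zpow_neg_one, smul_eq_mul, div_eq_inv_mul]
    rw [this]
    exact_mod_cast (by norm_num : (-1 : ℤ) < 0)

lemma not_isPole_of_analyticAt {F : ℂ → ℂ} {a : ℂ} (hF : AnalyticAt ℂ F a) : ¬ IsPole F a :=
  fun h => absurd hF.meromorphicOrderAt_nonneg (not_le.mpr h.2)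

lemma contourIntegral_inv_sub {γ : ℝ → ℂ} (a : ℂ) :
    contourIntegral γ (fun z => (z - a)⁻¹) = 2 * Real.pi * Complex.I * windingNumber γ a := by
  rw [windingNumber, mul_inv_cancel_left₀ Complex.two_pi_I_ne_zero]

lemma IsClosedPath.integral_deriv {γ : ℝ → ℂ} (hγ : IsClosedPath γ) {F M : ℂ → ℂ}
    (hF : ContinuousOn F (γ '' Icc 0 1))
    (hM : ∀ t ∈ Icc (0 : ℝ) 1, HasDerivAt M (F (γ t)) (γ t)) : contourIntegral γ F = 0 := by
  rw [isClosedPath_iff] at hγ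
  rw [contourIntegral, hγ.1.integral_deriv hF hM, hγ.2, sub_self]

/-- The residue theorem in `ℂ ∖ {0}` for functions with simple poles. -/
theorem residue_theorem {P : Set ℂ} (hP : LocFin P) {F : ℂ → ℂ} (hF : GoodOn P F)
    {ρ R : ℝ} (hρ : 0 < ρ) : ∃ (S : Finset ℂ) (r : ℂ → ℂ) (c : ℂ),
      (∀ a ∈ S, a ∈ P ∧ IsPole F a) ∧
      ∀ γ : ℝ → ℂ, IsClosedPath γ → (∀ t ∈ Icc (0 : ℝ) 1, ρ < ‖γ t‖ ∧ ‖γ t‖ < R) →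
        (∀ a ∈ S, ∀ t ∈ Icc (0 : ℝ) 1, γ t ≠ a) →
        contourIntegral γ F = 2 * Real.pi * Complex.I *
          (c * windingNumber γ 0 + ∑ a ∈ S, r a * windingNumber γ a) := by
  classical
  have hfin := hP.finite ρ R hρ
  choose! g hg hFg using hF.simplePoleAt
  set S₀ := hfin.toFinset with hS₀
  have hmem : ∀ a, a ∈ S₀ ↔ a ∈ P ∧ ρ ≤ ‖a‖ ∧ ‖a‖ ≤ R := by intro a; simp [hS₀]
  -- Only genuine poles are kept, so that a path is free to meet the removable singularities in `P`.
  set S := S₀.filter (fun a => g a a ≠ 0) with hS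
  have hpole : ∀ a ∈ P, (IsPole F a ↔ g a a ≠ 0) := fun a ha =>
    isPole_iff_of_eventually_eq (hg a ha) (hFg a ha)
  -- `F` minus its principal parts, with the removable singularities filled in. At `z ∈ S₀` the
  -- regular part of `F` has the value `g'(z)`, and the summand `a = z` contributes nothing since
  -- `0⁻¹ = 0`.
  set G : ℂ → ℂ := fun z => (if z ∈ S₀ then deriv (g z) z else F z) -
    ∑ a ∈ S₀, g a a * (z - a)⁻¹ with hG
  have hGd : ∀ z : ℂ, ρ < ‖z‖ → ‖z‖ < R → DifferentiableAt ℂ G z := by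
    intro z h1 h2
    have hz0 : z ≠ 0 := by rintro rfl; simp at h1; linarith
    by_cases hz : z ∈ S₀
    · have hzP := ((hmem z).mp hz).1
      have h3 : AnalyticAt ℂ (dslope (g z) z) z := by
        obtain ⟨p, hp⟩ := hg z hzP
        exact ⟨_, hp.has_fpower_series_dslope_fslope⟩
      have h4 : DifferentiableAt ℂ (fun w => dslope (g z) z w -
          ∑ a ∈ S₀.erase z, g a a * (w - a)⁻¹) z := by
        refine h3.differentiableAt.sub (DifferentiableAt.fun_sum fun a ha => ?_)
        have : z - a ≠ 0 := sub_ne_zero.mpr (Finset.ne_of_mem_erase ha).symm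
        exact ((differentiableAt_id.sub_const a).inv this).const_mul _
      refine h4.congr_of_eventuallyEq ?_
      have h5 := eventually_nhdsWithin_iff.mp (hFg z hzP)
      have h6 : ∀ᶠ w in 𝓝 z, w ∉ S₀.erase z :=
        ((S₀.erase z).finite_toSet.isClosed.isOpen_compl).mem_nhds (by simp)
      filter_upwards [h5, h6] with w hw hw'
      rw [hG]
      by_cases hwz : w = z
      · subst hwz
        simp only [hz, if_true, dslope_same]
        rw [← Finset.add_sum_erase _ _ hz]
        simp
      · have : w ∉ S₀ := fun h => hw' (Finset.mem_erase.mpr ⟨hwz, h⟩)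
        simp only [this, if_false]
        rw [← Finset.add_sum_erase _ _ hz, hw hwz, dslope_of_ne _ hwz, slope_def_field]
        ring
    · have hzP : z ∉ P := fun h => hz ((hmem z).mpr ⟨h, h1.le, h2.le⟩)
      have h4 : DifferentiableAt ℂ (fun w => F w - ∑ a ∈ S₀, g a a * (w - a)⁻¹) z := by
        refine (hF.analyticAt z hz0 hzP).differentiableAt.sub
          (DifferentiableAt.fun_sum fun a ha => ?_)
        have : z - a ≠ 0 := sub_ne_zero.mpr (by rintro rfl; exact hz ha)
        exact ((differentiableAt_id.sub_const a).inv this).const_mul _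
      refine h4.congr_of_eventuallyEq ?_
      have h6 : ∀ᶠ w in 𝓝 z, w ∉ S₀ :=
        (S₀.finite_toSet.isClosed.isOpen_compl).mem_nhds (by simpa using hz)
      filter_upwards [h6] with w hw
      simp [hG, hw]
  obtain ⟨c, M, hM⟩ := exists_primitive_annulus (R := R) hρ hGd
  refine ⟨S, fun a => g a a, c, fun a ha => ?_, fun γ hγ hann hav => ?_⟩
  · rw [hS, Finset.mem_filter, hmem] at ha
    exact ⟨ha.1.1, (hpole a ha.1.1).mpr ha.2⟩
  have hpc := (isClosedPath_iff.mp hγ).1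
  have hne : ∀ a ∈ S, ∀ w ∈ γ '' Icc 0 1, w - a ≠ 0 := by
    rintro a ha - ⟨t, ht, rfl⟩
    exact sub_ne_zero.mpr (hav a ha t ht)
  have hne0 : ∀ w ∈ γ '' Icc 0 1, w - 0 ≠ 0 := by
    rintro - ⟨t, ht, rfl⟩ h0
    have := (hann t ht).1
    rw [sub_zero] at h0
    rw [h0, norm_zero] at this
    linarith
  have hcG : ContinuousOn (fun z => G z - c * z⁻¹) (γ '' Icc 0 1) := by
    rintro - ⟨t, ht, rfl⟩
    have h0 := hne0 (γ t) (mem_image_of_mem _ ht)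
    rw [sub_zero] at h0
    exact ((hGd _ (hann t ht).1 (hann t ht).2).continuousAt.sub
      (continuousAt_const.mul (continuousAt_inv₀ h0))).continuousWithinAt
  have hz1 := hγ.integral_deriv hcG fun t ht => hM _ (hann t ht).1 (hann t ht).2
  have hcS : ∀ a ∈ S, ContinuousOn (fun z => g a a * (z - a)⁻¹) (γ '' Icc 0 1) := fun a ha =>
    continuousOn_const.mul ((continuousOn_id.sub continuousOn_const).inv₀ (hne a ha))
  have hc0 : ContinuousOn (fun z => c * (z - 0)⁻¹) (γ '' Icc 0 1) :=
    continuousOn_const.mul ((continuousOn_id.sub continuousOn_const).inv₀ hne0)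
  -- The two integrands may differ on the finite set `S₀`, where `F` itself was not used to define
  -- `G`.
  have hcong : contourIntegral γ F = contourIntegral γ (fun z => (G z - c * z⁻¹) +
      (c * (z - 0)⁻¹ + ∑ a ∈ S, g a a * (z - a)⁻¹)) := by
    refine contourIntegral_congr S₀.countable_toSet fun t ht hnm => ?_
    have h1 : γ t ∉ S₀ := by simpa using hnm
    have h2 : ∑ a ∈ S, g a a * (γ t - a)⁻¹ = ∑ a ∈ S₀, g a a * (γ t - a)⁻¹ := by
      rw [hS, Finset.sum_filter]
      refine Finset.sum_congr rfl fun a _ => ?_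
      by_cases h : g a a = 0 <;> simp [h]
    simp only [h2, hG, h1, if_false, sub_zero]
    ring
  have hmul : ∀ (k a : ℂ), contourIntegral γ (fun z => k * (z - a)⁻¹) =
      k * (2 * Real.pi * Complex.I * windingNumber γ a) := by
    intro k a
    rw [← contourIntegral_inv_sub, contourIntegral, contourIntegral,
      ← intervalIntegral.integral_const_mul]
    simp only [mul_assoc]
  have hint := fun a ha => hpc.intervalIntegrable (hcS a ha)
  have hsum : IntervalIntegrable (fun t => ∑ a ∈ S, g a a * (γ t - a)⁻¹ * deriv γ t) volume 0 1 := by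
    have h := IntervalIntegrable.sum S hint
    rwa [Finset.sum_fn] at h
  rw [hcong]
  calc _ = contourIntegral γ (fun z => G z - c * z⁻¹) +
        (contourIntegral γ (fun z => c * (z - 0)⁻¹) +
        ∑ a ∈ S, contourIntegral γ (fun z => g a a * (z - a)⁻¹)) := by
        simp only [contourIntegral]
        rw [← intervalIntegral.integral_finsetSum hint, ← intervalIntegral.integral_add
          (hpc.intervalIntegrable hc0) hsum,
          ← intervalIntegral.integral_add (hpc.intervalIntegrable hcG)
          ((hpc.intervalIntegrable hc0).add hsum)]
        refine intervalIntegral.integral_congr fun t _ => ?_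
        simp only [add_mul, Finset.sum_mul]
    _ = _ := by
        rw [hz1, hmul, zero_add, mul_add, Finset.mul_sum]
        congr 1
        · ring
        · refine Finset.sum_congr rfl fun a _ => ?_
          rw [hmul]; ring

lemma IsClosedPath.exists_norm_bounds {γ : ℝ → ℂ} (hγ : IsClosedPath γ)
    (h0 : ∀ t ∈ Icc (0 : ℝ) 1, γ t ≠ 0) :
    ∃ ρ R : ℝ, 0 < ρ ∧ ∀ t ∈ Icc (0 : ℝ) 1, ρ < ‖γ t‖ ∧ ‖γ t‖ < R := by
  have hc : ContinuousOn (fun t => ‖γ t‖) (Icc 0 1) := hγ.1.norm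
  obtain ⟨s, hs, hs'⟩ := isCompact_Icc.exists_isMinOn (nonempty_Icc.mpr zero_le_one) hc
  obtain ⟨u, hu, hu'⟩ := isCompact_Icc.exists_isMaxOn (nonempty_Icc.mpr zero_le_one) hc
  have := norm_pos_iff.mpr (h0 s hs)
  refine ⟨‖γ s‖ / 2, ‖γ u‖ + 1, by linarith, fun t ht => ⟨?_, ?_⟩⟩
  · have := hs' ht
    simp only [mem_ofPred_eq] at this
    linarith
  · have := hu' ht
    simp only [mem_ofPred_eq] at this
    linarith

/-- Closed paths with proportional winding numbers have proportional integrals. -/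
theorem contourIntegral_eq_mul {P : Set ℂ} (hP : LocFin P) {F : ℂ → ℂ} (hF : GoodOn P F)
    {γ γ' : ℝ → ℂ} (hγ : IsClosedPath γ) (hγ' : IsClosedPath γ') (s : ℂ)
    (h0 : ∀ t ∈ Icc (0 : ℝ) 1, γ t ≠ 0 ∧ γ' t ≠ 0)
    (hav : ∀ a ∈ P, IsPole F a → (∀ t ∈ Icc (0 : ℝ) 1, γ t ≠ a ∧ γ' t ≠ a) ∧
      windingNumber γ a = s * windingNumber γ' a)
    (hw : windingNumber γ 0 = s * windingNumber γ' 0) :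
    contourIntegral γ F = s * contourIntegral γ' F := by
  obtain ⟨ρ, R, hρ, hb⟩ := hγ.exists_norm_bounds fun t ht => (h0 t ht).1
  obtain ⟨ρ', R', hρ', hb'⟩ := hγ'.exists_norm_bounds fun t ht => (h0 t ht).2
  obtain ⟨S, r, c, hS, h⟩ := residue_theorem (R := max R R') hP hF (lt_min hρ hρ')
  rw [h γ hγ (fun t ht => ⟨(min_le_left _ _).trans_lt (hb t ht).1,
      (hb t ht).2.trans_le (le_max_left _ _)⟩)
      (fun a ha t ht => ((hav a (hS a ha).1 (hS a ha).2).1 t ht).1),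
    h γ' hγ' (fun t ht => ⟨(min_le_right _ _).trans_lt (hb' t ht).1,
      (hb' t ht).2.trans_le (le_max_right _ _)⟩)
      (fun a ha t ht => ((hav a (hS a ha).1 (hS a ha).2).1 t ht).2), hw,
    Finset.sum_congr rfl fun a ha => by rw [(hav a (hS a ha).1 (hS a ha).2).2]]
  simp only [mul_left_comm _ s, ← Finset.mul_sum]
  ring

/-! ### Integrals against `dz/z` and the substitutions `z ↦ cz` and `z ↦ 1/(cz)`. -/

/-- The integral of `G(z) dz/z`. -/
def logIntegral (γ : ℝ → ℂ) (G : ℂ → ℂ) : ℂ := contourIntegral γ (fun z => G z / z)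

lemma contourIntegral_comp {γ : ℝ → ℂ} (hγ : PiecewiseC1 γ 0 1) {φ φ' : ℂ → ℂ}
    (hφ : ∀ t ∈ Icc (0 : ℝ) 1, HasDerivAt φ (φ' (γ t)) (γ t)) (F : ℂ → ℂ) :
    contourIntegral (fun t => φ (γ t)) F = contourIntegral γ (fun z => F (φ z) * φ' z) := by
  obtain ⟨s, hs, hd⟩ := hγ.ae_differentiableAt
  refine intervalIntegral.integral_congr_ae ?_
  filter_upwards [(hs.insert 1).countable.ae_notMem volume] with t ht ht'
  rw [uIoc_of_le zero_le_one] at ht'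
  rw [mem_insert_iff, not_or] at ht
  have h1 := hd t ⟨ht'.1, lt_of_le_of_ne ht'.2 ht.1⟩ ht.2
  have h2 : HasDerivAt (fun t => φ (γ t)) (φ' (γ t) * deriv γ t) t :=
    (hφ t (Ioc_subset_Icc_self ht')).comp_of_eq t h1.hasDerivAt rfl
  rw [h2.deriv, mul_assoc]

lemma IsClosedPath.comp {γ : ℝ → ℂ} (hγ : IsClosedPath γ) {φ : ℂ → ℂ} {U : Set ℂ}
    (hφ : ContDiffOn ℝ 1 φ U) (hU : ∀ t ∈ Icc (0 : ℝ) 1, γ t ∈ U) :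
    IsClosedPath (fun t => φ (γ t)) := by
  rw [isClosedPath_iff] at hγ ⊢
  exact ⟨hγ.1.comp_contDiffOn hφ hU, by simp only [hγ.2]⟩

lemma contourIntegral_add {γ : ℝ → ℂ} (hγ : IsClosedPath γ) {F G : ℂ → ℂ}
    (hF : ContinuousOn F (γ '' Icc 0 1)) (hG : ContinuousOn G (γ '' Icc 0 1)) :
    contourIntegral γ (fun z => F z + G z) = contourIntegral γ F + contourIntegral γ G := by
  have h := (isClosedPath_iff.mp hγ).1
  simp only [contourIntegral]
  rw [← intervalIntegral.integral_add (h.intervalIntegrable hF) (h.intervalIntegrable hG)]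
  simp only [add_mul]

lemma contourIntegral_const_mul (γ : ℝ → ℂ) (k : ℂ) (F : ℂ → ℂ) :
    contourIntegral γ (fun z => k * F z) = k * contourIntegral γ F := by
  simp only [contourIntegral]
  rw [← intervalIntegral.integral_const_mul]
  simp only [mul_assoc]

lemma logIntegral_const_mul (γ : ℝ → ℂ) (k : ℂ) (F : ℂ → ℂ) :
    logIntegral γ (fun z => k * F z) = k * logIntegral γ F := by
  rw [logIntegral, logIntegral, ← contourIntegral_const_mul]
  simp only [mul_div_assoc]

lemma logIntegral_add {γ : ℝ → ℂ} (hγ : IsClosedPath γ) (h0 : ∀ t ∈ Icc (0 : ℝ) 1, γ t ≠ 0)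
    {F G : ℂ → ℂ} (hF : ContinuousOn F (γ '' Icc 0 1)) (hG : ContinuousOn G (γ '' Icc 0 1)) :
    logIntegral γ (fun z => F z + G z) = logIntegral γ F + logIntegral γ G := by
  have hne : ∀ w ∈ γ '' Icc 0 1, w ≠ 0 := by rintro - ⟨t, ht, rfl⟩; exact h0 t ht
  have := contourIntegral_add hγ (F := fun z => F z / z) (G := fun z => G z / z)
    (hF.div continuousOn_id hne) (hG.div continuousOn_id hne)
  simpa only [logIntegral, add_div] using this

lemma contourIntegral_congr' {γ : ℝ → ℂ} {F G : ℂ → ℂ}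
    (h : ∀ t ∈ Icc (0 : ℝ) 1, F (γ t) = G (γ t)) : contourIntegral γ F = contourIntegral γ G :=
  contourIntegral_congr countable_empty fun t ht _ => h t ht

lemma logIntegral_congr {γ : ℝ → ℂ} {F G : ℂ → ℂ}
    (h : ∀ t ∈ Icc (0 : ℝ) 1, F (γ t) = G (γ t)) : logIntegral γ F = logIntegral γ G :=
  contourIntegral_congr' fun t ht => by rw [h t ht]

lemma hasDerivAt_inv_mul {c z : ℂ} (hc : c ≠ 0) (hz : z ≠ 0) :
    HasDerivAt (fun z => (c * z)⁻¹) (-(c * z ^ 2)⁻¹) z := by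
  have := ((hasDerivAt_id z).const_mul c).inv (mul_ne_zero hc hz)
  refine this.congr_deriv ?_
  simp only [id]
  field_simp

section Inversion

variable {γ : ℝ → ℂ} {c : ℂ}

lemma IsClosedPath.inv_mul (hγ : IsClosedPath γ) (hc : c ≠ 0)
    (h0 : ∀ t ∈ Icc (0 : ℝ) 1, γ t ≠ 0) : IsClosedPath (fun t => (c * γ t)⁻¹) := by
  refine hγ.comp (φ := fun z => (c * z)⁻¹) (U := {0}ᶜ) ?_ (fun t ht => h0 t ht)
  exact (contDiffOn_const.mul contDiffOn_id).inv fun z hz => mul_ne_zero hc hz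

lemma logIntegral_inv_mul (hγ : IsClosedPath γ) (hc : c ≠ 0)
    (h0 : ∀ t ∈ Icc (0 : ℝ) 1, γ t ≠ 0) (G : ℂ → ℂ) :
    logIntegral (fun t => (c * γ t)⁻¹) G = - logIntegral γ (fun z => G (c * z)⁻¹) := by
  rw [logIntegral, contourIntegral_comp (φ := fun z => (c * z)⁻¹) (φ' := fun z => -(c * z ^ 2)⁻¹)
    (isClosedPath_iff.mp hγ).1
    (fun t ht => hasDerivAt_inv_mul hc (h0 t ht)), logIntegral, neg_eq_neg_one_mul,
    ← contourIntegral_const_mul]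
  refine contourIntegral_congr' fun t ht => ?_
  have := h0 t ht
  field_simp

lemma logIntegral_mul (hγ : IsClosedPath γ) (hc : c ≠ 0) (h0 : ∀ t ∈ Icc (0 : ℝ) 1, γ t ≠ 0)
    (G : ℂ → ℂ) : logIntegral (fun t => c * γ t) G = logIntegral γ (fun z => G (c * z)) := by
  rw [logIntegral, contourIntegral_comp (φ := fun z => c * z) (φ' := fun _ => c)
    (isClosedPath_iff.mp hγ).1 (fun t ht => by simpa using (hasDerivAt_id (γ t)).const_mul c),
    logIntegral]
  refine contourIntegral_congr' fun t ht => ?_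
  have := h0 t ht
  field_simp

lemma windingNumber_zero_eq : windingNumber γ 0 =
    (2 * Real.pi * Complex.I)⁻¹ * logIntegral γ (fun _ => 1) := by
  simp [windingNumber, logIntegral]

lemma windingNumber_inv_mul_zero (hγ : IsClosedPath γ) (hc : c ≠ 0)
    (h0 : ∀ t ∈ Icc (0 : ℝ) 1, γ t ≠ 0) :
    windingNumber (fun t => (c * γ t)⁻¹) 0 = - windingNumber γ 0 := by
  rw [windingNumber_zero_eq, windingNumber_zero_eq, logIntegral_inv_mul hγ hc h0, mul_neg]

lemma windingNumber_mul_zero (hγ : IsClosedPath γ) (hc : c ≠ 0)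
    (h0 : ∀ t ∈ Icc (0 : ℝ) 1, γ t ≠ 0) :
    windingNumber (fun t => c * γ t) 0 = windingNumber γ 0 := by
  rw [windingNumber_zero_eq, windingNumber_zero_eq, logIntegral_mul hγ hc h0]

/-- Under `w = 1/(cz)` the form `dw/(w - a)` becomes `dz/(z - 1/(ca)) - dz/z`. -/
lemma windingNumber_inv_mul (hγ : IsClosedPath γ) (hc : c ≠ 0)
    (h0 : ∀ t ∈ Icc (0 : ℝ) 1, γ t ≠ 0) {a : ℂ} (ha : a ≠ 0)
    (hav : ∀ t ∈ Icc (0 : ℝ) 1, γ t ≠ (c * a)⁻¹) :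
    windingNumber (fun t => (c * γ t)⁻¹) a =
      windingNumber γ (c * a)⁻¹ - windingNumber γ 0 := by
  have hne : ∀ w ∈ γ '' Icc 0 1, w - (c * a)⁻¹ ≠ 0 := by
    rintro - ⟨t, ht, rfl⟩; exact sub_ne_zero.mpr (hav t ht)
  have hne0 : ∀ w ∈ γ '' Icc 0 1, w - 0 ≠ 0 := by
    rintro - ⟨t, ht, rfl⟩; rw [sub_zero]; exact h0 t ht
  rw [windingNumber, contourIntegral_comp (φ := fun z => (c * z)⁻¹) (φ' := fun z => -(c * z ^ 2)⁻¹)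
    (isClosedPath_iff.mp hγ).1
    (fun t ht => hasDerivAt_inv_mul hc (h0 t ht)), windingNumber, windingNumber, ← mul_sub]
  congr 1
  rw [sub_eq_add_neg, neg_eq_neg_one_mul (contourIntegral _ _), ← contourIntegral_const_mul,
    ← contourIntegral_add hγ (F := fun z => (z - (c * a)⁻¹)⁻¹) (G := fun z => -1 * (z - 0)⁻¹)
    ((continuousOn_id.sub continuousOn_const).inv₀ hne)
    (continuousOn_const.mul ((continuousOn_id.sub continuousOn_const).inv₀ hne0))]
  refine contourIntegral_congr' fun t ht => ?_
  have h1 := h0 t ht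
  have h2 := hne _ (mem_image_of_mem _ ht)
  have h3 : (c * γ t)⁻¹ - a ≠ 0 := by
    intro h
    apply h2
    rw [sub_eq_zero] at h ⊢
    rw [← h]
    field_simp
  have h4 : 1 - c * γ t * a ≠ 0 := by
    intro h
    apply h3
    field_simp
    rw [h, mul_zero]
  have h5 : c * γ t * a - 1 ≠ 0 := fun h => h4 (by linear_combination -h)
  have e1 : (c * γ t)⁻¹ - a = (1 - c * γ t * a) / (c * γ t) := by field_simp
  have e2 : γ t - (c * a)⁻¹ = (c * γ t * a - 1) / (c * a) := by field_simp
  rw [e1, e2, sub_zero]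
  field_simp
  ring

end Inversion

/-! ### Paths separating two sets of points. -/

/-- A closed path in `ℂ ∖ {0}` winding once around `0` and the points of `P`, and not around the
points of `Q`. -/
structure Separates (P Q : Set ℂ) (γ : ℝ → ℂ) : Prop where
  isClosedPath : IsClosedPath γ
  ne_zero : ∀ t ∈ Icc (0 : ℝ) 1, γ t ≠ 0
  avoid_left : ∀ a ∈ P, ∀ t ∈ Icc (0 : ℝ) 1, γ t ≠ a
  avoid_right : ∀ a ∈ Q, ∀ t ∈ Icc (0 : ℝ) 1, γ t ≠ a
  winding_zero : windingNumber γ 0 = 1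
  winding_left : ∀ a ∈ P, windingNumber γ a = 1
  winding_right : ∀ a ∈ Q, windingNumber γ a = 0

lemma SimplePoleAt.mul_analytic {F G : ℂ → ℂ} {a : ℂ} (hF : SimplePoleAt F a)
    (hG : AnalyticAt ℂ G a) : SimplePoleAt (fun z => F z * G z) a := by
  obtain ⟨g, hg, h⟩ := hF
  refine ⟨fun z => g z * G z, hg.mul hG, ?_⟩
  filter_upwards [h] with z hz
  rw [hz]; ring

lemma GoodOn.mul_analytic {P : Set ℂ} (h0 : (0 : ℂ) ∉ P) {F G : ℂ → ℂ} (hF : GoodOn P F)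
    (hG : ∀ z, z ≠ 0 → AnalyticAt ℂ G z) : GoodOn P (fun z => F z * G z) where
  analyticAt z hz hzP := (hF.analyticAt z hz hzP).mul (hG z hz)
  simplePoleAt z hz := (hF.simplePoleAt z hz).mul_analytic (hG z fun h => h0 (h ▸ hz))

lemma GoodOn.div_id {P : Set ℂ} (h0 : (0 : ℂ) ∉ P) {F : ℂ → ℂ} (hF : GoodOn P F) :
    GoodOn P (fun z => F z / z) := by
  simp only [div_eq_mul_inv]
  exact hF.mul_analytic h0 fun z hz => analyticAt_inv hz

lemma simplePoleAt_of_analyticAt {F : ℂ → ℂ} {a : ℂ} (hF : AnalyticAt ℂ F a) : SimplePoleAt F a := by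
  refine ⟨fun z => F z * (z - a), hF.mul (analyticAt_id.sub analyticAt_const), ?_⟩
  filter_upwards [self_mem_nhdsWithin] with z hz
  rw [mul_div_cancel_right₀ _ (sub_ne_zero.mpr hz)]

/-- All poles of `F` lie in `P ∪ Q`, where both paths have the same winding numbers; what the second
path does at the additional points of `P'` and `Q'` is immaterial. -/
lemma Separates.logIntegral_eq {P Q P' Q' : Set ℂ} {γ γ' : ℝ → ℂ} {F : ℂ → ℂ}
    (hP : LocFin (P ∪ Q)) (hF : GoodOn (P ∪ Q) F) (h : Separates P Q γ) (h' : Separates P' Q' γ')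
    (hPP : P ⊆ P') (hQQ : Q ⊆ Q') : logIntegral γ F = logIntegral γ' F := by
  have := contourIntegral_eq_mul hP (hF.div_id hP.zero_notMem) h.isClosedPath h'.isClosedPath 1
    (fun t ht => ⟨h.ne_zero t ht, h'.ne_zero t ht⟩) ?_ (by rw [h.winding_zero, h'.winding_zero, mul_one])
  · rw [logIntegral, this, one_mul, logIntegral]
  · rintro a (ha | ha) -
    · exact ⟨fun t ht => ⟨h.avoid_left a ha t ht, h'.avoid_left a (hPP ha) t ht⟩,
        by rw [h.winding_left a ha, h'.winding_left a (hPP ha), mul_one]⟩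
    · exact ⟨fun t ht => ⟨h.avoid_right a ha t ht, h'.avoid_right a (hQQ ha) t ht⟩,
        by rw [h.winding_right a ha, h'.winding_right a (hQQ ha), mul_zero]⟩

/-- The image of the path under `z ↦ 1/(cz)` has the opposite winding number around `0` and around
each possible pole: `0 - 1` at points of `P'` and `1 - 1` at points of `Q'`. The integral over the
image is thus minus the original one. By substitution it is also plus the original one, since both
`dz/z` and `T` change sign. Hence it is zero. -/
lemma Separates.logIntegral_eq_zero {P Q P' Q' : Set ℂ} {γ : ℝ → ℂ} {T : ℂ → ℂ} {c : ℂ}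
    (hc : c ≠ 0) (h : Separates P Q γ) (hP : P' ⊆ P) (hQ : Q' ⊆ Q)
    (hPQ : ∀ a ∈ P', (c * a)⁻¹ ∈ Q) (hQP : ∀ a ∈ Q', (c * a)⁻¹ ∈ P) (hfin : LocFin (P' ∪ Q'))
    (hT : GoodOn (P' ∪ Q') T) (hanti : ∀ z, z ≠ 0 → T (c * z)⁻¹ = - T z) :
    logIntegral γ T = 0 := by
  have h1 := contourIntegral_eq_mul hfin (hT.div_id hfin.zero_notMem)
    (h.isClosedPath.inv_mul hc h.ne_zero) h.isClosedPath (-1)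
    (fun t ht => ⟨inv_ne_zero (mul_ne_zero hc (h.ne_zero t ht)), h.ne_zero t ht⟩) ?_
    (by rw [windingNumber_inv_mul_zero h.isClosedPath hc h.ne_zero, neg_one_mul])
  · change logIntegral _ T = -1 * logIntegral γ T at h1
    rw [logIntegral_inv_mul h.isClosedPath hc h.ne_zero] at h1
    have h2 : logIntegral γ (fun z => T (c * z)⁻¹) = - logIntegral γ T := by
      rw [neg_eq_neg_one_mul, ← logIntegral_const_mul]
      refine logIntegral_congr fun t ht => ?_
      rw [hanti _ (h.ne_zero t ht), neg_one_mul]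
    rw [h2] at h1
    linear_combination h1 / 2
  · intro a ha _
    have ha0 : a ≠ 0 := fun h => hfin.zero_notMem (h ▸ ha)
    have hkey : ∀ t, (c * γ t)⁻¹ = a → γ t = (c * a)⁻¹ := by
      intro t ht
      rw [← ht]
      field_simp
    rcases ha with ha | ha
    · have hav := h.avoid_right _ (hPQ a ha)
      refine ⟨fun t ht => ⟨fun he => hav t ht (hkey t he), h.avoid_left a (hP ha) t ht⟩, ?_⟩
      rw [windingNumber_inv_mul h.isClosedPath hc h.ne_zero ha0 hav,
        h.winding_right _ (hPQ a ha), h.winding_zero, h.winding_left a (hP ha)]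
      ring
    · have hav := h.avoid_left _ (hQP a ha)
      refine ⟨fun t ht => ⟨fun he => hav t ht (hkey t he), h.avoid_right a (hQ ha) t ht⟩, ?_⟩
      rw [windingNumber_inv_mul h.isClosedPath hc h.ne_zero ha0 hav,
        h.winding_left _ (hQP a ha), h.winding_zero, h.winding_right a (hQ ha)]
      ring

/-! ### Winding numbers of circles. -/

/-- The circle around `a` through `a + u`, starting at `a + u`. -/
def circlePath (a u : ℂ) (t : ℝ) : ℂ := a + u * Complex.exp (2 * Real.pi * Complex.I * t)

lemma hasDerivAt_circlePath (a u : ℂ) (t : ℝ) : HasDerivAt (circlePath a u)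
    (u * (Complex.exp (2 * Real.pi * Complex.I * t) * (2 * Real.pi * Complex.I))) t := by
  have h1 : HasDerivAt (fun s : ℝ => 2 * Real.pi * Complex.I * (s : ℂ)) (2 * Real.pi * Complex.I) t := by
    simpa using (Complex.ofRealCLM.hasDerivAt (x := t)).const_mul (2 * Real.pi * Complex.I : ℂ)
  exact (h1.cexp.const_mul u).const_add a

lemma circlePath_zero (a u : ℂ) : circlePath a u 0 = a + u := by simp [circlePath]

lemma circlePath_one (a u : ℂ) : circlePath a u 1 = a + u := by
  simp [circlePath, Complex.exp_two_pi_mul_I]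

lemma norm_circlePath_sub (a u : ℂ) (t : ℝ) : ‖circlePath a u t - a‖ = ‖u‖ := by
  rw [circlePath, add_sub_cancel_left, norm_mul, Complex.norm_exp]
  simp

lemma piecewiseC1_circlePath (a u : ℂ) : PiecewiseC1 (circlePath a u) 0 1 := by
  refine .single one_pos (ContDiff.contDiffOn ?_)
  have h : ContDiff ℝ 1 (fun t : ℝ => (t : ℂ)) := Complex.ofRealCLM.contDiff
  exact contDiff_const.add (contDiff_const.mul (contDiff_const.mul h).cexp)

lemma isClosedPath_circlePath (a u : ℂ) : IsClosedPath (circlePath a u) :=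
  isClosedPath_iff.mpr ⟨piecewiseC1_circlePath a u, by rw [circlePath_zero, circlePath_one]⟩

lemma windingNumber_circlePath_center (a : ℂ) {u : ℂ} (hu : u ≠ 0) :
    windingNumber (circlePath a u) a = 1 := by
  have : contourIntegral (circlePath a u) (fun z => (z - a)⁻¹) = 2 * Real.pi * Complex.I := by
    rw [contourIntegral]
    have : ∀ t ∈ Icc (0:ℝ) 1, (circlePath a u t - a)⁻¹ * deriv (circlePath a u) t =
        2 * Real.pi * Complex.I := by
      intro t _
      have := Complex.exp_ne_zero (2 * Real.pi * Complex.I * t)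
      rw [(hasDerivAt_circlePath a u t).deriv, circlePath, add_sub_cancel_left]
      field_simp
    rw [intervalIntegral.integral_congr (g := fun _ => 2 * Real.pi * Complex.I)
      (by rwa [uIcc_of_le zero_le_one])]
    simp
  rw [windingNumber, this, inv_mul_cancel₀ Complex.two_pi_I_ne_zero]

lemma one_sub_mem_slitPlane {w : ℂ} (h : ‖w‖ < 1) : 1 - w ∈ Complex.slitPlane := by
  rw [Complex.mem_slitPlane_iff]
  left
  have := (Complex.abs_re_le_norm w).trans_lt h
  rw [Complex.sub_re, Complex.one_re]
  linarith [(abs_lt.mp this).2]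

/-- For `w` outside the circle, `log (1 - (z - a)/(w - a))` is a primitive of `1/(z - w)` that stays
off the cut. -/
lemma windingNumber_circlePath_of_lt (a : ℂ) {u w : ℂ} (hw : ‖u‖ < ‖w - a‖) :
    windingNumber (circlePath a u) w = 0 := by
  have hwa : w - a ≠ 0 := norm_pos_iff.mp ((norm_nonneg u).trans_lt hw)
  have hlt : ∀ t, ‖(circlePath a u t - a) / (w - a)‖ < 1 := by
    intro t
    rw [norm_div, norm_circlePath_sub, div_lt_one (norm_pos_iff.mpr hwa)]
    exact hw
  have hne : ∀ t, circlePath a u t - w ≠ 0 := by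
    intro t h
    have := norm_circlePath_sub a u t
    rw [sub_eq_zero.mp h] at this
    linarith
  rw [windingNumber, (isClosedPath_circlePath a u).integral_deriv
    (M := fun z => Complex.log (1 - (z - a) / (w - a))), mul_zero]
  · refine (continuousOn_id.sub continuousOn_const).inv₀ ?_
    rintro - ⟨t, -, rfl⟩
    exact hne t
  · intro t _
    have h1 := ((((hasDerivAt_id (circlePath a u t)).sub_const a).div_const (w - a)).const_sub 1).clog
      (one_sub_mem_slitPlane (hlt t))
    refine h1.congr_deriv ?_
    have h2 := hne t
    have h3 : w - a - (circlePath a u t - a) ≠ 0 := fun h => h2 (by linear_combination -h)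
    simp only [id]
    field_simp
    ring

/-- Here `1/(z - w) = 1/z + w/(z(z - w))`, and the last term has the primitive `log (1 - w/z)` along
the circle. -/
lemma windingNumber_circlePath_zero_of_lt {u w : ℂ} (hw : ‖w‖ < ‖u‖) :
    windingNumber (circlePath 0 u) w = 1 := by
  have hu : u ≠ 0 := norm_pos_iff.mp ((norm_nonneg w).trans_lt hw)
  have hn : ∀ t, ‖circlePath 0 u t‖ = ‖u‖ := fun t => by
    simpa using norm_circlePath_sub 0 u t
  have h0 : ∀ t, circlePath 0 u t ≠ 0 := fun t => norm_pos_iff.mp (by rw [hn]; exact norm_pos_iff.mpr hu)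
  have hne : ∀ t, circlePath 0 u t - w ≠ 0 := by
    intro t h
    have := hn t
    rw [sub_eq_zero.mp h] at this
    linarith
  have hlt : ∀ t, ‖w / circlePath 0 u t‖ < 1 := by
    intro t
    rw [norm_div, hn, div_lt_one (norm_pos_iff.mpr hu)]
    exact hw
  have hc0 : ContinuousOn (fun z : ℂ => (z - 0)⁻¹) (circlePath 0 u '' Icc 0 1) := by
    refine (continuousOn_id.sub continuousOn_const).inv₀ ?_
    rintro - ⟨t, -, rfl⟩
    simpa using h0 t
  have hc1 : ContinuousOn (fun z : ℂ => w / (z * (z - w))) (circlePath 0 u '' Icc 0 1) := by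
    refine continuousOn_const.div (continuousOn_id.mul (continuousOn_id.sub continuousOn_const)) ?_
    rintro - ⟨t, -, rfl⟩
    exact mul_ne_zero (h0 t) (hne t)
  have h1 := (isClosedPath_circlePath 0 u).integral_deriv hc1
    (M := fun z => Complex.log (1 - w / z)) ?_
  · rw [← windingNumber_circlePath_center 0 hu, windingNumber, windingNumber]
    congr 1
    have e := contourIntegral_add (isClosedPath_circlePath 0 u) hc0 hc1
    rw [h1, add_zero] at e
    rw [← e]
    refine contourIntegral_congr' fun t _ => ?_
    have := h0 t
    have := hne t
    rw [sub_zero]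
    field_simp
    ring
  · intro t _
    have h1 := (((hasDerivAt_const (circlePath 0 u t) w).div (hasDerivAt_id _) (h0 t)).const_sub 1).clog
      (one_sub_mem_slitPlane (hlt t))
    refine h1.congr_deriv ?_
    have h2 := h0 t
    have h3 := hne t
    have h4 : 1 - w / circlePath 0 u t ≠ 0 := by
      intro h
      apply h3
      field_simp at h
      rw [h, mul_zero]
    simp only [id, Pi.div_apply]
    field_simp
    ring

/-! ### Construction of separating paths. -/

/-- `Φ` is the winding number function of a path in `U` from `p` to `q`. -/
def Joins (U : Set ℂ) (p q : ℂ) (Φ : ℂ → ℂ) : Prop :=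
  ∃ γ : ℝ → ℂ, PiecewiseC1 γ 0 1 ∧ γ 0 = p ∧ γ 1 = q ∧ (∀ t ∈ Icc (0 : ℝ) 1, γ t ∈ U) ∧
    ∀ a ∉ U, windingNumber γ a = Φ a

section Joins

variable {U : Set ℂ} {p q r : ℂ} {Φ Ψ : ℂ → ℂ}

lemma deriv_comp_affine (γ : ℝ → ℂ) (k m t : ℝ) :
    deriv (fun s => γ (k * s + m)) t = k * deriv γ (k * t + m) := by
  have h1 := deriv_comp_mul_left k (fun s => γ (s + m)) t
  rw [h1, deriv_comp_add_const, Complex.real_smul]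

lemma integral_comp_affine (γ : ℝ → ℂ) (F : ℂ → ℂ) {k : ℝ} (m a b : ℝ) :
    ∫ t in a..b, F (γ (k * t + m)) * deriv (fun s => γ (k * s + m)) t =
      ∫ t in (k * a + m)..(k * b + m), F (γ t) * deriv γ t := by
  have h := intervalIntegral.smul_integral_comp_mul_add (a := a) (b := b)
    (fun t => F (γ t) * deriv γ t) k m
  rw [← h, ← intervalIntegral.integral_smul]
  refine intervalIntegral.integral_congr fun t _ => ?_
  simp only [deriv_comp_affine, Complex.real_smul]
  ring

lemma Joins.symm (h : Joins U p q Φ) : Joins U q p (-Φ) := by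
  obtain ⟨γ, hγ, h0, h1, hU, hw⟩ := h
  refine ⟨fun t => γ (1 - t), by simpa using hγ.comp_neg 1, by simpa, by simpa,
    fun t ht => hU _ ⟨by linarith [ht.2], by linarith [ht.1]⟩, fun a ha => ?_⟩
  rw [Pi.neg_apply, ← hw a ha, windingNumber, windingNumber, ← mul_neg]
  congr 1
  have := integral_comp_affine γ (fun z => (z - a)⁻¹) (k := -1) 1 0 1
  have e : ∀ s : ℝ, -1 * s + 1 = 1 - s := fun s => by ring
  simp only [e] at this
  rw [contourIntegral, this, contourIntegral, sub_zero, sub_self, intervalIntegral.integral_symm]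

lemma Joins.trans (h : Joins U p q Φ) (h' : Joins U q r Ψ) : Joins U p r (Φ + Ψ) := by
  obtain ⟨γ, hγ, h0, h1, hU, hw⟩ := h
  obtain ⟨γ', hγ', h0', h1', hU', hw'⟩ := h'
  set δ : ℝ → ℂ := fun t => if t ≤ 1 / 2 then γ (2 * t + 0) else γ' (2 * t + (-1)) with hδ
  have e1 : ∀ t ∈ Icc (0 : ℝ) (1 / 2), δ t = γ (2 * t + 0) := fun t ht => by
    simp only [hδ, ht.2, if_true]
  have e2 : ∀ t ∈ Icc (1 / 2 : ℝ) 1, δ t = γ' (2 * t + (-1)) := fun t ht => by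
    rcases ht.1.eq_or_lt with h | h
    · rw [← h, hδ]
      norm_num [h1, h0']
    · simp only [hδ, not_le.mpr h, if_false]
  have c1 : PiecewiseC1 δ 0 (1 / 2) := by
    have := hγ.comp_affine (k := 2) two_pos 0
    norm_num at this
    exact this.congr fun t ht => by rw [e1 t (by simpa using ht), add_zero]
  have c2 : PiecewiseC1 δ (1 / 2) 1 := by
    have := hγ'.comp_affine (k := 2) two_pos (-1)
    norm_num at this
    exact this.congr fun t ht => by rw [e2 t (by simpa using ht)]
  have hUδ : ∀ t ∈ Icc (0 : ℝ) 1, δ t ∈ U := by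
    intro t ht
    rcases le_total t (1 / 2) with h | h
    · rw [e1 t ⟨ht.1, h⟩]
      exact hU _ ⟨by linarith [ht.1], by linarith⟩
    · rw [e2 t ⟨h, ht.2⟩]
      exact hU' _ ⟨by linarith, by linarith [ht.2]⟩
  refine ⟨δ, c1.trans c2, ?_, ?_, hUδ, fun a ha => ?_⟩
  · rw [e1 0 (by norm_num)]; simpa
  · rw [e2 1 (by norm_num)]; norm_num [h1']
  have hF : ∀ s ⊆ Icc (0 : ℝ) 1, ContinuousOn (fun z => (z - a)⁻¹) (δ '' s) := by
    intro s hs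
    refine (continuousOn_id.sub continuousOn_const).inv₀ ?_
    rintro - ⟨t, ht, rfl⟩ h
    have h' : δ t = a := sub_eq_zero.mp h
    exact ha (h' ▸ hUδ t (hs ht))
  have hi1 := c1.intervalIntegrable (hF _ (Icc_subset_Icc_right (by norm_num)))
  have hi2 := c2.intervalIntegrable (hF _ (Icc_subset_Icc_left (by norm_num)))
  have j1 : ∫ t in (0 : ℝ)..(1 / 2), (δ t - a)⁻¹ * deriv δ t =
      contourIntegral γ fun z => (z - a)⁻¹ := by
    have := integral_comp_affine γ (fun z => (z - a)⁻¹) (k := 2) 0 0 (1 / 2)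
    norm_num at this
    rw [contourIntegral, ← this]
    refine intervalIntegral.integral_congr_ae ?_
    filter_upwards [(countable_singleton (1 / 2 : ℝ)).ae_notMem volume] with t ht ht'
    rw [uIoc_of_le (by norm_num)] at ht'
    have hlt : t < 1 / 2 := lt_of_le_of_ne ht'.2 (by simpa using ht)
    have he : δ =ᶠ[𝓝 t] fun s => γ (2 * s) := by
      filter_upwards [Ioo_mem_nhds ht'.1 hlt] with s hs
      rw [e1 s (Ioo_subset_Icc_self hs), add_zero]
    rw [he.deriv_eq, he.self_of_nhds]
  have j2 : ∫ t in (1 / 2 : ℝ)..1, (δ t - a)⁻¹ * deriv δ t =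
      contourIntegral γ' fun z => (z - a)⁻¹ := by
    have := integral_comp_affine γ' (fun z => (z - a)⁻¹) (k := 2) (-1) (1 / 2) 1
    norm_num at this
    rw [contourIntegral, ← this]
    refine intervalIntegral.integral_congr_ae ?_
    filter_upwards [(countable_singleton (1 : ℝ)).ae_notMem volume] with t ht ht'
    rw [uIoc_of_le (by norm_num)] at ht'
    have hlt : t < 1 := lt_of_le_of_ne ht'.2 (by simpa using ht)
    have he : δ =ᶠ[𝓝 t] fun s => γ' (2 * s + (-1)) := by
      filter_upwards [Ioo_mem_nhds ht'.1 hlt] with s hs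
      rw [e2 s (Ioo_subset_Icc_self hs)]
    rw [he.deriv_eq, he.self_of_nhds]
  rw [Pi.add_apply, ← hw a ha, ← hw' a ha, windingNumber, windingNumber, windingNumber, ← mul_add,
    ← j1, ← j2, contourIntegral, intervalIntegral.integral_add_adjacent_intervals hi1 hi2]

lemma joins_segment (h : ∀ t ∈ Icc (0 : ℝ) 1, p + t * (q - p) ∈ U) : ∃ Φ, Joins U p q Φ := by
  refine ⟨_, fun t => p + t * (q - p), .single one_pos (ContDiff.contDiffOn ?_), by simp, by simp, h,
    fun a _ => rfl⟩
  have h : ContDiff ℝ 1 (fun t : ℝ => (t : ℂ)) := Complex.ofRealCLM.contDiff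
  exact contDiff_const.add (h.mul contDiff_const)

lemma joins_circlePath {a u : ℂ} (h : ∀ z, ‖z - a‖ = ‖u‖ → z ∈ U) :
    Joins U (a + u) (a + u) (windingNumber (circlePath a u)) :=
  ⟨circlePath a u, piecewiseC1_circlePath a u, circlePath_zero a u, circlePath_one a u,
    fun t _ => h _ (norm_circlePath_sub a u t), fun _ _ => rfl⟩

end Joins

lemma volume_line_eq_zero (a b : ℂ) :
    volume {z : ℂ | ∃ t : ℝ, z = a + t * (b - a)} = 0 := by
  set s : AffineSubspace ℝ ℂ := AffineSubspace.mk' a (Submodule.span ℝ {b - a}) with hs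
  have hne : s ≠ ⊤ := by
    intro h
    have h1 : s.direction = ⊤ := by rw [h]; exact AffineSubspace.direction_top ℝ ℂ ℂ
    rw [hs, AffineSubspace.direction_mk'] at h1
    have h2 := finrank_span_le_card (R := ℝ) ({b - a} : Set ℂ)
    rw [h1, finrank_top, Complex.finrank_real_complex] at h2
    simp at h2
  refine measure_mono_null ?_ (Measure.addHaar_affineSubspace volume s hne)
  rintro z ⟨t, rfl⟩
  rw [SetLike.mem_coe, hs, AffineSubspace.mem_mk', vsub_eq_sub, add_sub_cancel_left]
  rw [← Complex.real_smul]
  exact Submodule.smul_mem _ _ (Submodule.mem_span_singleton_self _)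

/-- The excluded points lie on countably many circles and lines, which together have measure zero.
-/
lemma exists_generic_point {W : Set ℂ} (hW : W.Countable) : ∃ p : ℂ,
    (∀ a ∈ W, ‖p‖ ≠ ‖a‖) ∧ ∀ a ∈ W, ∀ b ∈ W, ∀ t : ℝ, a ≠ b → p ≠ a + t * (b - a) := by
  have h1 : volume (⋃ a ∈ W, Metric.sphere (0 : ℂ) ‖a‖) = 0 :=
    (measure_biUnion_null_iff hW).mpr fun a _ => Measure.addHaar_sphere _ _ _
  have h2 : volume (⋃ a ∈ W, ⋃ b ∈ W, {z : ℂ | ∃ t : ℝ, z = a + t * (b - a)}) = 0 :=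
    (measure_biUnion_null_iff hW).mpr fun a _ =>
      (measure_biUnion_null_iff hW).mpr fun b _ => volume_line_eq_zero a b
  have h3 := measure_union_null h1 h2
  obtain ⟨p, hp⟩ : ∃ p, p ∉ (⋃ a ∈ W, Metric.sphere (0 : ℂ) ‖a‖) ∪
      ⋃ a ∈ W, ⋃ b ∈ W, {z : ℂ | ∃ t : ℝ, z = a + t * (b - a)} := by
    by_contra h
    push Not at h
    rw [eq_univ_of_forall h] at h3
    simp at h3
  simp only [mem_union, mem_iUnion, not_or, not_exists, mem_sphere_zero_iff_norm] at hp
  exact ⟨p, fun a ha => hp.1 a ha, fun a ha b hb t _ ht => hp.2 a ha b hb ⟨t, ht⟩⟩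

/-- Go straight from `p` to a small circle around `a`, run around it once, and return the same way.
The two journeys along the segment cancel in every winding number. -/
lemma joins_lollipop {W : Set ℂ} {p a : ℂ} (ha : a ∈ W)
    (hline : ∀ a ∈ W, ∀ b ∈ W, ∀ t : ℝ, a ≠ b → p ≠ a + t * (b - a))
    {ε : ℝ} (hε : 0 < ε) (hiso : ∀ b ∈ W, ‖b - a‖ ≤ ε → b = a) (hεp : ε < ‖p - a‖) :
    ∃ Φ, Joins Wᶜ p p Φ ∧ Φ a = 1 ∧ ∀ b ∈ W, b ≠ a → Φ b = 0 := by
  have hpa : 0 < ‖p - a‖ := hε.trans hεp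
  set k : ℝ := ε / ‖p - a‖ with hk
  have hk0 : 0 < k := div_pos hε hpa
  have hk1 : k < 1 := (div_lt_one hpa).mpr hεp
  set u : ℂ := k * (p - a) with hu
  have hnu : ‖u‖ = ε := by
    rw [hu, norm_mul, Complex.norm_real, Real.norm_of_nonneg hk0.le, hk, div_mul_cancel₀ _ hpa.ne']
  have hu0 : u ≠ 0 := norm_pos_iff.mp (by rw [hnu]; exact hε)
  obtain ⟨Φ, hΦ⟩ : ∃ Φ, Joins Wᶜ p (a + u) Φ := by
    refine joins_segment fun t ht hm => ?_
    set s : ℝ := t * (1 - k) with hs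
    have hs1 : s < 1 := by nlinarith [ht.1, ht.2]
    have e : p + t * (a + u - p) = p + s * (a - p) := by rw [hs, hu]; push_cast; ring
    rw [e] at hm
    have h1s : (1 - s : ℂ) ≠ 0 := by
      rw [← Complex.ofReal_one, ← Complex.ofReal_sub]
      exact Complex.ofReal_ne_zero.mpr (by linarith)
    by_cases hba : a = p + s * (a - p)
    · have : (1 - s : ℂ) * (p - a) = 0 := by linear_combination -hba
      rcases mul_eq_zero.mp this with h | h
      · exact h1s h
      · rw [h, norm_zero] at hpa; exact lt_irrefl _ hpa
    -- If the segment met `W` in a point `c = p + s(a - p)` other than `a`, then `p = a + (1 - s)⁻¹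
    -- (c - a)` would lie on the line through two points of `W`.
    · refine hline a ha _ hm (1 - s)⁻¹ hba ?_
      push_cast
      field_simp
      ring
  have hc : Joins Wᶜ (a + u) (a + u) (windingNumber (circlePath a u)) := by
    refine joins_circlePath fun z hz hm => ?_
    have := hiso z hm (hz.trans hnu).le
    rw [this, sub_self, norm_zero, hnu] at hz
    linarith
  refine ⟨_, (hΦ.trans hc).trans hΦ.symm, ?_, fun b hb hba => ?_⟩
  · simp [windingNumber_circlePath_center a hu0]
  · have : ‖u‖ < ‖b - a‖ := by
      rw [hnu]
      by_contra h
      exact hba (hiso b hb (not_lt.mp h))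
    simp [windingNumber_circlePath_of_lt a this]

lemma LocFin.exists_isolating {P : Set ℂ} (hP : LocFin P) {a : ℂ} (ha : a ∈ P) {δ : ℝ}
    (hδ : 0 < δ) : ∃ ε, 0 < ε ∧ ε < δ ∧ ∀ b ∈ insert 0 P, ‖b - a‖ ≤ ε → b = a := by
  have ha0 : 0 < ‖a‖ := norm_pos_iff.mpr fun h => hP.zero_notMem (h ▸ ha)
  have hfin := (hP.finite (‖a‖ / 2) (2 * ‖a‖) (by linarith)).subset (sdiff_subset (t := {a}))
  have hnhds := hfin.isClosed.isOpen_compl.mem_nhds (x := a) (by simp)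
  obtain ⟨η, hη, hball⟩ := Metric.mem_nhds_iff.mp hnhds
  refine ⟨min (min (η / 2) (‖a‖ / 2)) (δ / 2), by positivity,
    (min_le_right _ _).trans_lt (by linarith), fun b hb hba => ?_⟩
  have h1 : ‖b - a‖ ≤ η / 2 := hba.trans ((min_le_left _ _).trans (min_le_left _ _))
  have h2 : ‖b - a‖ ≤ ‖a‖ / 2 := hba.trans ((min_le_left _ _).trans (min_le_right _ _))
  have h3 : ‖a‖ / 2 ≤ ‖b‖ := by
    have := norm_sub_norm_le a b
    rw [norm_sub_rev] at this
    linarith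
  have h4 : ‖b‖ ≤ 2 * ‖a‖ := by
    have := norm_sub_norm_le b a
    linarith
  rcases mem_insert_iff.mp hb with rfl | hb
  · rw [norm_zero] at h3; linarith
  by_contra hne
  exact hball (Metric.mem_ball.mpr (by rw [dist_eq_norm]; linarith)) ⟨⟨hb, h3, h4⟩, hne⟩

theorem exists_separates {P Q : Set ℂ} (hPQ : LocFin (P ∪ Q)) (hdisj : Disjoint P Q)
    (hP : ∀ ρ : ℝ, 0 < ρ → (P ∩ {z | ρ ≤ ‖z‖}).Finite)
    (hQ : ∀ R : ℝ, (Q ∩ {z | ‖z‖ ≤ R}).Finite) : ∃ γ, Separates P Q γ := by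
  classical
  set W : Set ℂ := insert 0 (P ∪ Q) with hW
  obtain ⟨p, hp, hline⟩ := exists_generic_point (hPQ.countable.insert 0)
  have hp0 : 0 < ‖p‖ := norm_pos_iff.mpr fun h => hp 0 (mem_insert _ _) (by rw [h])
  have hlol : ∀ a ∈ P ∪ Q, ∃ Φ, Joins Wᶜ p p Φ ∧ Φ a = 1 ∧ ∀ b ∈ W, b ≠ a → Φ b = 0 := by
    intro a ha
    have hpa : 0 < ‖p - a‖ := norm_pos_iff.mpr fun h =>
      hp a (mem_insert_of_mem _ ha) (by rw [sub_eq_zero.mp h])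
    obtain ⟨ε, h1, h2, h3⟩ := hPQ.exists_isolating ha hpa
    exact joins_lollipop (mem_insert_of_mem _ ha) hline h1 h3 h2
  -- The circle around `0` through `p` is already correct except at the points of `P` outside it and
  -- the points of `Q` inside it. Both sets are finite.
  have hbase : ∃ Φ, Joins Wᶜ p p Φ ∧ ∀ b ∈ W, Φ b = if ‖b‖ < ‖p‖ then 1 else 0 := by
    refine ⟨windingNumber (circlePath 0 p), ?_, fun b hb => ?_⟩
    · have := joins_circlePath (U := Wᶜ) (a := 0) (u := p) fun z hz hm => hp z hm (by simpa using hz.symm)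
      rwa [zero_add] at this
    · split_ifs with h
      · exact windingNumber_circlePath_zero_of_lt h
      · refine windingNumber_circlePath_of_lt 0 ?_
        rw [sub_zero]
        exact lt_of_le_of_ne (not_lt.mp h) (hp b hb)
  have hadd : ∀ A : Finset ℂ, (∀ a ∈ A, a ∈ P ∪ Q) → ∃ Φ, Joins Wᶜ p p Φ ∧
      ∀ b ∈ W, Φ b = (if ‖b‖ < ‖p‖ then 1 else 0) + if b ∈ A then 1 else 0 := by
    intro A
    induction A using Finset.induction_on with
    | empty => intro _; simpa using hbase
    | insert a A haA ih =>
      intro hA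
      obtain ⟨Φ, h1, h2⟩ := ih fun b hb => hA b (Finset.mem_insert_of_mem hb)
      obtain ⟨Ψ, h3, h4, h5⟩ := hlol a (hA a (Finset.mem_insert_self _ _))
      refine ⟨_, h1.trans h3, fun b hb => ?_⟩
      rw [Pi.add_apply, h2 b hb]
      by_cases hba : b = a
      · subst hba; simp [h4, haA]
      · simp [h5 b hb hba, hba]
  have hsub : ∀ A B : Finset ℂ, (∀ a ∈ A, a ∈ P ∪ Q) → (∀ a ∈ B, a ∈ P ∪ Q) →
      ∃ Φ, Joins Wᶜ p p Φ ∧ ∀ b ∈ W, Φ b =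
        (if ‖b‖ < ‖p‖ then 1 else 0) + (if b ∈ A then 1 else 0) - if b ∈ B then 1 else 0 := by
    intro A B hA
    induction B using Finset.induction_on with
    | empty => intro _; simpa using hadd A hA
    | insert a B haB ih =>
      intro hB
      obtain ⟨Φ, h1, h2⟩ := ih fun b hb => hB b (Finset.mem_insert_of_mem hb)
      obtain ⟨Ψ, h3, h4, h5⟩ := hlol a (hB a (Finset.mem_insert_self _ _))
      refine ⟨_, h1.trans h3.symm, fun b hb => ?_⟩
      rw [Pi.add_apply, Pi.neg_apply, h2 b hb]
      by_cases hba : b = a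
      · subst hba; simp [h4, haB]; ring
      · simp [h5 b hb hba, hba]
  -- A positive loop is attached for each point of `P` outside the circle and a negative loop for
  -- each point of `Q` inside it.
  obtain ⟨Φ, ⟨γ, hγ, hγ0, hγ1, hU, hw⟩, hΦ⟩ := hsub (hP ‖p‖ hp0).toFinset (hQ ‖p‖).toFinset
    (fun a ha => Or.inl ((Set.Finite.mem_toFinset _).mp ha).1)
    (fun a ha => Or.inr ((Set.Finite.mem_toFinset _).mp ha).1)
  have hwin : ∀ b ∈ W, windingNumber γ b = (if ‖b‖ < ‖p‖ then 1 else 0) +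
      (if b ∈ P ∧ ‖p‖ ≤ ‖b‖ then 1 else 0) - if b ∈ Q ∧ ‖b‖ ≤ ‖p‖ then 1 else 0 := by
    intro b hb
    rw [hw b (not_not.mpr hb), hΦ b hb]
    simp
  have h0P : (0 : ℂ) ∉ P := fun h => hPQ.zero_notMem (Or.inl h)
  have h0Q : (0 : ℂ) ∉ Q := fun h => hPQ.zero_notMem (Or.inr h)
  refine ⟨γ, isClosedPath_iff.mpr ⟨hγ, by rw [hγ0, hγ1]⟩, fun t ht h => hU t ht (h ▸ mem_insert _ _),
    fun a ha t ht h => hU t ht (h ▸ mem_insert_of_mem _ (Or.inl ha)),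
    fun a ha t ht h => hU t ht (h ▸ mem_insert_of_mem _ (Or.inr ha)), ?_, fun a ha => ?_, fun a ha => ?_⟩
  · rw [hwin 0 (mem_insert _ _)]
    simp [h0P, h0Q, norm_pos_iff.mp hp0]
  · have haQ : a ∉ Q := fun h => disjoint_left.mp hdisj ha h
    rw [hwin a (mem_insert_of_mem _ (Or.inl ha))]
    rcases lt_or_ge ‖a‖ ‖p‖ with h | h
    · simp [ha, haQ, h, not_le.mpr h]
    · simp [ha, haQ, h, not_lt.mpr h]
  · have haP : a ∉ P := fun h => disjoint_left.mp hdisj h ha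
    rw [hwin a (mem_insert_of_mem _ (Or.inr ha))]
    have hne := hp a (mem_insert_of_mem _ (Or.inr ha))
    rcases lt_or_gt_of_ne hne with h | h
    · simp [ha, haP, not_lt.mpr h.le, not_le.mpr h]
    · simp [ha, haP, h, h.le]

/-! ### The infinite `q`-shifted factorial: functional equation and simple zeros. -/

section Pochhammer

variable {q : ℂ}

lemma summable_mul_pow (hq : ‖q‖ < 1) (a : ℂ) : Summable fun j : ℕ => ‖-(a * q ^ j)‖ := by
  simpa using (summable_geometric_of_lt_one (norm_nonneg q) hq).mul_left ‖a‖

lemma multipliable_qPochInf (hq : ‖q‖ < 1) (a : ℂ) : Multipliable fun j : ℕ => 1 - a * q ^ j := by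
  simpa only [sub_eq_add_neg] using multipliable_one_add_of_summable (summable_mul_pow hq a)

lemma qPochInf_eq_mul (hq : ‖q‖ < 1) (a : ℂ) :
    qPochInf q a = (1 - a) * qPochInf q (q * a) := by
  have h : Multipliable fun j : ℕ => 1 - a * q ^ (j + 1) := by
    have h1 := multipliable_qPochInf hq (q * a)
    have e : (fun j : ℕ => 1 - q * a * q ^ j) = fun j : ℕ => 1 - a * q ^ (j + 1) := by
      funext j; ring
    rwa [e] at h1
  have e : qPochInf q (q * a) = ∏' j : ℕ, (1 - a * q ^ (j + 1)) := by
    unfold qPochInf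
    exact tprod_congr fun j => by ring
  have h2 := tprod_eq_zero_mul' (f := fun j : ℕ => 1 - a * q ^ j) h
  rw [e]
  simpa only [qPochInf, pow_zero, mul_one] using h2

lemma qPochInf_eq_prod_mul (hq : ‖q‖ < 1) (a : ℂ) (n : ℕ) :
    qPochInf q a = (∏ i ∈ Finset.range n, (1 - a * q ^ i)) * qPochInf q (a * q ^ n) := by
  induction n with
  | zero => simp
  | succ n ih =>
    rw [ih, qPochInf_eq_mul hq (a * q ^ n), Finset.prod_range_succ, mul_assoc, pow_succ]
    ring_nf

lemma qPochInf_ne_zero (hq : ‖q‖ < 1) {a : ℂ} (ha : ∀ n : ℕ, a * q ^ n ≠ 1) :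
    qPochInf q a ≠ 0 := by
  have := tprod_one_add_ne_zero_of_summable (f := fun j : ℕ => -(a * q ^ j)) (fun j h => ha j ?_)
    (summable_mul_pow hq a)
  · simpa only [qPochInf, sub_eq_add_neg] using this
  · linear_combination -h

lemma qPochInf_eq_zero_iff (hq : ‖q‖ < 1) {a : ℂ} :
    qPochInf q a = 0 ↔ ∃ n : ℕ, a * q ^ n = 1 := by
  constructor
  · intro h
    by_contra hn
    push Not at hn
    exact qPochInf_ne_zero hq hn h
  · rintro ⟨n, hn⟩
    rw [qPochInf_eq_prod_mul hq a (n + 1), Finset.prod_range_succ, hn]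
    simp

lemma qPochInf_zero : qPochInf q 0 = 1 := by simp [qPochInf]

lemma qPochInf_ne_zero_of_norm_lt (hq : ‖q‖ < 1) {a : ℂ} (ha : ‖a‖ < 1) : qPochInf q a ≠ 0 := by
  refine qPochInf_ne_zero hq fun n h => ?_
  have h1 : ‖a * q ^ n‖ < 1 := by
    rw [norm_mul, norm_pow]
    exact mul_lt_one_of_nonneg_of_lt_one_left (norm_nonneg a) ha (pow_le_one₀ (norm_nonneg q) hq.le)
  rw [h, norm_one] at h1
  exact lt_irrefl _ h1

lemma differentiable_qPochInf (hq : ‖q‖ < 1) : Differentiable ℂ (qPochInf q) := by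
  have key : ∀ r : ℝ, DifferentiableOn ℂ (qPochInf q) (Metric.ball 0 r) := by
    intro r
    have h := Summable.hasProdLocallyUniformlyOn_nat_one_add (f := fun (j : ℕ) (a : ℂ) => -(a * q ^ j))
      (K := Metric.ball 0 r) Metric.isOpen_ball
      ((summable_geometric_of_lt_one (norm_nonneg q) hq).mul_left r)
      (.of_forall fun n x hx => ?_) (fun n => by fun_prop)
    · have h2 := h.differentiableOn (.of_forall fun s => by
        simpa [Finset.prod_fn] using DifferentiableOn.finsetProd (fun _ _ => by fun_prop))
        Metric.isOpen_ball
      have e : qPochInf q = fun a => ∏' j : ℕ, (1 + -(a * q ^ j)) := by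
        funext a; simp only [qPochInf, sub_eq_add_neg]
      rw [e]; exact h2
    · rw [norm_neg, norm_mul, norm_pow]
      gcongr
      simpa using (Metric.mem_ball.mp hx).le
  intro x
  exact (key (‖x‖ + 1)).differentiableAt (Metric.isOpen_ball.mem_nhds (by simp))

lemma analyticAt_qPochInf (hq : ‖q‖ < 1) (x : ℂ) : AnalyticAt ℂ (qPochInf q) x :=
  (differentiable_qPochInf hq).analyticAt x

lemma analyticAt_qPochInf_comp (hq : ‖q‖ < 1) {f : ℂ → ℂ} {x : ℂ} (hf : AnalyticAt ℂ f x) :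
    AnalyticAt ℂ (fun z => qPochInf q (f z)) x :=
  (analyticAt_qPochInf hq (f x)).comp hf

lemma continuous_qPochInf (hq : ‖q‖ < 1) : Continuous (qPochInf q) :=
  (differentiable_qPochInf hq).continuous

lemma pow_ne_one_of_norm_lt (hq : ‖q‖ < 1) {n : ℕ} (hn : n ≠ 0) : q ^ n ≠ 1 := by
  intro h
  have h1 := pow_lt_one₀ (norm_nonneg q) hq hn
  rw [← norm_pow, h, norm_one] at h1
  exact lt_irrefl _ h1

lemma zpow_injective (hq0 : q ≠ 0) (hq : ‖q‖ < 1) {m n : ℤ} (h : q ^ m = q ^ n) : m = n := by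
  by_contra hmn
  have h1 : ∀ k : ℤ, 0 < k → q ^ k ≠ 1 := by
    intro k hk
    lift k to ℕ using hk.le
    rw [zpow_natCast]
    exact pow_ne_one_of_norm_lt hq (by omega)
  rcases lt_or_gt_of_ne hmn with hlt | hlt
  · exact h1 (n - m) (by omega) (by rw [zpow_sub₀ hq0, h, div_self (zpow_ne_zero _ hq0)])
  · exact h1 (m - n) (by omega) (by rw [zpow_sub₀ hq0, h, div_self (zpow_ne_zero _ hq0)])

/-- At a zero exactly one factor `1 - a q^n` vanishes. The cofactor `h` is a product of terms `1 -
q^m` up to powers of `q`, with `m` never `0`. -/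
lemma deriv_qPochInf_ne_zero (hq0 : q ≠ 0) (hq : ‖q‖ < 1) {a : ℂ} (ha : qPochInf q a = 0) :
    deriv (qPochInf q) a ≠ 0 := by
  obtain ⟨n, hn⟩ := (qPochInf_eq_zero_iff hq).mp ha
  set h : ℂ → ℂ := fun x => (∏ i ∈ Finset.range n, (1 - x * q ^ i)) * qPochInf q (x * q ^ (n + 1))
    with hh
  have hd : Differentiable ℂ h := by
    refine Differentiable.mul ?_ ((differentiable_qPochInf hq).comp (by fun_prop))
    exact Differentiable.fun_finsetProd fun i _ => by fun_prop
  have e : qPochInf q = fun x => (1 - x * q ^ n) * h x := by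
    funext x
    rw [qPochInf_eq_prod_mul hq x (n + 1), Finset.prod_range_succ, hh]
    ring
  have h0 : h a ≠ 0 := by
    refine mul_ne_zero (Finset.prod_ne_zero_iff.mpr fun i hi hz => ?_) (qPochInf_ne_zero hq fun m hm => ?_)
    · have hi' := Finset.mem_range.mp hi
      refine pow_ne_one_of_norm_lt hq (n := n - i) (by omega) ?_
      have : a * q ^ i = 1 := by linear_combination -hz
      have e2 : q ^ n = q ^ i * q ^ (n - i) := by rw [← pow_add]; congr 1; omega
      rw [e2, ← mul_assoc, this, one_mul] at hn
      exact hn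
    · refine pow_ne_one_of_norm_lt hq (n := m + 1) (by omega) ?_
      have e2 : a * q ^ (n + 1) * q ^ m = (a * q ^ n) * q ^ (m + 1) := by ring
      rw [e2, hn, one_mul] at hm
      exact hm
  have h1 : HasDerivAt (fun x => (1 - x * q ^ n) * h x)
      (-(1 * q ^ n) * h a + (1 - a * q ^ n) * deriv h a) a :=
    (((hasDerivAt_id a).mul_const (q ^ n)).const_sub 1).mul (hd a).hasDerivAt
  rw [e, h1.deriv, hn]
  simp [h0, hq0]

end Pochhammer

/-! ### Pole sequences of quotients of infinite products. -/

/-- The points `β_j q^n`, `n ≥ 0`. -/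
def poleSeq {ι : Type*} (q : ℂ) (β : ι → ℂ) : Set ℂ := {z | ∃ (j : ι) (n : ℕ), z = β j * q ^ n}

/-- The inverses of the points `α_j q^n`, `n ≥ 0`. -/
def poleSeqInv {ι : Type*} (q : ℂ) (α : ι → ℂ) : Set ℂ := {z | z⁻¹ ∈ poleSeq q α}

section PoleSeq

variable {ι : Type*} {q : ℂ} {α β : ι → ℂ}

lemma zero_notMem_poleSeq (hq0 : q ≠ 0) (hβ : ∀ j, β j ≠ 0) : (0 : ℂ) ∉ poleSeq q β := by
  rintro ⟨j, n, h⟩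
  exact mul_ne_zero (hβ j) (pow_ne_zero n hq0) h.symm

lemma finite_poleSeq [Finite ι] (hq : ‖q‖ < 1) (β : ι → ℂ) {ρ : ℝ} (hρ : 0 < ρ) :
    (poleSeq q β ∩ {z | ρ ≤ ‖z‖}).Finite := by
  have h : ∀ j, ∃ N : ℕ, ∀ n ≥ N, ‖β j * q ^ n‖ < ρ := by
    intro j
    have h1 : Filter.Tendsto (fun n : ℕ => ‖β j * q ^ n‖) Filter.atTop (𝓝 0) := by
      have := ((tendsto_pow_atTop_nhds_zero_of_norm_lt_one hq).const_mul (β j)).norm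
      simpa only [mul_zero, norm_zero] using this
    exact Filter.eventually_atTop.mp (h1.eventually_lt_const hρ)
  choose N hN using h
  refine (finite_iUnion fun j => ((Finset.range (N j)).finite_toSet.image
    fun n : ℕ => β j * q ^ n)).subset ?_
  rintro z ⟨⟨j, n, rfl⟩, hz⟩
  refine mem_iUnion.mpr ⟨j, n, ?_, rfl⟩
  rw [Finset.mem_coe, Finset.mem_range]
  by_contra hn
  exact absurd hz (not_le.mpr (hN j n (not_lt.mp hn)))

lemma finite_poleSeqInv [Finite ι] (hq0 : q ≠ 0) (hq : ‖q‖ < 1) (hα : ∀ j, α j ≠ 0) (R : ℝ) :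
    (poleSeqInv q α ∩ {z | ‖z‖ ≤ R}).Finite := by
  refine ((finite_poleSeq hq α (ρ := (|R| + 1)⁻¹) (by positivity)).image (·⁻¹)).subset ?_
  rintro z ⟨hz, hzR⟩
  refine ⟨z⁻¹, ⟨hz, ?_⟩, inv_inv z⟩
  have hz0 : z ≠ 0 := by
    rintro rfl
    exact zero_notMem_poleSeq hq0 hα (by simpa [poleSeqInv] using hz)
  rw [mem_ofPred_eq, norm_inv]
  have : 0 < ‖z‖ := norm_pos_iff.mpr hz0
  have h2 : ‖z‖ ≤ R := hzR
  gcongr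
  linarith [le_abs_self R]

lemma locFin_poleSeq [Finite ι] (hq0 : q ≠ 0) (hq : ‖q‖ < 1) (hα : ∀ j, α j ≠ 0) (hβ : ∀ j, β j ≠ 0) :
    LocFin (poleSeq q β ∪ poleSeqInv q α) where
  zero_notMem := by
    rintro (h | h)
    · exact zero_notMem_poleSeq hq0 hβ h
    · exact zero_notMem_poleSeq hq0 hα (by simpa [poleSeqInv] using h)
  finite ρ R hρ := by
    rw [union_inter_distrib_right]
    exact ((finite_poleSeq hq β hρ).subset (inter_subset_inter_right _ fun z hz => hz.1)).union
      ((finite_poleSeqInv hq0 hq hα R).subset (inter_subset_inter_right _ fun z hz => hz.2))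

end PoleSeq

lemma simplePoleAt_inv {f : ℂ → ℂ} {a : ℂ} (hf : AnalyticAt ℂ f a) (h : f a = 0 → deriv f a ≠ 0) :
    SimplePoleAt (fun z => (f z)⁻¹) a := by
  by_cases h0 : f a = 0
  · have h1 : AnalyticAt ℂ (dslope f a) a := by
      obtain ⟨p, hp⟩ := hf
      exact ⟨_, hp.has_fpower_series_dslope_fslope⟩
    refine ⟨fun z => (dslope f a z)⁻¹, h1.inv (by rw [dslope_same]; exact h h0), ?_⟩
    filter_upwards [self_mem_nhdsWithin] with z hz
    rw [dslope_of_ne _ hz, slope_def_field, h0, sub_zero, inv_div, div_div,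
      mul_comm (f z), ← div_div, div_self (sub_ne_zero.mpr hz), one_div]
  · exact simplePoleAt_of_analyticAt (hf.inv h0)

/-- At most one factor vanishes at `a`, and only to first order; the other factors can be inverted
analytically. -/
lemma simplePoleAt_inv_prod {ι : Type*} (s : Finset ι) {φ : ι → ℂ → ℂ} {a : ℂ}
    (hφ : ∀ i ∈ s, AnalyticAt ℂ (φ i) a) (hd : ∀ i ∈ s, φ i a = 0 → deriv (φ i) a ≠ 0)
    (hu : ∀ i ∈ s, ∀ j ∈ s, φ i a = 0 → φ j a = 0 → i = j) :
    SimplePoleAt (fun z => (∏ i ∈ s, φ i z)⁻¹) a := by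
  classical
  by_cases h : ∃ i ∈ s, φ i a = 0
  · obtain ⟨i, hi, h0⟩ := h
    have h1 := simplePoleAt_inv (hφ i hi) (hd i hi)
    have h2 : AnalyticAt ℂ (fun z => (∏ j ∈ s.erase i, φ j z)⁻¹) a := by
      refine AnalyticAt.inv (Finset.analyticAt_fun_prod _ fun j hj => hφ j (Finset.mem_of_mem_erase hj))
        (Finset.prod_ne_zero_iff.mpr fun j hj hj0 => ?_)
      exact Finset.ne_of_mem_erase hj (hu i hi j (Finset.mem_of_mem_erase hj) h0 hj0).symm
    have h3 := h1.mul_analytic h2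
    have e : ∀ z, (φ i z)⁻¹ * (∏ j ∈ s.erase i, φ j z)⁻¹ = (∏ j ∈ s, φ j z)⁻¹ := fun z => by
      rw [← mul_inv, Finset.mul_prod_erase s (fun j => φ j z) hi]
    simpa only [e] using h3
  · push Not at h
    exact simplePoleAt_of_analyticAt
      ((Finset.analyticAt_fun_prod _ hφ).inv (Finset.prod_ne_zero_iff.mpr h))

/-- The three non-resonance hypotheses say that no two factors of the denominator vanish at the same
point: `hαβ` for factors of opposite types, `hαα` and `hββ` for factors of the same type. -/
lemma goodOn_quotient {ι : Type*} [Fintype ι] {q : ℂ} (hq0 : q ≠ 0) (hq : ‖q‖ < 1) {α β : ι → ℂ}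
    (hα : ∀ j, α j ≠ 0) (hβ : ∀ j, β j ≠ 0) (hαβ : ∀ i j, ∀ n : ℕ, α i * β j * q ^ n ≠ 1)
    (hαα : ∀ i j, i ≠ j → ∀ n : ℤ, α i ≠ α j * q ^ n)
    (hββ : ∀ i j, i ≠ j → ∀ n : ℤ, β i ≠ β j * q ^ n)
    {f : ℂ → ℂ} (hf : ∀ z, z ≠ 0 → AnalyticAt ℂ f z) :
    GoodOn (poleSeq q β ∪ poleSeqInv q α)
      (fun z => f z / ∏ j, (qPochInf q (α j * z) * qPochInf q (β j / z))) := by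
  have hz1 : ∀ z j, z ≠ 0 → qPochInf q (α j * z) = 0 → ∃ n : ℕ, z⁻¹ = α j * q ^ n := by
    intro z j hz h
    obtain ⟨n, hn⟩ := (qPochInf_eq_zero_iff hq).mp h
    exact ⟨n, by field_simp; linear_combination -hn⟩
  have hz2 : ∀ z j, z ≠ 0 → qPochInf q (β j / z) = 0 → ∃ n : ℕ, z = β j * q ^ n := by
    intro z j hz h
    obtain ⟨n, hn⟩ := (qPochInf_eq_zero_iff hq).mp h
    exact ⟨n, by field_simp at hn; exact hn.symm⟩
  have ha1 : ∀ z j, AnalyticAt ℂ (fun z => qPochInf q (α j * z)) z := fun z j =>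
    analyticAt_qPochInf_comp hq (analyticAt_const.mul analyticAt_id)
  have ha2 : ∀ z j, z ≠ 0 → AnalyticAt ℂ (fun z => qPochInf q (β j / z)) z := fun z j hz =>
    analyticAt_qPochInf_comp hq (analyticAt_const.div analyticAt_id hz)
  have hcancel : ∀ {x y z : ℂ} {m n : ℕ}, z = x * q ^ m → z = y * q ^ n →
      x = y * q ^ ((n : ℤ) - m) := by
    intro x y z m n h1 h2
    rw [zpow_sub₀ hq0, zpow_natCast, zpow_natCast, mul_div_assoc', ← h2, h1,
      mul_div_cancel_right₀ _ (pow_ne_zero m hq0)]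
  refine ⟨fun z hz hzP => ?_, fun z hzP => ?_⟩
  · refine (hf z hz).div (Finset.analyticAt_fun_prod _ fun j _ => (ha1 z j).mul (ha2 z j hz))
      (Finset.prod_ne_zero_iff.mpr fun j _ => mul_ne_zero (fun h => hzP ?_) fun h => hzP ?_)
    · obtain ⟨n, hn⟩ := hz1 z j hz h
      exact Or.inr ⟨j, n, hn⟩
    · obtain ⟨n, hn⟩ := hz2 z j hz h
      exact Or.inl ⟨j, n, hn⟩
  · have hz : z ≠ 0 := fun h => (locFin_poleSeq hq0 hq hα hβ).zero_notMem (h ▸ hzP)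
    have h1 := simplePoleAt_inv_prod (a := z) (Finset.univ : Finset (ι ⊕ ι))
      (φ := Sum.elim (fun j z => qPochInf q (α j * z)) (fun j z => qPochInf q (β j / z))) ?_ ?_ ?_
    · have h2 := h1.mul_analytic (hf z hz)
      simpa only [Fintype.prod_sum_type, Sum.elim_inl, Sum.elim_inr, ← Finset.prod_mul_distrib,
        inv_mul_eq_div] using h2
    · rintro (j | j) -
      · exact ha1 z j
      · exact ha2 z j hz
    · rintro (j | j) - h
      · have h3 : HasDerivAt (fun z => α j * z) (α j) z := by
          simpa using (hasDerivAt_id z).const_mul (α j)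
        have h4 := (differentiable_qPochInf hq (α j * z)).hasDerivAt.comp z h3
        simp only [Sum.elim_inl] at h ⊢
        rw [show (fun z => qPochInf q (α j * z)) = qPochInf q ∘ fun z => α j * z from rfl, h4.deriv]
        exact mul_ne_zero (deriv_qPochInf_ne_zero hq0 hq h) (hα j)
      · have h3 : HasDerivAt (fun z => β j / z) (-β j / z ^ 2) z :=
          ((hasDerivAt_const z (β j)).div (hasDerivAt_id z) hz).congr_deriv (by simp)
        have h4 := (differentiable_qPochInf hq (β j / z)).hasDerivAt.comp z h3
        simp only [Sum.elim_inr] at h ⊢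
        rw [show (fun z => qPochInf q (β j / z)) = qPochInf q ∘ fun z => β j / z from rfl, h4.deriv]
        exact mul_ne_zero (deriv_qPochInf_ne_zero hq0 hq h)
          (div_ne_zero (neg_ne_zero.mpr (hβ j)) (pow_ne_zero 2 hz))
    · have hcross : ∀ i j, qPochInf q (α i * z) = 0 → qPochInf q (β j / z) = 0 → False := by
        intro i j h h'
        obtain ⟨n, hn⟩ := hz1 z i hz h
        obtain ⟨m, hm⟩ := hz2 z j hz h'
        refine hαβ i j (n + m) ?_
        rw [pow_add, ← inv_mul_cancel₀ hz, hn, hm]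
        ring
      rintro (i | i) - (j | j) - h h'
      · obtain ⟨n, hn⟩ := hz1 z i hz h
        obtain ⟨m, hm⟩ := hz1 z j hz h'
        by_contra hij
        exact hαα i j (fun h => hij (by rw [h])) _ (hcancel hn hm)
      · exact (hcross i j h h').elim
      · exact (hcross j i h' h).elim
      · obtain ⟨n, hn⟩ := hz2 z i hz h
        obtain ⟨m, hm⟩ := hz2 z j hz h'
        by_contra hij
        exact hββ i j (fun h => hij (by rw [h])) _ (hcancel hn hm)

/-! ### Integration over the unit circle. -/

section UnitCircle

lemma norm_circlePath_zero_one (t : ℝ) : ‖circlePath 0 1 t‖ = 1 := by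
  simpa using norm_circlePath_sub 0 1 t

lemma circlePath_zero_one_ne_zero (t : ℝ) : circlePath 0 1 t ≠ 0 :=
  norm_pos_iff.mp (by rw [norm_circlePath_zero_one]; exact one_pos)

lemma continuous_circlePath (a u : ℂ) : Continuous (circlePath a u) :=
  continuous_iff_continuousAt.mpr fun t => (hasDerivAt_circlePath a u t).continuousAt

lemma logIntegral_unitCircle (G : ℂ → ℂ) : logIntegral (circlePath 0 1) G =
    2 * Real.pi * Complex.I * ∫ t in (0 : ℝ)..1, G (circlePath 0 1 t) := by
  rw [logIntegral, contourIntegral, ← intervalIntegral.integral_const_mul]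
  refine intervalIntegral.integral_congr fun t _ => ?_
  have h := circlePath_zero_one_ne_zero t
  have e : deriv (circlePath 0 1) t = circlePath 0 1 t * (2 * Real.pi * Complex.I) := by
    rw [(hasDerivAt_circlePath 0 1 t).deriv, circlePath]; ring
  simp only [e]
  field_simp

lemma tendsto_logIntegral_unitCircle {F : ℕ → ℂ → ℂ} {G : ℂ → ℂ} (C : ℝ)
    (hc : ∀ᶠ n in Filter.atTop, ContinuousOn (F n) {z | ‖z‖ = 1})
    (hb : ∀ᶠ n in Filter.atTop, ∀ z, ‖z‖ = 1 → ‖F n z‖ ≤ C)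
    (hl : ∀ z, ‖z‖ = 1 → Filter.Tendsto (fun n => F n z) Filter.atTop (𝓝 (G z))) :
    Filter.Tendsto (fun n => logIntegral (circlePath 0 1) (F n)) Filter.atTop
      (𝓝 (logIntegral (circlePath 0 1) G)) := by
  simp only [logIntegral_unitCircle]
  refine Filter.Tendsto.const_mul _ ?_
  refine intervalIntegral.tendsto_integral_filter_of_dominated_convergence (fun _ => C) ?_ ?_
    intervalIntegrable_const ?_
  · filter_upwards [hc] with n hn
    have : Continuous fun t => F n (circlePath 0 1 t) :=
      hn.comp_continuous (continuous_circlePath 0 1) norm_circlePath_zero_one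
    exact this.aestronglyMeasurable
  · filter_upwards [hb] with n hn
    exact .of_forall fun t _ => hn _ (norm_circlePath_zero_one t)
  · exact .of_forall fun t _ => hl _ (norm_circlePath_zero_one t)

lemma separates_unitCircle {P Q : Set ℂ} (hP : ∀ z ∈ P, ‖z‖ < 1) (hQ : ∀ z ∈ Q, 1 < ‖z‖) :
    Separates P Q (circlePath 0 1) where
  isClosedPath := isClosedPath_circlePath 0 1
  ne_zero t _ := circlePath_zero_one_ne_zero t
  avoid_left a ha t _ h := by
    have := hP a ha
    rw [← h, norm_circlePath_zero_one] at this
    exact lt_irrefl _ this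
  avoid_right a ha t _ h := by
    have := hQ a ha
    rw [← h, norm_circlePath_zero_one] at this
    exact lt_irrefl _ this
  winding_zero := windingNumber_circlePath_center 0 one_ne_zero
  winding_left a ha := windingNumber_circlePath_zero_of_lt (by simpa using hP a ha)
  winding_right a ha := windingNumber_circlePath_of_lt 0 (by simpa using hQ a ha)

/-- Scaling moves the unit circle to another circle around `0`, and `G` has no pole between them.
The integral extracts the constant Laurent coefficient, which does not see the scaling. -/
lemma logIntegral_unitCircle_mul {G : ℂ → ℂ} (hG : ∀ z, z ≠ 0 → AnalyticAt ℂ G z) {p : ℂ}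
    (hp : p ≠ 0) : logIntegral (circlePath 0 1) (fun z => G (p * z)) =
      logIntegral (circlePath 0 1) G := by
  have hcl := isClosedPath_circlePath 0 1
  have h0 : ∀ t ∈ Icc (0 : ℝ) 1, circlePath 0 1 t ≠ 0 := fun t _ => circlePath_zero_one_ne_zero t
  rw [← logIntegral_mul hcl hp h0]
  have hfin : LocFin (∅ : Set ℂ) := ⟨notMem_empty 0, fun _ _ _ => by simp⟩
  have hgood : GoodOn ∅ (fun z => G z / z) :=
    ⟨fun z hz _ => (hG z hz).div analyticAt_id hz, fun z hz => absurd hz (notMem_empty z)⟩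
  have := contourIntegral_eq_mul hfin hgood
    (hcl.comp (φ := fun z => p * z) (U := univ) (contDiff_const.mul contDiff_id).contDiffOn
      (fun _ _ => mem_univ _)) hcl 1
    (fun t ht => ⟨mul_ne_zero hp (h0 t ht), h0 t ht⟩) (fun a ha => absurd ha (notMem_empty a))
    (by rw [windingNumber_mul_zero hcl hp h0, one_mul])
  rw [logIntegral, this, one_mul, logIntegral]

end UnitCircle

/-! ### Basic properties of the theta function. -/

section Theta

variable {q : ℂ}

lemma theta_mul_left (hq0 : q ≠ 0) (hq : ‖q‖ < 1) {x : ℂ} (hx : x ≠ 0) :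
    theta q (q * x) = -x⁻¹ * theta q x := by
  have e : q / (q * x) = x⁻¹ := by field_simp
  rw [theta, theta, e, qPochInf_eq_mul hq x, qPochInf_eq_mul hq x⁻¹, ← div_eq_mul_inv]
  field_simp
  ring

lemma theta_inv (hq : ‖q‖ < 1) {x : ℂ} (hx : x ≠ 0) : theta q x⁻¹ = -x⁻¹ * theta q x := by
  have e : q / x⁻¹ = q * x := by field_simp
  rw [theta, theta, e, qPochInf_eq_mul hq x, qPochInf_eq_mul hq x⁻¹, ← div_eq_mul_inv]
  field_simp
  ring

lemma analyticAt_theta (hq : ‖q‖ < 1) {x : ℂ} (hx : x ≠ 0) : AnalyticAt ℂ (theta q) x :=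
  (analyticAt_qPochInf hq x).mul
    (analyticAt_qPochInf_comp hq (analyticAt_const.div analyticAt_id hx))

lemma analyticAt_theta_comp (hq : ‖q‖ < 1) {f : ℂ → ℂ} {x : ℂ} (hf : AnalyticAt ℂ f x)
    (hx : f x ≠ 0) : AnalyticAt ℂ (fun z => theta q (f z)) x :=
  (analyticAt_theta hq hx).comp_of_eq hf rfl

end Theta

/-! ### The constant term of a theta function. -/

section ConstantTerm

/-- The finite theta product `∏_{i<n} (1 - w q^i)(1 - q^{i+1}/w)`. -/
def finTheta (q : ℂ) (n : ℕ) (w : ℂ) : ℂ :=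
  ∏ i ∈ Finset.range n, ((1 - w * q ^ i) * (1 - q ^ (i + 1) / w))

variable {q : ℂ}

/-- Both products telescope under `w ↦ qw`. This is the finite form of the quasi-periodicity `-w
θ(qw) = θ(w)`, recovered as `n → ∞`. -/
lemma finTheta_mul_left (hq0 : q ≠ 0) (n : ℕ) {w : ℂ} (hw : w ≠ 0) :
    (q ^ n - w) * finTheta q n (q * w) = (1 - w * q ^ n) * finTheta q n w := by
  have e1 : (∏ i ∈ Finset.range n, (1 - q * w * q ^ i)) * (1 - w) =
      (∏ i ∈ Finset.range n, (1 - w * q ^ i)) * (1 - w * q ^ n) := by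
    induction n with
    | zero => simp
    | succ n ih =>
      rw [Finset.prod_range_succ, mul_right_comm, ih, Finset.prod_range_succ]
      ring
  have e2 : (∏ i ∈ Finset.range n, (1 - q ^ (i + 1) / (q * w))) * (1 - q ^ n / w) =
      (∏ i ∈ Finset.range n, (1 - q ^ (i + 1) / w)) * (1 - 1 / w) := by
    clear e1
    induction n with
    | zero => simp
    | succ n ih =>
      have : q ^ (n + 1) / (q * w) = q ^ n / w := by
        rw [pow_succ]; field_simp
      rw [Finset.prod_range_succ, this, ih, Finset.prod_range_succ]
      ring
  have e3 : q ^ n - w = -w * (1 - q ^ n / w) := by field_simp; ring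
  have e4 : (1 - 1 / w) * -w = 1 - w := by field_simp; ring
  simp only [finTheta, Finset.prod_mul_distrib]
  rw [e3]
  linear_combination (-w * ∏ i ∈ Finset.range n, (1 - q * w * q ^ i)) * e2 +
    (∏ i ∈ Finset.range n, (1 - q * w * q ^ i)) * (∏ i ∈ Finset.range n, (1 - q ^ (i + 1) / w)) * e4 +
    (∏ i ∈ Finset.range n, (1 - q ^ (i + 1) / w)) * e1

lemma analyticAt_finTheta_sq (q : ℂ) (n : ℕ) {z : ℂ} (hz : z ≠ 0) :
    AnalyticAt ℂ (fun z => finTheta q n (z ^ 2)) z := by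
  refine Finset.analyticAt_fun_prod _ fun i _ => ?_
  have h2 : AnalyticAt ℂ (fun z : ℂ => z ^ 2) z := analyticAt_id.pow 2
  exact (analyticAt_const.sub (h2.mul analyticAt_const)).mul
    (analyticAt_const.sub (analyticAt_const.div h2 (pow_ne_zero 2 hz)))

lemma logIntegral_unitCircle_add {F G : ℂ → ℂ} (hF : ∀ z, z ≠ 0 → AnalyticAt ℂ F z)
    (hG : ∀ z, z ≠ 0 → AnalyticAt ℂ G z) : logIntegral (circlePath 0 1) (fun z => F z + G z) =
      logIntegral (circlePath 0 1) F + logIntegral (circlePath 0 1) G := by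
  have hne : ∀ w ∈ circlePath 0 1 '' Icc 0 1, w ≠ 0 := by
    rintro - ⟨t, -, rfl⟩; exact circlePath_zero_one_ne_zero t
  exact logIntegral_add (isClosedPath_circlePath 0 1) (fun t _ => circlePath_zero_one_ne_zero t)
    (fun z hz => (hF z (hne z hz)).continuousAt.continuousWithinAt)
    (fun z hz => (hG z (hne z hz)).continuousAt.continuousWithinAt)

/-- The constant term of the finite product is the central `q`-binomial coefficient. The functional
equation expresses the coefficients of `w` and `w⁻¹` through the constant term, and this suffices to
absorb the two factors added in passing from `n` to `n + 1`. -/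
lemma logIntegral_finTheta (hq0 : q ≠ 0) (hq : ‖q‖ < 1) (n : ℕ) :
    logIntegral (circlePath 0 1) (fun z => finTheta q n (z ^ 2)) *
      (∏ i ∈ Finset.range n, (1 - q ^ (i + 1))) ^ 2 =
    2 * Real.pi * Complex.I * ∏ i ∈ Finset.range (2 * n), (1 - q ^ (i + 1)) := by
  -- With `w = z²`, the shift `w ↦ qw` is `z ↦ pz` for a square root `p` of `q`.
  obtain ⟨p, hp⟩ := IsAlgClosed.exists_pow_nat_eq q (n := 2) two_pos
  have hp0 : p ≠ 0 := by rintro rfl; exact hq0 (by rw [← hp]; simp)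
  set E := logIntegral (circlePath 0 1) with hE
  induction n with
  | zero =>
    simp [finTheta, hE, logIntegral_unitCircle]
  | succ n ih =>
    set f : ℂ → ℂ := fun z => finTheta q n (z ^ 2) with hf
    have fan : ∀ z, z ≠ 0 → AnalyticAt ℂ f z := fun z hz => analyticAt_finTheta_sq q n hz
    have san : ∀ z : ℂ, z ≠ 0 → AnalyticAt ℂ (fun z : ℂ => z ^ 2) z := fun z _ => analyticAt_id.pow 2
    have ian : ∀ z : ℂ, z ≠ 0 → AnalyticAt ℂ (fun z : ℂ => (z ^ 2)⁻¹) z := fun z hz =>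
      (san z hz).inv (pow_ne_zero 2 hz)
    have gan : ∀ z, z ≠ 0 → AnalyticAt ℂ (fun z => z ^ 2 * f z) z := fun z hz =>
      (san z hz).mul (fan z hz)
    have han : ∀ z, z ≠ 0 → AnalyticAt ℂ (fun z => (z ^ 2)⁻¹ * f z) z := fun z hz =>
      (ian z hz).mul (fan z hz)
    have cm : ∀ (k : ℂ) {g : ℂ → ℂ}, (∀ z, z ≠ 0 → AnalyticAt ℂ g z) →
        ∀ z, z ≠ 0 → AnalyticAt ℂ (fun z => k * g z) z := fun k g hg z hz =>
      analyticAt_const.mul (hg z hz)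
    have lin : ∀ (k l : ℂ) {g h : ℂ → ℂ}, (∀ z, z ≠ 0 → AnalyticAt ℂ g z) →
        (∀ z, z ≠ 0 → AnalyticAt ℂ h z) → E (fun z => k * g z + l * h z) = k * E g + l * E h := by
      intro k l g h hg hh
      rw [hE, logIntegral_unitCircle_add (cm k hg) (cm l hh), logIntegral_const_mul,
        logIntegral_const_mul]
    have ep : ∀ z, f (p * z) = finTheta q n (q * z ^ 2) := fun z => by
      simp only [hf, mul_pow, hp]
    have key := fun z (hz : z ≠ 0) => finTheta_mul_left hq0 n (w := z ^ 2) (pow_ne_zero 2 hz)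
    -- the coefficients of `w` and `w⁻¹`
    have k1 : q ^ n * E f + -q⁻¹ * E (fun z => z ^ 2 * f z) =
        1 * E f + -q ^ n * E (fun z => z ^ 2 * f z) := by
      rw [← lin _ _ fan gan, ← lin _ _ fan gan, hE, ← logIntegral_unitCircle_mul (p := p) _ hp0]
      · refine logIntegral_congr fun t _ => ?_
        have hz := circlePath_zero_one_ne_zero t
        rw [ep, mul_pow, hp]
        field_simp
        linear_combination key _ hz
      · exact fun z hz => (cm _ fan z hz).add (cm _ gan z hz)
    have k2 : q ^ n * q * E (fun z => (z ^ 2)⁻¹ * f z) + -1 * E f =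
        1 * E (fun z => (z ^ 2)⁻¹ * f z) + -q ^ n * E f := by
      rw [← lin _ _ han fan, ← lin _ _ han fan, hE, ← logIntegral_unitCircle_mul (p := p) _ hp0]
      · refine logIntegral_congr fun t _ => ?_
        have hz := circlePath_zero_one_ne_zero t
        rw [ep, mul_pow, hp]
        field_simp
        linear_combination key _ hz
      · exact fun z hz => (cm _ han z hz).add (cm _ fan z hz)
    -- Expansion of the new factors `(1 - w q^n)(1 - q^{n+1}/w)`.
    have k3 : E (fun z => finTheta q (n + 1) (z ^ 2)) = (1 + q ^ (2 * n + 1)) * E f +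
        1 * E (fun z => -q ^ n * (z ^ 2 * f z) + -q ^ (n + 1) * ((z ^ 2)⁻¹ * f z)) := by
      have hgh : ∀ z, z ≠ 0 → AnalyticAt ℂ
          (fun z => -q ^ n * (z ^ 2 * f z) + -q ^ (n + 1) * ((z ^ 2)⁻¹ * f z)) z :=
        fun z hz => (cm _ gan z hz).add (cm _ han z hz)
      rw [← lin _ _ fan hgh]
      refine logIntegral_congr fun t _ => ?_
      have hz := circlePath_zero_one_ne_zero t
      simp only [finTheta, hf, Finset.prod_range_succ]
      field_simp
      ring
    rw [lin _ _ gan han] at k3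
    have hq1 : (1 - q ^ (n + 1)) ≠ 0 := fun h =>
      pow_ne_one_of_norm_lt hq (n := n + 1) (by omega) (by linear_combination -h)
    have k4 : E (fun z => finTheta q (n + 1) (z ^ 2)) * (1 - q ^ (n + 1)) =
        (1 + q ^ (n + 1)) * (1 - q ^ (2 * n + 1)) * E f := by
      have k1' : E (fun z => z ^ 2 * f z) * (1 - q ^ (n + 1)) = -q * (1 - q ^ n) * E f := by
        field_simp at k1
        linear_combination -k1
      have k2' : E (fun z => (z ^ 2)⁻¹ * f z) * (1 - q ^ (n + 1)) = -(1 - q ^ n) * E f := by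
        linear_combination -k2
      rw [k3]
      linear_combination -q ^ n * k1' - q ^ (n + 1) * k2'
    rw [Finset.prod_range_succ, show 2 * (n + 1) = 2 * n + 1 + 1 by ring, Finset.prod_range_succ,
      Finset.prod_range_succ]
    linear_combination (1 - q ^ (n + 1)) * (∏ i ∈ Finset.range n, (1 - q ^ (i + 1))) ^ 2 * k4 +
      (1 - q ^ (n + 1)) * (1 + q ^ (n + 1)) * (1 - q ^ (2 * n + 1)) * ih

lemma tendsto_finTheta (hq : ‖q‖ < 1) (w : ℂ) :
    Filter.Tendsto (fun n => finTheta q n w) Filter.atTop (𝓝 (theta q w)) := by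
  simp only [finTheta, Finset.prod_mul_distrib]
  refine Filter.Tendsto.mul (multipliable_qPochInf hq w).hasProd.tendsto_prod_nat ?_
  have := (multipliable_qPochInf hq (q / w)).hasProd.tendsto_prod_nat
  refine this.congr fun n => Finset.prod_congr rfl fun i _ => ?_
  rw [pow_succ]; ring

lemma norm_finTheta_le (hq : ‖q‖ < 1) (n : ℕ) {w : ℂ} (hw : ‖w‖ = 1) :
    ‖finTheta q n w‖ ≤ Real.exp (2 * (1 - ‖q‖)⁻¹) := by
  have h1 : ∀ i ∈ Finset.range n, ‖(1 - w * q ^ i) * (1 - q ^ (i + 1) / w)‖ ≤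
      Real.exp (2 * ‖q‖ ^ i) := by
    intro i _
    have e1 : ‖1 - w * q ^ i‖ ≤ Real.exp (‖q‖ ^ i) := by
      refine (norm_sub_le _ _).trans ?_
      rw [norm_one, norm_mul, hw, one_mul, norm_pow, add_comm]
      exact Real.add_one_le_exp _
    have e2 : ‖1 - q ^ (i + 1) / w‖ ≤ Real.exp (‖q‖ ^ i) := by
      refine (norm_sub_le _ _).trans ?_
      rw [norm_one, norm_div, hw, div_one, norm_pow, add_comm]
      refine le_trans ?_ (Real.add_one_le_exp _)
      have : ‖q‖ ^ (i + 1) ≤ ‖q‖ ^ i := pow_le_pow_of_le_one (norm_nonneg q) hq.le (by omega)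
      linarith
    rw [norm_mul, two_mul, Real.exp_add]
    gcongr
  rw [finTheta, norm_prod]
  refine (Finset.prod_le_prod (fun _ _ => norm_nonneg _) h1).trans ?_
  rw [← Real.exp_sum, Real.exp_le_exp, ← Finset.mul_sum]
  gcongr
  rw [← tsum_geometric_of_lt_one (norm_nonneg q) hq]
  exact (summable_geometric_of_lt_one (norm_nonneg q) hq).sum_le_tsum _ fun _ _ => by positivity

/-- Limit of `logIntegral_finTheta`, by dominated convergence: `(q)_{2n} / (q)_n²` tends to
`1/(q)_∞`. -/
lemma logIntegral_theta (hq0 : q ≠ 0) (hq : ‖q‖ < 1) :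
    logIntegral (circlePath 0 1) (fun z => theta q (z ^ 2)) * qPochInf q q =
      2 * Real.pi * Complex.I := by
  have h1 : Filter.Tendsto (fun n => logIntegral (circlePath 0 1) (fun z => finTheta q n (z ^ 2)))
      Filter.atTop (𝓝 (logIntegral (circlePath 0 1) (fun z => theta q (z ^ 2)))) := by
    refine tendsto_logIntegral_unitCircle (Real.exp (2 * (1 - ‖q‖)⁻¹)) (.of_forall fun n z hz => ?_)
      (.of_forall fun n z hz => norm_finTheta_le hq n (by rw [norm_pow, hz, one_pow]))
      fun z _ => tendsto_finTheta hq _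
    have hz0 : z ≠ 0 := norm_pos_iff.mp (by rw [show ‖z‖ = 1 from hz]; exact one_pos)
    exact (analyticAt_finTheta_sq q n hz0).continuousAt.continuousWithinAt
  have h2 : Filter.Tendsto (fun n => ∏ i ∈ Finset.range n, (1 - q ^ (i + 1))) Filter.atTop
      (𝓝 (qPochInf q q)) := by
    refine (multipliable_qPochInf hq q).hasProd.tendsto_prod_nat.congr fun n =>
      Finset.prod_congr rfl fun i _ => by rw [pow_succ']
  have h3 := h2.comp (Filter.tendsto_id.const_mul_atTop' (two_pos : 0 < 2))
  have h4 := tendsto_nhds_unique ((h1.mul (h2.pow 2)).congr fun n => logIntegral_finTheta hq0 hq n)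
    (h3.const_mul (2 * Real.pi * Complex.I))
  have hne := qPochInf_ne_zero_of_norm_lt hq hq
  apply mul_right_cancel₀ hne
  linear_combination h4

/-- With `w = z²` one has `(w)_∞ (1/w)_∞ = (1 - 1/w) θ(w) = θ(w) + θ(qw)`, and both summands have
the same constant term. -/
lemma logIntegral_weight (hq0 : q ≠ 0) (hq : ‖q‖ < 1) :
    logIntegral (circlePath 0 1) (fun z => qPochInf q (z ^ 2) * qPochInf q (z ^ 2)⁻¹) *
      qPochInf q q = 2 * (2 * Real.pi * Complex.I) := by
  obtain ⟨p, hp⟩ := IsAlgClosed.exists_pow_nat_eq q (n := 2) two_pos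
  have hp0 : p ≠ 0 := by rintro rfl; exact hq0 (by rw [← hp]; simp)
  have han : ∀ z, z ≠ 0 → AnalyticAt ℂ (fun z => theta q (z ^ 2)) z := fun z hz =>
    analyticAt_theta_comp hq (analyticAt_id.pow 2) (pow_ne_zero 2 hz)
  have h1 := logIntegral_unitCircle_mul han hp0
  have h2 : logIntegral (circlePath 0 1) (fun z => qPochInf q (z ^ 2) * qPochInf q (z ^ 2)⁻¹) =
      logIntegral (circlePath 0 1) (fun z => theta q (z ^ 2) + theta q ((p * z) ^ 2)) := by
    refine logIntegral_congr fun t _ => ?_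
    have hz := circlePath_zero_one_ne_zero t
    rw [mul_pow, hp, theta_mul_left hq0 hq (pow_ne_zero 2 hz), theta,
      qPochInf_eq_mul hq (circlePath 0 1 t ^ 2)⁻¹, ← div_eq_mul_inv q]
    ring
  have han' : ∀ z, z ≠ 0 → AnalyticAt ℂ (fun z => theta q ((p * z) ^ 2)) z := fun z hz =>
    (han (p * z) (mul_ne_zero hp0 hz)).comp_of_eq (analyticAt_const.mul analyticAt_id) rfl
  rw [h2, logIntegral_unitCircle_add han han', h1]
  linear_combination 2 * logIntegral_theta hq0 hq

end ConstantTerm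

/-! ### The Nassrallah–Rahman integral. -/

/-- The integrand of the Nassrallah–Rahman integral, without the factor `1/z`. -/
def nrWeight (q : ℂ) (a : Fin 5 → ℂ) (z : ℂ) : ℂ :=
  (qPochInf q (z ^ 2) * qPochInf q (z ^ 2)⁻¹ *
    (qPochInf q ((∏ j, a j) * z) * qPochInf q ((∏ j, a j) / z))) /
    ∏ j, (qPochInf q (a j * z) * qPochInf q (a j / z))

/-- Genericity of the parameters of the Nassrallah–Rahman integral. -/
structure NRGeneric (q : ℂ) (a : Fin 5 → ℂ) : Prop where
  ne_zero : ∀ j, a j ≠ 0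
  mul_ne : ∀ i j, ∀ n : ℤ, a i * a j ≠ q ^ n
  ne_mul : ∀ i j, i ≠ j → ∀ n : ℤ, a i ≠ a j * q ^ n
  prod_ne : ∀ j, ∀ n : ℤ, ∏ i, a i ≠ a j * q ^ n

/-- The auxiliary function whose integral vanishes by antisymmetry under `z ↦ 1/(qz)`. -/
def nrAux (q : ℂ) (a : Fin 5 → ℂ) (z : ℂ) : ℂ :=
  (qPochInf q (q * z ^ 2) * qPochInf q (z ^ 2)⁻¹ *
    (qPochInf q (q * (∏ j, a j) * z) * qPochInf q ((∏ j, a j) / z)) * z⁻¹) /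
    ∏ j, (qPochInf q (q * a j * z) * qPochInf q (a j / z))

section NR

variable {q : ℂ} {a : Fin 5 → ℂ}

/-- The map `z ↦ 1/(qz)` swaps the two factors in each pair containing `a j` or `∏ j, a j`. The sign
comes from `(1 - 1/(qz²))/(1 - qz²) = -1/(qz²)`, combined with `z⁻¹ ↦ qz`. -/
lemma nrAux_antisymm (hq0 : q ≠ 0) (hq : ‖q‖ < 1) {z : ℂ} (hz : z ≠ 0) :
    nrAux q a (q * z)⁻¹ = - nrAux q a z := by
  have e1 : ∀ x : ℂ, q * x * (q * z)⁻¹ = x / z := fun x => by field_simp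
  have e2 : ∀ x : ℂ, x / (q * z)⁻¹ = q * x * z := fun x => by field_simp
  have e3 : q * ((q * z)⁻¹) ^ 2 = (q * z ^ 2)⁻¹ := by field_simp
  have e4 : (((q * z)⁻¹) ^ 2)⁻¹ = q * (q * z ^ 2) := by field_simp
  have e5 : q * (q * z ^ 2)⁻¹ = (z ^ 2)⁻¹ := by field_simp
  have h1 := qPochInf_eq_mul hq (q * z ^ 2)⁻¹
  have h2 := qPochInf_eq_mul hq (q * z ^ 2)
  rw [e5] at h1
  unfold nrAux
  simp only [e1, e2, e3, e4, inv_inv]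
  rw [h1, h2, ← neg_div]
  congr 1
  · field_simp
    ring
  · exact Finset.prod_congr rfl fun j _ => mul_comm _ _

lemma analyticAt_qPochInf_mul (hq : ‖q‖ < 1) (c z : ℂ) :
    AnalyticAt ℂ (fun z => qPochInf q (c * z)) z :=
  analyticAt_qPochInf_comp hq (analyticAt_const.mul analyticAt_id)

lemma analyticAt_qPochInf_div (hq : ‖q‖ < 1) (c : ℂ) {z : ℂ} (hz : z ≠ 0) :
    AnalyticAt ℂ (fun z => qPochInf q (c / z)) z :=
  analyticAt_qPochInf_comp hq (analyticAt_const.div analyticAt_id hz)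

lemma analyticAt_weight (hq : ‖q‖ < 1) {z : ℂ} (hz : z ≠ 0) :
    AnalyticAt ℂ (fun z => qPochInf q (z ^ 2) * qPochInf q (z ^ 2)⁻¹) z :=
  (analyticAt_qPochInf_comp hq (analyticAt_id.pow 2)).mul
    (analyticAt_qPochInf_comp hq ((analyticAt_id.pow 2).inv (pow_ne_zero 2 hz)))

lemma NRGeneric.mul_mul_pow_ne_one (h : NRGeneric q a) (i j : Fin 5) (n : ℕ) :
    a i * a j * q ^ n ≠ 1 := by
  intro h1
  refine h.mul_ne i j (-n) ?_
  rw [zpow_neg, zpow_natCast]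
  exact eq_inv_of_mul_eq_one_left h1

lemma goodOn_nrWeight (hq0 : q ≠ 0) (hq : ‖q‖ < 1) (h : NRGeneric q a) :
    GoodOn (poleSeq q a ∪ poleSeqInv q a) (nrWeight q a) :=
  goodOn_quotient hq0 hq h.ne_zero h.ne_zero (h.mul_mul_pow_ne_one) h.ne_mul h.ne_mul
    fun z hz => (analyticAt_weight hq hz).mul
      ((analyticAt_qPochInf_mul hq _ z).mul (analyticAt_qPochInf_div hq _ hz))

lemma goodOn_nrAux (hq0 : q ≠ 0) (hq : ‖q‖ < 1) (h : NRGeneric q a) :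
    GoodOn (poleSeq q a ∪ poleSeqInv q (fun j => q * a j)) (nrAux q a) := by
  refine goodOn_quotient hq0 hq (fun j => mul_ne_zero hq0 (h.ne_zero j)) h.ne_zero
    (fun i j n => ?_) (fun i j hij n => ?_) h.ne_mul fun z hz => ?_
  · have := h.mul_mul_pow_ne_one i j (n + 1)
    rwa [show q * a i * a j * q ^ n = a i * a j * q ^ (n + 1) by ring]
  · rw [mul_assoc]
    exact fun h1 => h.ne_mul i j hij n (mul_left_cancel₀ hq0 h1)
  · refine (((analyticAt_qPochInf_comp hq (analyticAt_const.mul (analyticAt_id.pow 2))).mul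
      (analyticAt_qPochInf_comp hq ((analyticAt_id.pow 2).inv (pow_ne_zero 2 hz)))).mul
      ((analyticAt_qPochInf_mul hq _ z).mul (analyticAt_qPochInf_div hq _ hz))).mul
      (analyticAt_inv hz)

lemma goodOn_nrAux_inv (hq0 : q ≠ 0) (hq : ‖q‖ < 1) (h : NRGeneric q a) :
    GoodOn (poleSeq q (fun j => q * a j) ∪ poleSeqInv q a) (fun z => nrAux q a z⁻¹) := by
  have := goodOn_quotient hq0 hq h.ne_zero (fun j => mul_ne_zero hq0 (h.ne_zero j))
    (fun i j n => ?_) h.ne_mul (fun i j hij n => ?_) (f := fun z => qPochInf q (q / z ^ 2) *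
      qPochInf q (z ^ 2) * (qPochInf q (q * (∏ j, a j) / z) * qPochInf q ((∏ j, a j) * z)) * z)
      fun z hz => ?_
  · convert this using 2 with z
    unfold nrAux
    simp only [inv_pow, inv_inv, div_inv_eq_mul, ← div_eq_mul_inv]
    congr 1
    exact Finset.prod_congr rfl fun j _ => mul_comm _ _
  · have := h.mul_mul_pow_ne_one i j (n + 1)
    rwa [show a i * (q * a j) * q ^ n = a i * a j * q ^ (n + 1) by ring]
  · rw [mul_assoc]
    exact fun h1 => h.ne_mul i j hij n (mul_left_cancel₀ hq0 h1)
  · refine (((analyticAt_qPochInf_comp hq (analyticAt_const.div (analyticAt_id.pow 2)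
      (pow_ne_zero 2 hz))).mul (analyticAt_qPochInf_comp hq (analyticAt_id.pow 2))).mul
      ((analyticAt_qPochInf_div hq _ hz).mul (analyticAt_qPochInf_mul hq _ z))).mul analyticAt_id

lemma poleSeq_mul_subset {ι : Type*} (q : ℂ) (β : ι → ℂ) :
    poleSeq q (fun j => q * β j) ⊆ poleSeq q β := by
  rintro z ⟨j, n, rfl⟩
  exact ⟨j, n + 1, by ring⟩

lemma poleSeqInv_mul_subset {ι : Type*} (q : ℂ) (β : ι → ℂ) :
    poleSeqInv q (fun j => q * β j) ⊆ poleSeqInv q β :=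
  fun _ hz => poleSeq_mul_subset q β hz

variable {P Q : Set ℂ} {γ : ℝ → ℂ}

/-- The poles `1/(a_j q^n)` occur only for `n ≥ 1`, so `z ↦ 1/(qz)` exchanges the two pole
sequences. -/
lemma logIntegral_nrAux (hq0 : q ≠ 0) (hq : ‖q‖ < 1) (h : NRGeneric q a)
    (hγ : Separates P Q γ) (hP : poleSeq q a ⊆ P) (hQ : poleSeqInv q a ⊆ Q) :
    logIntegral γ (nrAux q a) = 0 := by
  refine hγ.logIntegral_eq_zero hq0 hP ((poleSeqInv_mul_subset q a).trans hQ) ?_ ?_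
    (locFin_poleSeq hq0 hq (fun j => mul_ne_zero hq0 (h.ne_zero j)) h.ne_zero)
    (goodOn_nrAux hq0 hq h) fun z hz => nrAux_antisymm hq0 hq hz
  · rintro z ⟨j, n, rfl⟩
    refine hQ ⟨j, n + 1, ?_⟩
    rw [inv_inv]; ring
  · rintro z ⟨j, n, hn⟩
    refine hP ⟨j, n, ?_⟩
    rw [mul_inv, hn]
    field_simp

lemma logIntegral_nrAux_inv (hq0 : q ≠ 0) (hq : ‖q‖ < 1) (h : NRGeneric q a)
    (hγ : Separates P Q γ) (hP : poleSeq q a ⊆ P) (hQ : poleSeqInv q a ⊆ Q) :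
    logIntegral γ (fun z => nrAux q a z⁻¹) = 0 := by
  refine hγ.logIntegral_eq_zero (inv_ne_zero hq0) ((poleSeq_mul_subset q a).trans hP) hQ ?_ ?_
    (locFin_poleSeq hq0 hq h.ne_zero (fun j => mul_ne_zero hq0 (h.ne_zero j)))
    (goodOn_nrAux_inv hq0 hq h) fun z hz => ?_
  · rintro z ⟨j, n, rfl⟩
    refine hQ ⟨j, n, ?_⟩
    rw [inv_inv]
    field_simp
  · rintro z ⟨j, n, hn⟩
    refine hP ⟨j, n + 1, ?_⟩
    rw [mul_inv, hn, inv_inv]; ring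
  · have := nrAux_antisymm (a := a) hq0 hq (inv_ne_zero hz)
    rw [← this]
    congr 1
    field_simp

/-- What remains of the contiguity relation after the common infinite products are divided out, with
`x` the shifted parameter and `y₁, …, y₄` the others. The bracket on the right is symmetric under `z
↦ 1/z`. -/
lemma nr_polynomial_identity (x y₁ y₂ y₃ y₄ : ℂ) {z : ℂ} (hz : z ≠ 0) :
    (1 - z ^ 2) * (1 - (z ^ 2)⁻¹) *
      ((1 - x * z) * (1 - x / z) * ((1 - x * y₂ * y₃ * y₄) * (1 - x * y₁ * y₃ * y₄) *
          (1 - x * y₁ * y₂ * y₄) * (1 - x * y₁ * y₂ * y₃)) -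
        (1 - x * y₁ * y₂ * y₃ * y₄ * z) * (1 - x * y₁ * y₂ * y₃ * y₄ / z) *
          ((1 - x * y₁) * (1 - x * y₂) * (1 - x * y₃) * (1 - x * y₄))) =
    -(x * (1 - x * y₁ * y₂ * y₃ * y₄ * x)) *
      ((1 - (z ^ 2)⁻¹) * (1 - x * y₁ * y₂ * y₃ * y₄ / z) * z⁻¹ *
          ((1 - x * z) * (1 - y₁ * z) * (1 - y₂ * z) * (1 - y₃ * z) * (1 - y₄ * z)) +
        (1 - z ^ 2) * (1 - x * y₁ * y₂ * y₃ * y₄ * z) * z *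
          ((1 - x / z) * (1 - y₁ / z) * (1 - y₂ / z) * (1 - y₃ / z) * (1 - y₄ / z))) := by
  field_simp
  ring

lemma nr_polynomial_identity' (ha : ∀ j, a j ≠ 0) (i : Fin 5) {z : ℂ} (hz : z ≠ 0) :
    (1 - z ^ 2) * (1 - (z ^ 2)⁻¹) *
      ((1 - a i * z) * (1 - a i / z) * ∏ j ∈ Finset.univ.erase i, (1 - (∏ l, a l) / a j) -
        (1 - (∏ l, a l) * z) * (1 - (∏ l, a l) / z) * ∏ j ∈ Finset.univ.erase i, (1 - a i * a j)) =
    -(a i * (1 - (∏ l, a l) * a i)) *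
      ((1 - (z ^ 2)⁻¹) * (1 - (∏ l, a l) / z) * z⁻¹ * ∏ j, (1 - a j * z) +
        (1 - z ^ 2) * (1 - (∏ l, a l) * z) * z * ∏ j, (1 - a j / z)) := by
  have h0 := ha 0
  have h1 := ha 1
  have h2 := ha 2
  have h3 := ha 3
  have h4 := ha 4
  have d : ∀ x y w : ℂ, w ≠ 0 → x = w * y → x / w = y := fun x y w hw h => by
    rw [h, mul_div_cancel_left₀ _ hw]
  simp only [Fin.prod_univ_five]
  fin_cases i
  · have e : (Finset.univ.erase (0 : Fin 5)) = {1, 2, 3, 4} := by decide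
    simp only [Fin.zero_eta, Fin.isValue, e]
    simp
    rw [d _ (a 0 * a 2 * a 3 * a 4) _ h1 (by ring), d _ (a 0 * a 1 * a 3 * a 4) _ h2 (by ring),
      d _ (a 0 * a 1 * a 2 * a 4) _ h3 (by ring), d _ (a 0 * a 1 * a 2 * a 3) _ h4 (by ring)]
    linear_combination nr_polynomial_identity (a 0) (a 1) (a 2) (a 3) (a 4) hz
  · have e : (Finset.univ.erase (1 : Fin 5)) = {0, 2, 3, 4} := by decide
    simp only [Fin.mk_one, Fin.isValue, e]
    simp
    rw [d _ (a 1 * a 2 * a 3 * a 4) _ h0 (by ring), d _ (a 1 * a 0 * a 3 * a 4) _ h2 (by ring),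
      d _ (a 1 * a 0 * a 2 * a 4) _ h3 (by ring), d _ (a 1 * a 0 * a 2 * a 3) _ h4 (by ring)]
    linear_combination nr_polynomial_identity (a 1) (a 0) (a 2) (a 3) (a 4) hz
  · have e : (Finset.univ.erase (2 : Fin 5)) = {0, 1, 3, 4} := by decide
    simp only [Fin.reduceFinMk, Fin.isValue, e]
    simp
    rw [d _ (a 2 * a 1 * a 3 * a 4) _ h0 (by ring), d _ (a 2 * a 0 * a 3 * a 4) _ h1 (by ring),
      d _ (a 2 * a 0 * a 1 * a 4) _ h3 (by ring), d _ (a 2 * a 0 * a 1 * a 3) _ h4 (by ring)]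
    linear_combination nr_polynomial_identity (a 2) (a 0) (a 1) (a 3) (a 4) hz
  · have e : (Finset.univ.erase (3 : Fin 5)) = {0, 1, 2, 4} := by decide
    simp only [Fin.reduceFinMk, Fin.isValue, e]
    simp
    rw [d _ (a 3 * a 1 * a 2 * a 4) _ h0 (by ring), d _ (a 3 * a 0 * a 2 * a 4) _ h1 (by ring),
      d _ (a 3 * a 0 * a 1 * a 4) _ h2 (by ring), d _ (a 3 * a 0 * a 1 * a 2) _ h4 (by ring)]
    linear_combination nr_polynomial_identity (a 3) (a 0) (a 1) (a 2) (a 4) hz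
  · have e : (Finset.univ.erase (4 : Fin 5)) = {0, 1, 2, 3} := by decide
    simp only [Fin.reduceFinMk, Fin.isValue, e]
    simp
    rw [d _ (a 4 * a 1 * a 2 * a 3) _ h0 (by ring), d _ (a 4 * a 0 * a 2 * a 3) _ h1 (by ring),
      d _ (a 4 * a 0 * a 1 * a 3) _ h2 (by ring), d _ (a 4 * a 0 * a 1 * a 2) _ h3 (by ring)]
    linear_combination nr_polynomial_identity (a 4) (a 0) (a 1) (a 2) (a 3) hz

lemma prod_update_mul (q : ℂ) (a : Fin 5 → ℂ) (i : Fin 5) :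
    ∏ j, Function.update a i (q * a i) j = q * ∏ j, a j := by
  rw [Finset.prod_update_of_mem (Finset.mem_univ i), Finset.sdiff_singleton_eq_erase,
    mul_assoc, Finset.mul_prod_erase _ _ (Finset.mem_univ i)]

/-- The integrands with `a i` and `q a i` differ, after weighting, by a symmetrized `nrAux`, whose
integral is zero. -/
lemma nrWeight_contiguity (hq : ‖q‖ < 1) (ha : ∀ j, a j ≠ 0) (i : Fin 5) {z : ℂ}
    (hz : z ≠ 0) (h1 : ∀ j, 1 - a j * z ≠ 0) (h2 : ∀ j, 1 - a j / z ≠ 0) :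
    (∏ j ∈ Finset.univ.erase i, (1 - (∏ l, a l) / a j)) *
        nrWeight q (Function.update a i (q * a i)) z =
      (∏ j ∈ Finset.univ.erase i, (1 - a i * a j)) * nrWeight q a z +
      -(a i * (1 - (∏ l, a l) * a i)) * (nrAux q a z + nrAux q a z⁻¹) := by
  set A := ∏ l, a l with hA
  -- The common infinite-product factor: all four functions in the relation are elementary multiples
  -- of `w`.
  set w : ℂ := (qPochInf q (q * z ^ 2) * qPochInf q (q * (z ^ 2)⁻¹) *
    (qPochInf q (q * A * z) * qPochInf q (q * A / z))) /
    ∏ j, (qPochInf q (a j * z) * qPochInf q (a j / z)) with hw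
  have p1 := qPochInf_eq_mul hq (z ^ 2)
  have p2 := qPochInf_eq_mul hq (z ^ 2)⁻¹
  have p3 := qPochInf_eq_mul hq (A * z)
  have p4 := qPochInf_eq_mul hq (A / z)
  have p5 : ∀ j, qPochInf q (q * a j * z) = qPochInf q (a j * z) / (1 - a j * z) := fun j => by
    rw [qPochInf_eq_mul hq (a j * z), mul_div_cancel_left₀ _ (h1 j), mul_assoc]
  have p6 : ∀ j, qPochInf q (q * a j / z) = qPochInf q (a j / z) / (1 - a j / z) := fun j => by
    rw [qPochInf_eq_mul hq (a j / z), mul_div_cancel_left₀ _ (h2 j), mul_div_assoc]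
  rw [← mul_assoc] at p3
  rw [← mul_div_assoc] at p4
  have e1 : nrWeight q a z = (1 - z ^ 2) * (1 - (z ^ 2)⁻¹) * ((1 - A * z) * (1 - A / z)) * w := by
    rw [nrWeight, ← hA, p1, p2, p3, p4, hw]; ring
  have e2 : nrWeight q (Function.update a i (q * a i)) z =
      (1 - z ^ 2) * (1 - (z ^ 2)⁻¹) * ((1 - a i * z) * (1 - a i / z)) * w := by
    have e3 : ∏ j, (qPochInf q (Function.update a i (q * a i) j * z) *
        qPochInf q (Function.update a i (q * a i) j / z)) =
        (∏ j, (qPochInf q (a j * z) * qPochInf q (a j / z))) / ((1 - a i * z) * (1 - a i / z)) := by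
      rw [← Finset.mul_prod_erase _ _ (Finset.mem_univ i), Function.update_self, p5, p6,
        ← Finset.mul_prod_erase Finset.univ (fun j => qPochInf q (a j * z) * qPochInf q (a j / z))
          (Finset.mem_univ i)]
      rw [Finset.prod_congr rfl fun j hj => by
        rw [Function.update_of_ne (Finset.ne_of_mem_erase hj)]]
      field_simp
    rw [nrWeight, prod_update_mul, ← hA, e3, p1, p2, hw]
    field_simp
  have e4 : nrAux q a z = (1 - (z ^ 2)⁻¹) * (1 - A / z) * z⁻¹ * (∏ j, (1 - a j * z)) * w := by
    have hne : ∏ j, (1 - a j * z) ≠ 0 := Finset.prod_ne_zero_iff.mpr fun j _ => h1 j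
    have e5 : ∏ j, (qPochInf q (q * a j * z) * qPochInf q (a j / z)) =
        (∏ j, (qPochInf q (a j * z) * qPochInf q (a j / z))) / ∏ j, (1 - a j * z) := by
      rw [← Finset.prod_div_distrib]
      exact Finset.prod_congr rfl fun j _ => by rw [p5]; ring
    rw [nrAux, ← hA, e5, p2, p4, hw, div_div_eq_mul_div]
    ring
  have e6 : nrAux q a z⁻¹ = (1 - z ^ 2) * (1 - A * z) * z * (∏ j, (1 - a j / z)) * w := by
    have hne : ∏ j, (1 - a j / z) ≠ 0 := Finset.prod_ne_zero_iff.mpr fun j _ => h2 j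
    have e5 : ∏ j, (qPochInf q (q * a j * z⁻¹) * qPochInf q (a j / z⁻¹)) =
        (∏ j, (qPochInf q (a j * z) * qPochInf q (a j / z))) / ∏ j, (1 - a j / z) := by
      rw [← Finset.prod_div_distrib]
      exact Finset.prod_congr rfl fun j _ => by
        rw [← div_eq_mul_inv, p6, div_inv_eq_mul]; ring
    rw [nrAux, ← hA, e5, inv_inv, inv_pow, inv_inv, p1, div_inv_eq_mul, ← div_eq_mul_inv (q * A), p3,
      hw, div_div_eq_mul_div]
    ring
  rw [e1, e2, e4, e6]
  linear_combination w * nr_polynomial_identity' ha i hz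

end NR

section NR

variable {q : ℂ} {a c : Fin 5 → ℂ} {P Q : Set ℂ} {γ : ℝ → ℂ}

/-- The product `∏_{i<j} (a_i a_j)_∞`. -/
def pairProd {n : ℕ} (q : ℂ) (a : Fin n → ℂ) : ℂ :=
  ∏ i, ∏ j ∈ Finset.Ioi i, qPochInf q (a i * a j)

lemma Separates.one_sub_ne_zero {ι : Type*} {a : ι → ℂ} (hγ : Separates P Q γ)
    (hP : poleSeq q a ⊆ P) (hQ : poleSeqInv q a ⊆ Q) {t : ℝ} (ht : t ∈ Icc (0 : ℝ) 1) (j : ι) :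
    1 - a j * γ t ≠ 0 ∧ 1 - a j / γ t ≠ 0 := by
  have hz := hγ.ne_zero t ht
  constructor
  · intro h
    refine hγ.avoid_right _ (hQ (a := γ t) ⟨j, 0, ?_⟩) t ht rfl
    rw [pow_zero, mul_one]
    exact inv_eq_of_mul_eq_one_left (by linear_combination -h)
  · intro h
    refine hγ.avoid_left _ (hP (a := γ t) ⟨j, 0, ?_⟩) t ht rfl
    rw [pow_zero, mul_one]
    field_simp at h
    linear_combination h

lemma GoodOn.continuousOn_image {P' : Set ℂ} {F : ℂ → ℂ} (hF : GoodOn P' F)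
    (hγ : Separates P Q γ) (h : P' ⊆ P ∪ Q) : ContinuousOn F (γ '' Icc 0 1) := by
  rintro - ⟨t, ht, rfl⟩
  refine (hF.analyticAt _ (hγ.ne_zero t ht) fun hm => ?_).continuousAt.continuousWithinAt
  rcases h hm with h1 | h1
  · exact hγ.avoid_left _ h1 t ht rfl
  · exact hγ.avoid_right _ h1 t ht rfl

lemma logIntegral_nrWeight_contiguity (hq0 : q ≠ 0) (hq : ‖q‖ < 1) (h : NRGeneric q a)
    (hγ : Separates P Q γ) (hP : poleSeq q a ⊆ P) (hQ : poleSeqInv q a ⊆ Q) (i : Fin 5) :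
    (∏ j ∈ Finset.univ.erase i, (1 - (∏ l, a l) / a j)) *
        logIntegral γ (nrWeight q (Function.update a i (q * a i))) =
      (∏ j ∈ Finset.univ.erase i, (1 - a i * a j)) * logIntegral γ (nrWeight q a) := by
  have c1 := (goodOn_nrWeight hq0 hq h).continuousOn_image hγ (union_subset_union hP hQ)
  have c2 := (goodOn_nrAux hq0 hq h).continuousOn_image hγ
    (union_subset_union hP ((poleSeqInv_mul_subset q a).trans hQ))
  have c3 := (goodOn_nrAux_inv hq0 hq h).continuousOn_image hγ
    (union_subset_union ((poleSeq_mul_subset q a).trans hP) hQ)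
  set u := ∏ j ∈ Finset.univ.erase i, (1 - (∏ l, a l) / a j)
  set v := ∏ j ∈ Finset.univ.erase i, (1 - a i * a j)
  set w := -(a i * (1 - (∏ l, a l) * a i))
  have s1 : logIntegral γ (fun z => nrAux q a z + nrAux q a z⁻¹) = 0 := by
    rw [logIntegral_add hγ.isClosedPath hγ.ne_zero c2 c3, logIntegral_nrAux hq0 hq h hγ hP hQ,
      logIntegral_nrAux_inv hq0 hq h hγ hP hQ, add_zero]
  have s2 : logIntegral γ (fun z => v * nrWeight q a z + w * (nrAux q a z + nrAux q a z⁻¹)) =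
      v * logIntegral γ (nrWeight q a) := by
    have c4 : ContinuousOn (fun z => v * nrWeight q a z) (γ '' Icc 0 1) := continuousOn_const.mul c1
    have c5 : ContinuousOn (fun z => w * (nrAux q a z + nrAux q a z⁻¹)) (γ '' Icc 0 1) :=
      continuousOn_const.mul (c2.add c3)
    rw [logIntegral_add hγ.isClosedPath hγ.ne_zero c4 c5, logIntegral_const_mul,
      logIntegral_const_mul, s1, mul_zero, add_zero]
  rw [← logIntegral_const_mul, ← s2]
  exact logIntegral_congr fun t ht => nrWeight_contiguity hq h.ne_zero i (hγ.ne_zero t ht)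
    (fun j => (hγ.one_sub_ne_zero hP hQ ht j).1) (fun j => (hγ.one_sub_ne_zero hP hQ ht j).2)

/-- This factor and that of `prod_qPochInf_div_update` are the two constants of the contiguity
relation, which is why `nrRatio` is invariant. -/
lemma pairProd_update (hq : ‖q‖ < 1) (a : Fin 5 → ℂ) (i : Fin 5) :
    pairProd q a = pairProd q (Function.update a i (q * a i)) *
      ∏ j ∈ Finset.univ.erase i, (1 - a i * a j) := by
  have key : ∀ j, qPochInf q (a i * a j) = (1 - a i * a j) * qPochInf q (q * a i * a j) := fun j => by
    rw [qPochInf_eq_mul hq, mul_assoc]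
  have e0 : Finset.Ioi (0 : Fin 5) = {1, 2, 3, 4} := by decide
  have e1 : Finset.Ioi (1 : Fin 5) = {2, 3, 4} := by decide
  have e2 : Finset.Ioi (2 : Fin 5) = {3, 4} := by decide
  have e3 : Finset.Ioi (3 : Fin 5) = {4} := by decide
  have e4 : Finset.Ioi (4 : Fin 5) = ∅ := by decide
  have expand : ∀ x : Fin 5 → ℂ, pairProd q x = qPochInf q (x 0 * x 1) * qPochInf q (x 0 * x 2) *
      qPochInf q (x 0 * x 3) * qPochInf q (x 0 * x 4) * qPochInf q (x 1 * x 2) *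
      qPochInf q (x 1 * x 3) * qPochInf q (x 1 * x 4) * qPochInf q (x 2 * x 3) *
      qPochInf q (x 2 * x 4) * qPochInf q (x 3 * x 4) := by
    intro x
    rw [pairProd, Fin.prod_univ_five, e0, e1, e2, e3, e4]
    simp [-mul_eq_mul_right_iff, -mul_eq_mul_left_iff]
    ring
  have comm : ∀ j, a j * a i = a i * a j := fun j => mul_comm _ _
  have comm' : ∀ j, a j * (q * a i) = q * a i * a j := fun j => mul_comm _ _
  rw [expand, expand]
  fin_cases i
  · have e : Finset.univ.erase (0 : Fin 5) = {1, 2, 3, 4} := by decide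
    simp only [Fin.zero_eta, Fin.isValue, e] at *
    simp [-mul_eq_mul_right_iff, -mul_eq_mul_left_iff, Function.update, key]
    ring
  · have e : Finset.univ.erase (1 : Fin 5) = {0, 2, 3, 4} := by decide
    simp only [Fin.mk_one, Fin.isValue, e] at *
    simp [-mul_eq_mul_right_iff, -mul_eq_mul_left_iff, Function.update, comm 0, comm' 0, key]
    ring
  · have e : Finset.univ.erase (2 : Fin 5) = {0, 1, 3, 4} := by decide
    simp only [Fin.reduceFinMk, Fin.isValue, e] at *
    simp [-mul_eq_mul_right_iff, -mul_eq_mul_left_iff, Function.update, comm 0, comm' 0, comm 1, comm' 1, key]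
    ring
  · have e : Finset.univ.erase (3 : Fin 5) = {0, 1, 2, 4} := by decide
    simp only [Fin.reduceFinMk, Fin.isValue, e] at *
    simp [-mul_eq_mul_right_iff, -mul_eq_mul_left_iff, Function.update, comm 0, comm' 0, comm 1, comm' 1, comm 2, comm' 2, key]
    ring
  · have e : Finset.univ.erase (4 : Fin 5) = {0, 1, 2, 3} := by decide
    simp only [Fin.reduceFinMk, Fin.isValue, e] at *
    simp [-mul_eq_mul_right_iff, -mul_eq_mul_left_iff, Function.update, comm 0, comm' 0, comm 1, comm' 1, comm 2, comm' 2, comm 3, comm' 3, key]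
    ring

lemma prod_qPochInf_div_update (hq0 : q ≠ 0) (hq : ‖q‖ < 1) (a : Fin 5 → ℂ) (i : Fin 5) :
    ∏ j, qPochInf q ((∏ l, a l) / a j) =
      (∏ j, qPochInf q ((∏ l, Function.update a i (q * a i) l) / Function.update a i (q * a i) j)) *
      ∏ j ∈ Finset.univ.erase i, (1 - (∏ l, a l) / a j) := by
  rw [prod_update_mul, ← Finset.mul_prod_erase _ _ (Finset.mem_univ i),
    ← Finset.mul_prod_erase Finset.univ (fun j => qPochInf q (q * (∏ l, a l) /
      Function.update a i (q * a i) j)) (Finset.mem_univ i), Function.update_self,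
    mul_div_mul_left _ _ hq0, mul_assoc, ← Finset.prod_mul_distrib]
  congr 1
  refine Finset.prod_congr rfl fun j hj => ?_
  rw [Function.update_of_ne (Finset.ne_of_mem_erase hj), qPochInf_eq_mul hq, mul_div_assoc, mul_comm]

lemma NRGeneric.mul_pow (hq0 : q ≠ 0) (h : NRGeneric q c) (k : Fin 5 → ℕ) :
    NRGeneric q (fun j => c j * q ^ k j) where
  ne_zero j := mul_ne_zero (h.ne_zero j) (pow_ne_zero _ hq0)
  mul_ne i j n hn := by
    refine h.mul_ne i j (n - k i - k j) ?_
    rw [zpow_sub₀ hq0, zpow_sub₀ hq0, ← hn, zpow_natCast, zpow_natCast]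
    field_simp
  ne_mul i j hij n hn := by
    refine h.ne_mul i j hij (n + k j - k i) ?_
    rw [zpow_sub₀ hq0, zpow_add₀ hq0, zpow_natCast, zpow_natCast]
    field_simp
    linear_combination hn
  prod_ne j n hn := by
    refine h.prod_ne j (n + k j - ∑ i, (k i : ℤ)) ?_
    have e : (q : ℂ) ^ (∑ i, (k i : ℤ)) = ∏ i, q ^ k i := by
      rw [Finset.prod_pow_eq_pow_sum, ← Nat.cast_sum, zpow_natCast]
    have hne : ∏ i, q ^ k i ≠ 0 := Finset.prod_ne_zero_iff.mpr fun i _ => pow_ne_zero _ hq0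
    rw [zpow_sub₀ hq0, zpow_add₀ hq0, zpow_natCast, e]
    rw [Finset.prod_mul_distrib] at hn
    field_simp
    linear_combination hn

lemma poleSeq_mul_pow_subset {ι : Type*} (q : ℂ) (c : ι → ℂ) (k : ι → ℕ) :
    poleSeq q (fun j => c j * q ^ k j) ⊆ poleSeq q c := by
  rintro z ⟨j, n, rfl⟩
  exact ⟨j, k j + n, by rw [pow_add]; ring⟩

lemma poleSeqInv_mul_pow_subset {ι : Type*} (q : ℂ) (c : ι → ℂ) (k : ι → ℕ) :
    poleSeqInv q (fun j => c j * q ^ k j) ⊆ poleSeqInv q c :=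
  fun _ hz => poleSeq_mul_pow_subset q c k hz

/-- The normalized integral, which does not change when the parameters are shifted. -/
def nrRatio (q : ℂ) (γ : ℝ → ℂ) (a : Fin 5 → ℂ) : ℂ :=
  logIntegral γ (nrWeight q a) * pairProd q a / ∏ j, qPochInf q ((∏ l, a l) / a j)

lemma NRGeneric.one_sub_prod_div_ne_zero (h : NRGeneric q a) (j : Fin 5) :
    1 - (∏ l, a l) / a j ≠ 0 := by
  intro h1
  have h2 := h.ne_zero j
  refine h.prod_ne j 0 ?_
  field_simp at h1
  rw [zpow_zero]
  linear_combination -h1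

lemma nrRatio_update (hq0 : q ≠ 0) (hq : ‖q‖ < 1) (h : NRGeneric q a)
    (hγ : Separates P Q γ) (hP : poleSeq q a ⊆ P) (hQ : poleSeqInv q a ⊆ Q) (i : Fin 5) :
    nrRatio q γ (Function.update a i (q * a i)) = nrRatio q γ a := by
  have h1 : ∏ j ∈ Finset.univ.erase i, (1 - (∏ l, a l) / a j) ≠ 0 :=
    Finset.prod_ne_zero_iff.mpr fun j _ => h.one_sub_prod_div_ne_zero j
  have h3 := logIntegral_nrWeight_contiguity hq0 hq h hγ hP hQ i
  rw [nrRatio, nrRatio, prod_qPochInf_div_update hq0 hq a i, pairProd_update hq a i, mul_comm (∏ j, _),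
    ← div_div]
  congr 1
  field_simp
  linear_combination (pairProd q (Function.update a i (q * a i))) * h3

/-- The path stays fixed while the parameters are shifted: the shifted pole sequences are contained
in the original ones, so the path still separates them. -/
lemma nrRatio_mul_pow (hq0 : q ≠ 0) (hq : ‖q‖ < 1) (h : NRGeneric q c)
    (hγ : Separates P Q γ) (hP : poleSeq q c ⊆ P) (hQ : poleSeqInv q c ⊆ Q) (k : Fin 5 → ℕ) :
    nrRatio q γ (fun j => c j * q ^ k j) = nrRatio q γ c := by
  induction hs : ∑ i, k i generalizing k with
  | zero =>
    have hk : ∀ i, k i = 0 := by simpa using hs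
    simp [hk]
  | succ m ih =>
    obtain ⟨i, hi⟩ : ∃ i, k i ≠ 0 := by
      by_contra hn
      push Not at hn
      simp [hn] at hs
    have hk : Function.update (Function.update k i (k i - 1)) i (k i - 1 + 1) = k := by
      rw [Function.update_idem, Nat.sub_add_cancel (Nat.pos_of_ne_zero hi), Function.update_eq_self]
    set k' := Function.update k i (k i - 1) with hk'
    have hsum : ∑ j, k' j = m := by
      have h1 := Finset.add_sum_erase Finset.univ k (Finset.mem_univ i)
      have h2 := Finset.add_sum_erase Finset.univ k' (Finset.mem_univ i)
      have h3 : ∑ j ∈ Finset.univ.erase i, k' j = ∑ j ∈ Finset.univ.erase i, k j :=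
        Finset.sum_congr rfl fun j hj => by
          rw [hk', Function.update_of_ne (Finset.ne_of_mem_erase hj)]
      have h4 : k' i = k i - 1 := by rw [hk', Function.update_self]
      rw [h3, h4] at h2
      omega
    rw [← ih k' hsum, ← nrRatio_update hq0 hq (h.mul_pow hq0 k') hγ
      ((poleSeq_mul_pow_subset q c k').trans hP) ((poleSeqInv_mul_pow_subset q c k').trans hQ) i]
    congr 1
    funext j
    by_cases hj : j = i
    · subst hj
      rw [Function.update_self, hk', Function.update_self]
      conv_lhs => rw [← Nat.sub_add_cancel (Nat.pos_of_ne_zero hi)]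
      rw [pow_succ]; ring
    · rw [Function.update_of_ne hj, hk', Function.update_of_ne hj]

end NR

section NR

variable {q : ℂ} {c : Fin 5 → ℂ} {P Q : Set ℂ} {γ : ℝ → ℂ}

lemma norm_lt_one_of_mem_poleSeq {ι : Type*} {β : ι → ℂ} (hq : ‖q‖ < 1) (hβ : ∀ j, ‖β j‖ < 1)
    {z : ℂ} (hz : z ∈ poleSeq q β) : ‖z‖ < 1 := by
  obtain ⟨j, n, rfl⟩ := hz
  rw [norm_mul, norm_pow]
  exact mul_lt_one_of_nonneg_of_lt_one_left (norm_nonneg _) (hβ j)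
    (pow_le_one₀ (norm_nonneg q) hq.le)

lemma separates_poleSeq_unitCircle {ι : Type*} {β : ι → ℂ} (hq0 : q ≠ 0) (hq : ‖q‖ < 1)
    (hβ0 : ∀ j, β j ≠ 0) (hβ : ∀ j, ‖β j‖ < 1) :
    Separates (poleSeq q β) (poleSeqInv q β) (circlePath 0 1) := by
  refine separates_unitCircle (fun z hz => norm_lt_one_of_mem_poleSeq hq hβ hz) fun z hz => ?_
  have h1 := norm_lt_one_of_mem_poleSeq hq hβ hz
  have hz0 : z ≠ 0 := by
    rintro rfl
    exact zero_notMem_poleSeq hq0 hβ0 (by simpa [poleSeqInv] using hz)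
  rw [norm_inv] at h1
  exact (inv_lt_one₀ (norm_pos_iff.mpr hz0)).mp h1

/-- Joint continuity on a compact set supplies the uniform bound for dominated convergence as the
scaling parameter `q ^ n` tends to `0`. -/
lemma continuousOn_nrWeight (hq : ‖q‖ < 1) (c : Fin 5 → ℂ) {δ : ℝ} (hδ : ∀ j, ‖c j‖ * δ < 1) :
    ContinuousOn (fun p : ℂ × ℂ => nrWeight q (fun j => c j * p.1) p.2)
      (Metric.closedBall 0 δ ×ˢ Metric.sphere 0 1) := by
  have hc := continuous_qPochInf hq
  have hz : ∀ p ∈ Metric.closedBall (0 : ℂ) δ ×ˢ Metric.sphere (0 : ℂ) 1, p.2 ≠ 0 := by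
    rintro p ⟨-, hp⟩ h
    rw [h] at hp
    simp at hp
  have hs : ∀ p ∈ Metric.closedBall (0 : ℂ) δ ×ˢ Metric.sphere (0 : ℂ) 1, p.2 ^ 2 ≠ 0 :=
    fun p hp => pow_ne_zero 2 (hz p hp)
  have c2 : ContinuousOn (fun p : ℂ × ℂ => p.2) (Metric.closedBall (0 : ℂ) δ ×ˢ Metric.sphere (0 : ℂ) 1) :=
    continuousOn_snd
  have c1 : ContinuousOn (fun p : ℂ × ℂ => p.1) (Metric.closedBall (0 : ℂ) δ ×ˢ Metric.sphere (0 : ℂ) 1) :=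
    continuousOn_fst
  have cA : ContinuousOn (fun p : ℂ × ℂ => ∏ j, (c j * p.1))
      (Metric.closedBall (0 : ℂ) δ ×ˢ Metric.sphere (0 : ℂ) 1) :=
    continuousOn_finsetProd _ fun j _ => continuousOn_const.mul c1
  refine ContinuousOn.div (((hc.comp_continuousOn (c2.pow 2)).mul
    (hc.comp_continuousOn ((c2.pow 2).inv₀ hs))).mul ((hc.comp_continuousOn (cA.mul c2)).mul
    (hc.comp_continuousOn (cA.div c2 hz)))) (continuousOn_finsetProd _ fun j _ =>
    (hc.comp_continuousOn ((continuousOn_const.mul c1).mul c2)).mul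
    (hc.comp_continuousOn ((continuousOn_const.mul c1).div c2 hz))) ?_
  rintro p ⟨hp1, hp2⟩
  rw [mem_closedBall_zero_iff] at hp1
  rw [mem_sphere_zero_iff_norm] at hp2
  have hlt : ∀ j, ‖c j‖ * ‖p.1‖ < 1 := fun j =>
    (mul_le_mul_of_nonneg_left hp1 (norm_nonneg _)).trans_lt (hδ j)
  refine Finset.prod_ne_zero_iff.mpr fun j _ => mul_ne_zero ?_ ?_
  · refine qPochInf_ne_zero_of_norm_lt hq ?_
    rw [norm_mul, norm_mul, hp2, mul_one]; exact hlt j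
  · refine qPochInf_ne_zero_of_norm_lt hq ?_
    rw [norm_div, norm_mul, hp2, div_one]; exact hlt j

lemma tendsto_logIntegral_nrWeight (hq : ‖q‖ < 1) (c : Fin 5 → ℂ) :
    Filter.Tendsto (fun n : ℕ => logIntegral (circlePath 0 1) (nrWeight q fun j => c j * q ^ n))
      Filter.atTop (𝓝 (logIntegral (circlePath 0 1)
        fun z => qPochInf q (z ^ 2) * qPochInf q (z ^ 2)⁻¹)) := by
  obtain ⟨δ, hδ, hcδ⟩ : ∃ δ : ℝ, 0 < δ ∧ ∀ j, ‖c j‖ * δ < 1 := by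
    refine ⟨(1 + ∑ j, ‖c j‖)⁻¹, by positivity, fun j => ?_⟩
    rw [← div_eq_mul_inv, div_lt_one (by positivity)]
    linarith [Finset.single_le_sum (fun i _ => norm_nonneg (c i)) (Finset.mem_univ j)]
  have hcont := continuousOn_nrWeight hq c hcδ
  have hcpt : IsCompact (Metric.closedBall (0 : ℂ) δ ×ˢ Metric.sphere (0 : ℂ) 1) :=
    (isCompact_closedBall 0 δ).prod (isCompact_sphere 0 1)
  obtain ⟨C, hC⟩ := hcpt.exists_bound_of_continuousOn hcont
  have hlim : Filter.Tendsto (fun n : ℕ => q ^ n) Filter.atTop (𝓝 0) :=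
    tendsto_pow_atTop_nhds_zero_of_norm_lt_one hq
  have hev : ∀ᶠ n : ℕ in Filter.atTop, q ^ n ∈ Metric.closedBall (0 : ℂ) δ :=
    hlim.eventually (Metric.closedBall_mem_nhds 0 hδ)
  refine tendsto_logIntegral_unitCircle C ?_ ?_ fun z hz => ?_
  · filter_upwards [hev] with n hn
    refine hcont.comp (f := fun z => (q ^ n, z)) (by fun_prop) fun z hz => ⟨hn, ?_⟩
    simpa using hz
  · filter_upwards [hev] with n hn
    exact fun z hz => hC (q ^ n, z) ⟨hn, by simpa using hz⟩
  · have hz' : z ∈ Metric.sphere (0 : ℂ) 1 := by simpa using hz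
    have h1 := hcont (0, z) ⟨Metric.mem_closedBall_self hδ.le, hz'⟩
    have h2 : Filter.Tendsto (fun n : ℕ => (q ^ n, z)) Filter.atTop
        (𝓝[Metric.closedBall (0 : ℂ) δ ×ˢ Metric.sphere (0 : ℂ) 1] (0, z)) := by
      rw [tendsto_nhdsWithin_iff]
      refine ⟨hlim.prodMk_nhds tendsto_const_nhds, ?_⟩
      filter_upwards [hev] with n hn using ⟨hn, hz'⟩
    have h3 := h1.tendsto.comp h2
    simpa [nrWeight, qPochInf_zero, Function.comp_def] using h3

/-- The Nassrallah–Rahman integral. -/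
theorem nassrallah_rahman (hq0 : q ≠ 0) (hq : ‖q‖ < 1) (h : NRGeneric q c)
    (hγ : Separates P Q γ) (hP : poleSeq q c ⊆ P) (hQ : poleSeqInv q c ⊆ Q) :
    logIntegral γ (nrWeight q c) * qPochInf q q * pairProd q c =
      2 * (2 * Real.pi * Complex.I) * ∏ j, qPochInf q ((∏ l, c l) / c j) := by
  have hlim : Filter.Tendsto (fun n : ℕ => q ^ n) Filter.atTop (𝓝 0) :=
    tendsto_pow_atTop_nhds_zero_of_norm_lt_one hq
  have hcont := continuous_qPochInf hq
  have l1 := tendsto_logIntegral_nrWeight hq c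
  have l2 : Filter.Tendsto (fun n : ℕ => pairProd q fun j => c j * q ^ n) Filter.atTop (𝓝 1) := by
    have hc : Continuous fun s : ℂ => pairProd q fun j => c j * s := by
      refine continuous_finsetProd _ fun i _ => continuous_finsetProd _ fun j _ => ?_
      fun_prop
    have := (hc.tendsto 0).comp hlim
    simpa [pairProd, qPochInf_zero, Function.comp_def] using this
  have l3 : Filter.Tendsto (fun n : ℕ => ∏ j, qPochInf q ((∏ l, (c l * q ^ n)) / (c j * q ^ n)))
      Filter.atTop (𝓝 1) := by
    -- Five parameters scaled by `s`, divided by one of them, leave the fourth power.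
    have hc : Continuous fun s : ℂ => ∏ j, qPochInf q ((∏ l, c l) / c j * s ^ 4) := by
      refine continuous_finsetProd _ fun j _ => ?_
      fun_prop
    have := (hc.tendsto 0).comp hlim
    simp [qPochInf_zero, Function.comp_def] at this
    refine this.congr fun n => Finset.prod_congr rfl fun j _ => ?_
    have hn : q ^ n ≠ 0 := pow_ne_zero n hq0
    have hj := h.ne_zero j
    congr 1
    rw [Finset.prod_mul_distrib]
    simp only [Finset.prod_const, Finset.card_univ, Fintype.card_fin]
    field_simp
  have l4 := (l1.mul l2).div l3 one_ne_zero
  rw [mul_one, div_one] at l4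
  have hev : ∀ᶠ n : ℕ in Filter.atTop, ∀ j, ‖c j * q ^ n‖ < 1 := by
    rw [Filter.eventually_all]
    intro j
    have := (hlim.const_mul (c j)).norm
    rw [mul_zero, norm_zero] at this
    exact this.eventually_lt_const one_pos
  -- Once all `c j * q ^ n` lie in the unit disc, the unit circle separates the poles and may
  -- replace `γ`. The constant sequence thereby acquires a known limit.
  have l5 : Filter.Tendsto (fun _ : ℕ => nrRatio q γ c) Filter.atTop (𝓝 (logIntegral (circlePath 0 1)
        fun z => qPochInf q (z ^ 2) * qPochInf q (z ^ 2)⁻¹)) := by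
    refine l4.congr' ?_
    filter_upwards [hev] with n hn
    have hg := h.mul_pow hq0 fun _ => n
    have e1 := (separates_poleSeq_unitCircle hq0 hq hg.ne_zero hn).logIntegral_eq
      (locFin_poleSeq hq0 hq hg.ne_zero hg.ne_zero) (goodOn_nrWeight hq0 hq hg) hγ
      ((poleSeq_mul_pow_subset q c _).trans hP) ((poleSeqInv_mul_pow_subset q c _).trans hQ)
    rw [← nrRatio_mul_pow hq0 hq h hγ hP hQ fun _ => n, nrRatio, ← e1]
    rfl
  have key := tendsto_nhds_unique l5 tendsto_const_nhds
  have hne : ∏ j, qPochInf q ((∏ l, c l) / c j) ≠ 0 := by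
    refine Finset.prod_ne_zero_iff.mpr fun j _ => qPochInf_ne_zero hq fun n hn => ?_
    have hj := h.ne_zero j
    refine h.prod_ne j (-n) ?_
    have hn' : q ^ n ≠ 0 := pow_ne_zero n hq0
    rw [zpow_neg, zpow_natCast]
    field_simp at hn ⊢
    exact hn
  have hw := logIntegral_weight hq0 hq
  rw [key, nrRatio] at hw
  field_simp at hw
  linear_combination hw

end NR

/-! ### The six-parameter weight at `l = b m`. -/

/-- The weight function `(z^{±2})_∞ θ(l z^±) / ∏_j (b_j z^±)_∞`. -/
def weight (q : ℂ) (b : Fin 6 → ℂ) (l z : ℂ) : ℂ :=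
  (qPochInf q (z ^ 2) * qPochInf q ((z ^ 2)⁻¹)) * (theta q (l * z) * theta q (l / z)) /
    ∏ j, (qPochInf q (b j * z) * qPochInf q (b j / z))

/-- Genericity of the six balanced parameters. -/
structure Generic (q : ℂ) (b : Fin 6 → ℂ) : Prop where
  prod_eq : ∏ j, b j = q
  ne_mul : ∀ i j, i ≠ j → ∀ n : ℤ, b i ≠ b j * q ^ n
  mul_ne : ∀ i j, ∀ n : ℤ, b i * b j ≠ q ^ n

section Six

variable {q : ℂ} {b : Fin 6 → ℂ} {P Q : Set ℂ} {γ : ℝ → ℂ}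

lemma Generic.ne_zero (hq0 : q ≠ 0) (h : Generic q b) (j : Fin 6) : b j ≠ 0 := by
  have h1 : ∏ j, b j ≠ 0 := by rw [h.prod_eq]; exact hq0
  exact Finset.prod_ne_zero_iff.mp h1 j (Finset.mem_univ j)

/-- By balancing, the product of the other five parameters is `q / b m`, so the last condition
follows from `b m * b j` not being a power of `q`. -/
lemma Generic.nrGeneric (hq0 : q ≠ 0) (h : Generic q b) (m : Fin 6) :
    NRGeneric q (fun j => b (m.succAbove j)) where
  ne_zero j := h.ne_zero hq0 _
  mul_ne i j n := h.mul_ne _ _ n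
  ne_mul i j hij n := h.ne_mul _ _ (fun he => hij (Fin.succAbove_right_injective he)) n
  prod_ne j n hn := by
    have h1 := h.prod_eq
    rw [Fin.prod_univ_succAbove _ m, hn] at h1
    refine h.mul_ne m (m.succAbove j) (1 - n) ?_
    rw [zpow_sub₀ hq0, zpow_one]
    have := zpow_ne_zero n hq0
    field_simp
    linear_combination h1

/-- In `θ(b_m z^±)` the factors `(b_m z^±)_∞` cancel against the denominator. The remaining `(q
z^∓/b_m)_∞` are the numerator factors `(A z^±)_∞`, where `A = q/b_m` is the product of the other
five parameters. -/
lemma weight_eq_nrWeight (hq0 : q ≠ 0) (hb : ∏ j, b j = q) (m : Fin 6) {z : ℂ} (hz : z ≠ 0)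
    (h1 : qPochInf q (b m * z) ≠ 0) (h2 : qPochInf q (b m / z) ≠ 0) :
    weight q b (b m) z = nrWeight q (fun j => b (m.succAbove j)) z := by
  have hm : b m ≠ 0 := by
    have h1 : ∏ j, b j ≠ 0 := by rw [hb]; exact hq0
    exact Finset.prod_ne_zero_iff.mp h1 m (Finset.mem_univ m)
  have hA : ∏ j, b (m.succAbove j) = q / b m := by
    rw [Fin.prod_univ_succAbove _ m] at hb
    rw [← hb]; field_simp
  have e1 : q / b m * z = q / (b m / z) := by field_simp
  have e2 : q / b m / z = q / (b m * z) := by field_simp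
  rw [weight, nrWeight, Fin.prod_univ_succAbove _ m, hA, theta, theta, e1, e2,
    ← mul_div_mul_left _ (∏ j, _) (mul_ne_zero h1 h2)]
  congr 1
  ring

lemma pairProd_succAbove (q : ℂ) (b : Fin 6 → ℂ) {m : Fin 6} (hm : m = 0 ∨ m = 1) :
    pairProd q b = pairProd q (fun j => b (m.succAbove j)) *
      ∏ j, qPochInf q (b m * b (m.succAbove j)) := by
  have e0 : Finset.Ioi (0 : Fin 5) = {1, 2, 3, 4} := by decide
  have e1 : Finset.Ioi (1 : Fin 5) = {2, 3, 4} := by decide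
  have e2 : Finset.Ioi (2 : Fin 5) = {3, 4} := by decide
  have e3 : Finset.Ioi (3 : Fin 5) = {4} := by decide
  have e4 : Finset.Ioi (4 : Fin 5) = ∅ := by decide
  have d0 : Finset.Ioi (0 : Fin 6) = {1, 2, 3, 4, 5} := by decide
  have d1 : Finset.Ioi (1 : Fin 6) = {2, 3, 4, 5} := by decide
  have d2 : Finset.Ioi (2 : Fin 6) = {3, 4, 5} := by decide
  have d3 : Finset.Ioi (3 : Fin 6) = {4, 5} := by decide
  have d4 : Finset.Ioi (4 : Fin 6) = {5} := by decide
  have d5 : Finset.Ioi (5 : Fin 6) = ∅ := by decide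
  rw [pairProd, pairProd, Fin.prod_univ_six, Fin.prod_univ_five, Fin.prod_univ_five, e0, e1, e2, e3, e4,
    d0, d1, d2, d3, d4, d5]
  rcases hm with rfl | rfl
  · have s : ∀ j : Fin 5, (0 : Fin 6).succAbove j = j.succ := fun j => rfl
    simp [-mul_eq_mul_right_iff, -mul_eq_mul_left_iff, s]
    ring
  · have s0 : (1 : Fin 6).succAbove 0 = 0 := rfl
    have s1 : (1 : Fin 6).succAbove 1 = 2 := rfl
    have s2 : (1 : Fin 6).succAbove 2 = 3 := rfl
    have s3 : (1 : Fin 6).succAbove 3 = 4 := rfl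
    have s4 : (1 : Fin 6).succAbove 4 = 5 := rfl
    simp [-mul_eq_mul_right_iff, -mul_eq_mul_left_iff, s0, s1, s2, s3, s4, mul_comm (b 1) (b 0)]
    ring

lemma Separates.qPochInf_ne_zero {ι : Type*} {β : ι → ℂ} (hq : ‖q‖ < 1) (hγ : Separates P Q γ)
    (hP : poleSeq q β ⊆ P) (hQ : poleSeqInv q β ⊆ Q) {t : ℝ} (ht : t ∈ Icc (0 : ℝ) 1) (j : ι) :
    qPochInf q (β j * γ t) ≠ 0 ∧ qPochInf q (β j / γ t) ≠ 0 := by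
  have hz := hγ.ne_zero t ht
  constructor
  · refine Rahman.qPochInf_ne_zero hq fun n hn => ?_
    refine hγ.avoid_right _ (hQ (a := γ t) ⟨j, n, ?_⟩) t ht rfl
    exact inv_eq_of_mul_eq_one_left (by linear_combination hn)
  · refine Rahman.qPochInf_ne_zero hq fun n hn => ?_
    refine hγ.avoid_left _ (hP (a := γ t) ⟨j, n, ?_⟩) t ht rfl
    field_simp at hn
    exact hn.symm

lemma logIntegral_weight_apply (hq0 : q ≠ 0) (hq : ‖q‖ < 1) (h : Generic q b)
    (hγ : Separates P Q γ) (hP : poleSeq q b ⊆ P) (hQ : poleSeqInv q b ⊆ Q) {m : Fin 6}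
    (hm : m = 0 ∨ m = 1) :
    logIntegral γ (weight q b (b m)) * qPochInf q q * pairProd q b =
      2 * (2 * Real.pi * Complex.I) * ∏ j, theta q (b m * b (m.succAbove j)) := by
  have hsub : poleSeq q (fun j => b (m.succAbove j)) ⊆ poleSeq q b := by
    rintro z ⟨j, n, rfl⟩; exact ⟨_, n, rfl⟩
  have hsubI : poleSeqInv q (fun j => b (m.succAbove j)) ⊆ poleSeqInv q b := fun _ hz => hsub hz
  have hbm := h.ne_zero hq0 m
  have hA : ∏ j, b (m.succAbove j) = q / b m := by
    have hb := h.prod_eq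
    rw [Fin.prod_univ_succAbove _ m] at hb
    rw [← hb]; field_simp
  have h1 := nassrallah_rahman hq0 hq (h.nrGeneric hq0 m) hγ (hsub.trans hP)
    (hsubI.trans hQ)
  rw [logIntegral_congr (G := nrWeight q fun j => b (m.succAbove j)) fun t ht =>
    weight_eq_nrWeight hq0 h.prod_eq m (hγ.ne_zero t ht)
      (hγ.qPochInf_ne_zero hq hP hQ ht m).1 (hγ.qPochInf_ne_zero hq hP hQ ht m).2,
    pairProd_succAbove q b hm, ← mul_assoc, h1, hA]
  simp only [theta, Finset.prod_mul_distrib, div_div]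
  ring

end Six

/-! ### Zeros of theta functions, proportionality, and the three-term relation. -/

section ThetaZeros

variable {q : ℂ}

lemma theta_eq_zero (hq0 : q ≠ 0) (hq : ‖q‖ < 1) {x : ℂ} (hx : x ≠ 0) (h : theta q x = 0) :
    ∃ n : ℤ, x = q ^ n := by
  rcases mul_eq_zero.mp h with h | h
  · obtain ⟨n, hn⟩ := (qPochInf_eq_zero_iff hq).mp h
    refine ⟨-n, ?_⟩
    rw [zpow_neg, zpow_natCast]
    exact eq_inv_of_mul_eq_one_left hn
  · obtain ⟨n, hn⟩ := (qPochInf_eq_zero_iff hq).mp h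
    refine ⟨n + 1, ?_⟩
    rw [zpow_add₀ hq0, zpow_natCast, zpow_one]
    field_simp at hn
    linear_combination -hn

lemma theta_one (hq : ‖q‖ < 1) : theta q 1 = 0 := by
  rw [theta, qPochInf_eq_mul hq]; simp

lemma deriv_theta_ne_zero (hq0 : q ≠ 0) (hq : ‖q‖ < 1) {x : ℂ} (hx : x ≠ 0)
    (h : theta q x = 0) : deriv (theta q) x ≠ 0 := by
  have h1 : HasDerivAt (fun x => q / x) (-q / x ^ 2) x := by
    simpa [div_eq_mul_inv] using (hasDerivAt_inv hx).const_mul q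
  have h2 : HasDerivAt (theta q) (deriv (qPochInf q) x * qPochInf q (q / x) +
      qPochInf q x * (deriv (qPochInf q) (q / x) * (-q / x ^ 2))) x :=
    (differentiable_qPochInf hq x).hasDerivAt.mul
      ((differentiable_qPochInf hq (q / x)).hasDerivAt.comp x h1)
  have hpow : ∀ n : ℕ, ‖q ^ (n + 1)‖ < 1 := fun n => by
    rw [norm_pow]; exact pow_lt_one₀ (norm_nonneg q) hq (by omega)
  rw [h2.deriv]
  rcases mul_eq_zero.mp h with h0 | h0
  · obtain ⟨n, hn⟩ := (qPochInf_eq_zero_iff hq).mp h0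
    have e : q / x = q ^ (n + 1) := by
      rw [div_eq_iff hx, pow_succ]; linear_combination -q * hn
    rw [h0, zero_mul, add_zero]
    exact mul_ne_zero (deriv_qPochInf_ne_zero hq0 hq h0)
      (qPochInf_ne_zero_of_norm_lt hq (by rw [e]; exact hpow n))
  · obtain ⟨n, hn⟩ := (qPochInf_eq_zero_iff hq).mp h0
    have e : x = q ^ (n + 1) := by
      field_simp at hn
      rw [pow_succ]; linear_combination -hn
    rw [h0, mul_zero, zero_add]
    exact mul_ne_zero (qPochInf_ne_zero_of_norm_lt hq (by rw [e]; exact hpow n))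
      (mul_ne_zero (deriv_qPochInf_ne_zero hq0 hq h0)
        (div_ne_zero (neg_ne_zero.mpr hq0) (pow_ne_zero 2 hx)))

/-- Zeros of a quasi-periodic function are invariant under multiplication by `q`. -/
lemma eq_zero_mul_zpow (hq0 : q ≠ 0) {f m : ℂ → ℂ} (hfm : ∀ z, z ≠ 0 → f (q * z) = m z * f z)
    (hm : ∀ z, z ≠ 0 → m z ≠ 0) {z : ℂ} (hz : z ≠ 0) (h : f z = 0) (n : ℤ) :
    f (z * q ^ n) = 0 := by
  induction n with
  | zero => simpa using h
  | succ n ih =>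
    have h1 := hfm (z * q ^ (n : ℤ)) (mul_ne_zero hz (zpow_ne_zero _ hq0))
    rw [ih, mul_zero] at h1
    rw [zpow_add_one₀ hq0, ← h1]
    congr 1; ring
  | pred n ih =>
    have hne : z * q ^ (-(n : ℤ) - 1) ≠ 0 := mul_ne_zero hz (zpow_ne_zero _ hq0)
    have h1 := hfm _ hne
    have e : q * (z * q ^ (-(n : ℤ) - 1)) = z * q ^ (-(n : ℤ)) := by
      rw [zpow_sub_one₀ hq0]; field_simp
    rw [e, ih] at h1
    exact (mul_eq_zero.mp h1.symm).resolve_left (hm _ hne)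

/-- A compact annulus meets every orbit of multiplication by `q`. -/
lemma exists_norm_mul_zpow_mem (hq0 : q ≠ 0) (hq : ‖q‖ < 1) {z : ℂ} (hz : z ≠ 0) :
    ∃ n : ℤ, ‖q‖ ≤ ‖z * q ^ n‖ ∧ ‖z * q ^ n‖ ≤ 1 := by
  have hq0' := norm_pos_iff.mpr hq0
  obtain ⟨n, h1, h2⟩ := exists_mem_Ioc_zpow (norm_pos_iff.mpr hz) ((one_lt_inv₀ hq0').mpr hq)
  rw [inv_zpow] at h1 h2
  have hn : 0 < ‖q‖ ^ n := zpow_pos hq0' n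
  refine ⟨n + 1, ?_, ?_⟩
  · rw [norm_mul, norm_zpow, zpow_add_one₀ hq0'.ne']
    have := (inv_lt_iff_one_lt_mul₀ hn).mp h1
    nlinarith
  · rw [norm_mul, norm_zpow]
    have hn' : 0 < ‖q‖ ^ (n + 1) := zpow_pos hq0' _
    rw [← div_inv_eq_mul, div_le_one (inv_pos.mpr hn')]
    exact h2

/-- A `q`-periodic holomorphic function on `ℂ ∖ {0}` is constant. -/
lemma exists_const_of_periodic (hq0 : q ≠ 0) (hq : ‖q‖ < 1) {h : ℂ → ℂ}
    (ha : ∀ z, z ≠ 0 → AnalyticAt ℂ h z) (hp : ∀ z, z ≠ 0 → h (q * z) = h z) :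
    ∃ c, ∀ z, z ≠ 0 → h z = c := by
  have hp' : ∀ (z : ℂ) (n : ℤ), z ≠ 0 → h (z * q ^ n) = h z := by
    intro z n hz
    have := eq_zero_mul_zpow (f := fun w => h w - h z) (m := fun _ => 1) hq0
      (fun w hw => by rw [hp w hw, one_mul]) (fun _ _ => one_ne_zero) hz (sub_self _) n
    exact sub_eq_zero.mp this
  have hK : IsCompact {z : ℂ | ‖q‖ ≤ ‖z‖ ∧ ‖z‖ ≤ 1} := by
    refine (isCompact_closedBall (0 : ℂ) 1).of_isClosed_subset ?_ fun z hz => by simpa using hz.2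
    exact (isClosed_le continuous_const continuous_norm).inter
      (isClosed_le continuous_norm continuous_const)
  have hc : ContinuousOn h {z : ℂ | ‖q‖ ≤ ‖z‖ ∧ ‖z‖ ≤ 1} := fun z hz =>
    (ha z (norm_pos_iff.mp ((norm_pos_iff.mpr hq0).trans_le hz.1))).continuousAt.continuousWithinAt
  obtain ⟨C, hC⟩ := hK.exists_bound_of_continuousOn hc
  -- Composition with the exponential gives an entire function, bounded by its maximum on the
  -- fundamental annulus, and Liouville's theorem applies.
  have hd : Differentiable ℂ fun w => h (Complex.exp w) := fun w =>
    (ha _ (Complex.exp_ne_zero w)).differentiableAt.comp w Complex.differentiable_exp.differentiableAt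
  have hb : Bornology.IsBounded (range fun w => h (Complex.exp w)) := by
    refine isBounded_iff_forall_norm_le.mpr ⟨C, ?_⟩
    rintro - ⟨w, rfl⟩
    obtain ⟨n, hn⟩ := exists_norm_mul_zpow_mem hq0 hq (Complex.exp_ne_zero w)
    change ‖h (Complex.exp w)‖ ≤ C
    rw [← hp' _ n (Complex.exp_ne_zero w)]
    exact hC _ hn
  refine ⟨h (Complex.exp 0), fun z hz => ?_⟩
  have := hd.apply_eq_apply_of_bounded hb (Complex.log z) 0
  simpa only [Complex.exp_log hz] using this

/-- Two functions with the same quasi-periodicity are proportional if the zeros of the second are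
simple and zeros of the first. -/
lemma exists_eq_const_mul (hq0 : q ≠ 0) (hq : ‖q‖ < 1) {f g m : ℂ → ℂ}
    (hf : ∀ z, z ≠ 0 → AnalyticAt ℂ f z) (hg : ∀ z, z ≠ 0 → AnalyticAt ℂ g z)
    (hfm : ∀ z, z ≠ 0 → f (q * z) = m z * f z) (hgm : ∀ z, z ≠ 0 → g (q * z) = m z * g z)
    (hm : ∀ z, z ≠ 0 → m z ≠ 0) (hz : ∀ z, z ≠ 0 → g z = 0 → f z = 0 ∧ deriv g z ≠ 0) :
    ∃ c, ∀ z, z ≠ 0 → f z = c * g z := by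
  classical
  have hds : ∀ {φ : ℂ → ℂ} {a : ℂ}, AnalyticAt ℂ φ a → AnalyticAt ℂ (dslope φ a) a := by
    rintro φ a ⟨p, hp⟩
    exact ⟨_, hp.has_fpower_series_dslope_fslope⟩
  have hgz : ∀ a, a ≠ 0 → ∀ᶠ z in 𝓝[≠] a, g z ≠ 0 := by
    intro a ha
    rcases (hg a ha).eventually_eq_zero_or_eventually_ne_zero with h | h
    · exact absurd ((Filter.EventuallyEq.deriv_eq (f := fun _ => (0 : ℂ)) h).trans (by simp)) (hz a ha h.self_of_nhds).2
    · exact h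
  -- The quotient `f/g`, with l'Hôpital's value filled in at the simple zeros of `g`.
  set h : ℂ → ℂ := fun z => if g z = 0 then deriv f z / deriv g z else f z / g z with hh
  have hha : ∀ z, z ≠ 0 → AnalyticAt ℂ h z := by
    intro a ha
    by_cases h0 : g a = 0
    · obtain ⟨hf0, hd⟩ := hz a ha h0
      have h1 : AnalyticAt ℂ (fun z => dslope f a z / dslope g a z) a :=
        (hds (hf a ha)).div (hds (hg a ha)) (by rwa [dslope_same])
      refine h1.congr ?_
      have h2 := eventually_nhdsWithin_iff.mp (hgz a ha)
      filter_upwards [h2] with z hz'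
      by_cases hza : z = a
      · subst hza; simp [hh, h0]
      · have hgz' := hz' hza
        have := sub_ne_zero.mpr hza
        simp only [hh, hgz', if_false]
        rw [dslope_of_ne _ hza, dslope_of_ne _ hza, slope_def_field, slope_def_field, h0, hf0]
        field_simp
        simp
    · refine ((hf a ha).div (hg a ha) h0).congr ?_
      filter_upwards [(hg a ha).continuousAt.eventually_ne h0] with z hz'
      simp [hh, hz']
  have hprod : ∀ z, z ≠ 0 → f z = h z * g z := by
    intro z hz'
    by_cases h0 : g z = 0
    · rw [h0, mul_zero, (hz z hz' h0).1]
    · simp only [hh, h0, if_false]; field_simp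
  -- Clear where `g z ≠ 0`, and extended to the zeros of `g` by continuity.
  have hper : ∀ z, z ≠ 0 → h (q * z) = h z := by
    intro z hz'
    have hqz := mul_ne_zero hq0 hz'
    have h1 : ContinuousAt (fun w => h (q * w)) z :=
      (hha _ hqz).continuousAt.comp (f := fun w => q * w) (by fun_prop)
    have h2 := (hha z hz').continuousAt
    have hev : ∀ᶠ w in 𝓝[≠] z, h (q * w) = h w := by
      filter_upwards [hgz z hz', (eventually_ne_nhds hz').filter_mono nhdsWithin_le_nhds]
        with w hw hw0
      have hqw := mul_ne_zero hq0 hw0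
      have e1 := hprod _ hqw
      rw [hfm w hw0, hgm w hw0, hprod w hw0] at e1
      have := mul_ne_zero (hm w hw0) hw
      refine (mul_right_cancel₀ this ?_).symm
      linear_combination e1
    exact tendsto_nhds_unique ((h1.tendsto.mono_left nhdsWithin_le_nhds).congr' hev)
      (h2.tendsto.mono_left nhdsWithin_le_nhds)
  obtain ⟨c, hc⟩ := exists_const_of_periodic hq0 hq hha hper
  exact ⟨c, fun z hz' => by rw [hprod z hz', hc z hz']⟩

/-- The product `θ(l z) θ(l / z)`. -/
def thetaPair (q l z : ℂ) : ℂ := theta q (l * z) * theta q (l / z)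

lemma thetaPair_mul_left (hq0 : q ≠ 0) (hq : ‖q‖ < 1) {l z : ℂ} (hl : l ≠ 0) (hz : z ≠ 0) :
    thetaPair q (q * l) z = (l ^ 2)⁻¹ * thetaPair q l z := by
  rw [thetaPair, mul_assoc, mul_div_assoc, theta_mul_left hq0 hq (mul_ne_zero hl hz),
    theta_mul_left hq0 hq (div_ne_zero hl hz), thetaPair]
  field_simp

lemma thetaPair_inv_left (hq : ‖q‖ < 1) {l z : ℂ} (hl : l ≠ 0) (hz : z ≠ 0) :
    thetaPair q l⁻¹ z = (l ^ 2)⁻¹ * thetaPair q l z := by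
  rw [thetaPair, show l⁻¹ * z = (l / z)⁻¹ by field_simp, show l⁻¹ / z = (l * z)⁻¹ by field_simp,
    theta_inv hq (mul_ne_zero hl hz), theta_inv hq (div_ne_zero hl hz), thetaPair]
  field_simp

lemma thetaPair_self (hq : ‖q‖ < 1) {l : ℂ} (hl : l ≠ 0) : thetaPair q l l = 0 := by
  rw [thetaPair, div_self hl, theta_one hq, mul_zero]

lemma thetaPair_eq_zero (hq0 : q ≠ 0) (hq : ‖q‖ < 1) {l z : ℂ} (hl : l ≠ 0) (hz : z ≠ 0)
    (h : thetaPair q l z = 0) : ∃ n : ℤ, l = z⁻¹ * q ^ n ∨ l = z * q ^ n := by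
  rcases mul_eq_zero.mp h with h | h
  · obtain ⟨n, hn⟩ := theta_eq_zero hq0 hq (mul_ne_zero hl hz) h
    exact ⟨n, Or.inl (by rw [← hn]; field_simp)⟩
  · obtain ⟨n, hn⟩ := theta_eq_zero hq0 hq (div_ne_zero hl hz) h
    exact ⟨n, Or.inr (by rw [← hn]; field_simp)⟩

lemma analyticAt_thetaPair_right (hq : ‖q‖ < 1) {l z : ℂ} (hl : l ≠ 0) (hz : z ≠ 0) :
    AnalyticAt ℂ (thetaPair q l) z :=
  (analyticAt_theta_comp hq (analyticAt_const.mul analyticAt_id) (mul_ne_zero hl hz)).mul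
    (analyticAt_theta_comp hq (analyticAt_const.div analyticAt_id hz) (div_ne_zero hl hz))

lemma analyticAt_thetaPair_left (hq : ‖q‖ < 1) {l z : ℂ} (hl : l ≠ 0) (hz : z ≠ 0) :
    AnalyticAt ℂ (fun l => thetaPair q l z) l :=
  (analyticAt_theta_comp hq (analyticAt_id.mul analyticAt_const) (mul_ne_zero hl hz)).mul
    (analyticAt_theta_comp hq (analyticAt_id.div analyticAt_const hz) (div_ne_zero hl hz))

lemma thetaPair_comm (hq : ‖q‖ < 1) {l z : ℂ} (hl : l ≠ 0) (hz : z ≠ 0) :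
    thetaPair q l z = -(l / z) * thetaPair q z l := by
  have h := theta_inv hq (div_ne_zero hz hl)
  rw [inv_div] at h
  rw [thetaPair, thetaPair, h, mul_comm z l]
  ring

/-- The condition on `z²` keeps the zeros of the two theta factors apart, and each factor has simple
zeros. -/
lemma deriv_thetaPair_left_ne_zero (hq0 : q ≠ 0) (hq : ‖q‖ < 1) {l z : ℂ} (hl : l ≠ 0)
    (hz : z ≠ 0) (hz2 : ∀ n : ℤ, z * z ≠ q ^ n) (h : thetaPair q l z = 0) :
    deriv (fun l => thetaPair q l z) l ≠ 0 := by
  have h1 : HasDerivAt (fun l => theta q (l * z)) (deriv (theta q) (l * z) * (1 * z)) l :=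
    HasDerivAt.comp (h₂ := theta q) (h := fun l => l * z) l
      (analyticAt_theta hq (mul_ne_zero hl hz)).differentiableAt.hasDerivAt
      ((hasDerivAt_id l).mul_const z)
  have h2 : HasDerivAt (fun l => theta q (l / z)) (deriv (theta q) (l / z) * (1 / z)) l :=
    HasDerivAt.comp (h₂ := theta q) (h := fun l => l / z) l
      (analyticAt_theta hq (div_ne_zero hl hz)).differentiableAt.hasDerivAt
      ((hasDerivAt_id l).div_const z)
  have hnot : theta q (l * z) = 0 → theta q (l / z) = 0 → False := by
    intro h3 h4
    obtain ⟨m, hm⟩ := theta_eq_zero hq0 hq (mul_ne_zero hl hz) h3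
    obtain ⟨n, hn⟩ := theta_eq_zero hq0 hq (div_ne_zero hl hz) h4
    refine hz2 (m - n) ?_
    rw [zpow_sub₀ hq0, ← hm, ← hn]
    field_simp
  have h3 := h1.mul h2
  rw [show (fun l => thetaPair q l z) = (fun l => theta q (l * z)) * fun l => theta q (l / z) from rfl,
    h3.deriv]
  rcases mul_eq_zero.mp h with h0 | h0
  · rw [h0, zero_mul, add_zero, one_mul]
    exact mul_ne_zero (mul_ne_zero (deriv_theta_ne_zero hq0 hq (mul_ne_zero hl hz) h0) hz)
      fun h4 => hnot h0 h4
  · rw [h0, mul_zero, zero_add]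
    exact mul_ne_zero (fun h4 => hnot h4 h0) (mul_ne_zero
      (deriv_theta_ne_zero hq0 hq (div_ne_zero hl hz) h0) (one_div_ne_zero hz))

/-- The three-term relation for theta functions. -/
lemma thetaPair_three_term (hq0 : q ≠ 0) (hq : ‖q‖ < 1) {l u v z : ℂ} (hl : l ≠ 0) (hu : u ≠ 0)
    (hv : v ≠ 0) (hz : z ≠ 0) (hu2 : ∀ n : ℤ, u * u ≠ q ^ n)
    (huv : thetaPair q u v ≠ 0) :
    thetaPair q l z = thetaPair q l v / thetaPair q u v * thetaPair q u z +
      thetaPair q l u / thetaPair q v u * thetaPair q v z := by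
  have hvu : thetaPair q v u ≠ 0 := by
    intro h
    rw [thetaPair_comm hq hu hv, h, mul_zero] at huv
    exact huv rfl
  -- As a function of `x`, the difference is normalized to vanish at `u`. By its symmetries it
  -- vanishes on `u^{±1} q^ℤ`, all the zeros of `θ(x u^±)`, hence is a multiple of the latter.
  set f : ℂ → ℂ := fun x => thetaPair q x z - thetaPair q x v / thetaPair q u v * thetaPair q u z
    with hf
  have hfm : ∀ x, x ≠ 0 → f (q * x) = (x ^ 2)⁻¹ * f x := fun x hx => by
    simp only [hf, thetaPair_mul_left hq0 hq hx hz, thetaPair_mul_left hq0 hq hx hv]; ring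
  have hm : ∀ x : ℂ, x ≠ 0 → (x ^ 2)⁻¹ ≠ 0 := fun x hx => inv_ne_zero (pow_ne_zero 2 hx)
  have hfu : f u = 0 := by simp only [hf, div_self huv, one_mul, sub_self]
  have hfu' : f u⁻¹ = 0 := by
    have : f u⁻¹ = (u ^ 2)⁻¹ * f u := by
      simp only [hf, thetaPair_inv_left hq hu hz, thetaPair_inv_left hq hu hv]; ring
    rw [this, hfu, mul_zero]
  have hfz : ∀ x, x ≠ 0 → thetaPair q x u = 0 → f x = 0 := by
    intro x hx h0
    obtain ⟨n, rfl | rfl⟩ := thetaPair_eq_zero hq0 hq hx hu h0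
    · exact eq_zero_mul_zpow hq0 hfm hm (inv_ne_zero hu) hfu' n
    · exact eq_zero_mul_zpow hq0 hfm hm hu hfu n
  obtain ⟨c, hc⟩ := exists_eq_const_mul hq0 hq (f := f) (g := fun x => thetaPair q x u)
    (m := fun x => (x ^ 2)⁻¹)
    (fun x hx => (analyticAt_thetaPair_left hq hx hz).sub
      (((analyticAt_thetaPair_left hq hx hv).div_const).mul analyticAt_const))
    (fun x hx => analyticAt_thetaPair_left hq hx hu) hfm
    (fun x hx => thetaPair_mul_left hq0 hq hx hu) hm
    (fun x hx h0 => ⟨hfz x hx h0, deriv_thetaPair_left_ne_zero hq0 hq hx hu hu2 h0⟩)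
  -- The factor of proportionality is read off at `x = v`, where the subtracted term vanishes.
  have h1 := hc v hv
  have h2 := hc l hl
  simp only [hf, thetaPair_self hq hv, zero_div, zero_mul, sub_zero] at h1 h2
  rw [sub_eq_iff_eq_add] at h2
  rw [h2, h1]
  field_simp
  ring

end ThetaZeros

/-! ### The function `D` and the evaluation of the integral of the weight. -/

section ThetaDiff

variable {q : ℂ} {b : Fin 6 → ℂ}

/-- The balancing condition and the factor `q l⁻²` are exactly what give the two products in `D` the
same multiplier. -/
lemma thetaDiff_mul (hq0 : q ≠ 0) (hq : ‖q‖ < 1) (hb : ∏ j, b j = q) (hb0 : ∀ j, b j ≠ 0) {l : ℂ}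
    (hl : l ≠ 0) : thetaDiff q b (q * l) = (q * l ^ 6)⁻¹ * thetaDiff q b l := by
  have h1 : ∏ j, theta q (q * l * b j) = (l ^ 6 * q)⁻¹ * ∏ j, theta q (l * b j) := by
    simp_rw [mul_assoc q l, theta_mul_left hq0 hq (mul_ne_zero hl (hb0 _)), mul_inv, neg_mul]
    rw [Finset.prod_neg, Finset.prod_mul_distrib, Finset.prod_mul_distrib, Finset.prod_inv_distrib,
      Finset.prod_inv_distrib, hb]
    simp [mul_comm, Even.neg_one_pow (show Even 6 by decide)]
  have h2 : ∏ j, theta q (q * l / b j) = (l ^ 6)⁻¹ * q * ∏ j, theta q (l / b j) := by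
    simp_rw [mul_div_assoc q l, theta_mul_left hq0 hq (div_ne_zero hl (hb0 _)), inv_div,
      div_eq_mul_inv (b _) l, neg_mul]
    rw [Finset.prod_neg, Finset.prod_mul_distrib, Finset.prod_mul_distrib, hb]
    simp [mul_comm, Even.neg_one_pow (show Even 6 by decide)]
  rw [thetaDiff, h1, h2, thetaDiff]
  field_simp

lemma thetaDiff_inv (hq0 : q ≠ 0) (hq : ‖q‖ < 1) (hb : ∏ j, b j = q) (hb0 : ∀ j, b j ≠ 0) {l : ℂ}
    (hl : l ≠ 0) : thetaDiff q b l⁻¹ = -(l ^ 4)⁻¹ * thetaDiff q b l := by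
  have h1 : ∏ j, theta q (l⁻¹ * b j) = (l ^ 6)⁻¹ * q * ∏ j, theta q (l / b j) := by
    have e : ∀ j, l⁻¹ * b j = (l / b j)⁻¹ := fun j => by rw [inv_div]; field_simp
    simp_rw [e, theta_inv hq (div_ne_zero hl (hb0 _)), inv_div,
      div_eq_mul_inv (b _) l, neg_mul]
    rw [Finset.prod_neg, Finset.prod_mul_distrib, Finset.prod_mul_distrib, hb]
    simp [mul_comm, Even.neg_one_pow (show Even 6 by decide)]
  have h2 : ∏ j, theta q (l⁻¹ / b j) = (l ^ 6 * q)⁻¹ * ∏ j, theta q (l * b j) := by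
    have e : ∀ j, l⁻¹ / b j = (l * b j)⁻¹ := fun j => by rw [mul_inv]; field_simp
    simp_rw [e, theta_inv hq (mul_ne_zero hl (hb0 _)), mul_inv, neg_mul]
    rw [Finset.prod_neg, Finset.prod_mul_distrib, Finset.prod_mul_distrib, Finset.prod_inv_distrib,
      Finset.prod_inv_distrib, hb]
    simp [mul_comm, Even.neg_one_pow (show Even 6 by decide)]
  rw [thetaDiff, h1, h2, thetaDiff]
  field_simp
  ring

lemma thetaDiff_apply (hq : ‖q‖ < 1) (hb0 : ∀ j, b j ≠ 0) (m : Fin 6) :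
    thetaDiff q b (b m) = theta q (b m ^ 2) * ∏ j, theta q (b m * b (m.succAbove j)) := by
  have h : ∏ j, theta q (b m / b j) = 0 :=
    Finset.prod_eq_zero (Finset.mem_univ m) (by rw [div_self (hb0 m), theta_one hq])
  rw [thetaDiff, h, mul_zero, sub_zero, Fin.prod_univ_succAbove _ m, sq]

lemma analyticAt_thetaDiff (hq : ‖q‖ < 1) (hb0 : ∀ j, b j ≠ 0) {l : ℂ} (hl : l ≠ 0) :
    AnalyticAt ℂ (thetaDiff q b) l := by
  refine (Finset.analyticAt_fun_prod _ fun j _ => ?_).sub ((analyticAt_const.mul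
    ((analyticAt_id.pow 2).inv (pow_ne_zero 2 hl))).mul (Finset.analyticAt_fun_prod _ fun j _ => ?_))
  · exact analyticAt_theta_comp hq (analyticAt_id.mul analyticAt_const) (mul_ne_zero hl (hb0 j))
  · exact analyticAt_theta_comp hq (analyticAt_id.div analyticAt_const (hb0 j))
      (div_ne_zero hl (hb0 j))

lemma theta_sq_mul (hq0 : q ≠ 0) (hq : ‖q‖ < 1) {l : ℂ} (hl : l ≠ 0) :
    theta q ((q * l) ^ 2) = (q * l ^ 4)⁻¹ * theta q (l ^ 2) := by
  have hl2 := pow_ne_zero 2 hl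
  rw [show (q * l) ^ 2 = q * (q * l ^ 2) by ring, theta_mul_left hq0 hq (mul_ne_zero hq0 hl2),
    theta_mul_left hq0 hq hl2]
  field_simp

/-- `D(l)` vanishes when `l² ∈ q^ℤ`. -/
lemma thetaDiff_eq_zero (hq0 : q ≠ 0) (hq : ‖q‖ < 1) (hb : ∏ j, b j = q) (hb0 : ∀ j, b j ≠ 0)
    {l : ℂ} (hl : l ≠ 0) (h : theta q (l ^ 2) = 0) : thetaDiff q b l = 0 := by
  have hfm : ∀ x, x ≠ 0 → thetaDiff q b (q * x) = (q * x ^ 6)⁻¹ * thetaDiff q b x :=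
    fun x hx => thetaDiff_mul hq0 hq hb hb0 hx
  have hm : ∀ x : ℂ, x ≠ 0 → (q * x ^ 6)⁻¹ ≠ 0 := fun x hx =>
    inv_ne_zero (mul_ne_zero hq0 (pow_ne_zero 6 hx))
  -- Fixed points of `x ↦ 1/x` and of `x ↦ q/x`: in both cases the functional equations give `D(x) =
  -- -D(x)`. Every other `l` with `l² ∈ q^ℤ` is obtained by a shift by a power of `q`.
  have base : ∀ x : ℂ, x ≠ 0 → x ^ 2 = 1 ∨ x ^ 2 = q → thetaDiff q b x = 0 := by
    rintro x hx (h1 | h1)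
    · have h2 := thetaDiff_inv hq0 hq hb hb0 hx
      rw [inv_eq_of_mul_eq_one_left (show x * x = 1 by rw [← sq, h1]), show x ^ 4 = (x ^ 2) ^ 2 by ring,
        h1] at h2
      linear_combination h2 / 2
    · have h2 := thetaDiff_mul hq0 hq hb hb0 (inv_ne_zero hx)
      rw [thetaDiff_inv hq0 hq hb hb0 hx, show q * x⁻¹ = x by rw [← h1]; field_simp] at h2
      field_simp at h2
      rw [h1] at h2
      field_simp at h2
      linear_combination h2 / 2
  obtain ⟨n, hn⟩ := theta_eq_zero hq0 hq (pow_ne_zero 2 hl) h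
  obtain ⟨k, hk⟩ : ∃ k : ℤ, n = 2 * k ∨ n = 2 * k + 1 := ⟨n / 2, by omega⟩
  have hqk := zpow_ne_zero k hq0
  have h1 : thetaDiff q b (l * q ^ (-k)) = 0 := by
    refine base _ (mul_ne_zero hl (zpow_ne_zero _ hq0)) ?_
    rw [mul_pow, hn, zpow_neg]
    rcases hk with rfl | rfl
    · left
      rw [two_mul, zpow_add₀ hq0]; field_simp
    · right
      rw [zpow_add_one₀ hq0, two_mul, zpow_add₀ hq0]; field_simp
  have h2 := eq_zero_mul_zpow hq0 hfm hm (mul_ne_zero hl (zpow_ne_zero (-k) hq0)) h1 k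
  rwa [mul_assoc, ← zpow_add₀ hq0, neg_add_cancel, zpow_zero, mul_one] at h2

lemma deriv_theta_sq_ne_zero (hq0 : q ≠ 0) (hq : ‖q‖ < 1) {l : ℂ} (hl : l ≠ 0)
    (h : theta q (l ^ 2) = 0) : deriv (fun l => theta q (l ^ 2)) l ≠ 0 := by
  have h1 : HasDerivAt (fun l => theta q (l ^ 2)) (deriv (theta q) (l ^ 2) * (2 * l)) l :=
    HasDerivAt.comp (h₂ := theta q) (h := fun l => l ^ 2) l
      (analyticAt_theta hq (pow_ne_zero 2 hl)).differentiableAt.hasDerivAt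
      (by simpa using hasDerivAt_pow 2 l)
  rw [h1.deriv]
  exact mul_ne_zero (deriv_theta_ne_zero hq0 hq (pow_ne_zero 2 hl) h) (mul_ne_zero two_ne_zero hl)

lemma Generic.theta_mul_ne_zero (hq0 : q ≠ 0) (hq : ‖q‖ < 1) (h : Generic q b) (i j : Fin 6) :
    theta q (b i * b j) ≠ 0 := fun h0 => by
  obtain ⟨n, hn⟩ := theta_eq_zero hq0 hq (mul_ne_zero (h.ne_zero hq0 i) (h.ne_zero hq0 j)) h0
  exact h.mul_ne i j n hn

/-- Interpolation at `b 0` and `b 1`, where one product in `D` vanishes. The coefficients are the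
same functions of `l` as in `thetaPair_three_term`, which is why `D` appears in the integral. -/
lemma thetaDiff_eq (hq0 : q ≠ 0) (hq : ‖q‖ < 1) (h : Generic q b) {l : ℂ} (hl : l ≠ 0) :
    thetaDiff q b l = theta q (l ^ 2) *
      (thetaPair q l (b 1) / thetaPair q (b 0) (b 1) * ∏ j, theta q (b 0 * b ((0 : Fin 6).succAbove j)) +
        thetaPair q l (b 0) / thetaPair q (b 1) (b 0) * ∏ j, theta q (b 1 * b ((1 : Fin 6).succAbove j))) := by
  have hb0 := h.ne_zero hq0
  have hb := h.prod_eq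
  have hpair : ∀ i j, i ≠ j → thetaPair q (b i) (b j) ≠ 0 := by
    intro i j hij h0
    obtain ⟨n, hn | hn⟩ := thetaPair_eq_zero hq0 hq (hb0 i) (hb0 j) h0
    · refine h.mul_ne i j n ?_
      have := hb0 j
      rw [hn]; field_simp
    · exact h.ne_mul i j hij n hn
  have hsq : ∀ i, theta q (b i ^ 2) ≠ 0 := fun i => by
    rw [sq]; exact h.theta_mul_ne_zero hq0 hq i i
  have h10 := hpair 1 0 (by decide)
  have h01 := hpair 0 1 (by decide)
  set T₀ := ∏ j, theta q (b 0 * b ((0 : Fin 6).succAbove j)) with hT₀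
  set T₁ := ∏ j, theta q (b 1 * b ((1 : Fin 6).succAbove j)) with hT₁
  -- After subtraction of the `b 1` term, the difference vanishes at all zeros of `θ(x²) θ(x b_1^±)`
  -- and has the same multiplier, so the two are proportional. The constant is found at `x = b 0`.
  set f : ℂ → ℂ := fun x => thetaDiff q b x -
    theta q (x ^ 2) * (thetaPair q x (b 0) / thetaPair q (b 1) (b 0) * T₁) with hf
  have hfm : ∀ x, x ≠ 0 → f (q * x) = (q * x ^ 6)⁻¹ * f x := fun x hx => by
    simp only [hf, thetaDiff_mul hq0 hq hb hb0 hx, thetaPair_mul_left hq0 hq hx (hb0 0),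
      theta_sq_mul hq0 hq hx]
    field_simp
  have hm : ∀ x : ℂ, x ≠ 0 → (q * x ^ 6)⁻¹ ≠ 0 := fun x hx =>
    inv_ne_zero (mul_ne_zero hq0 (pow_ne_zero 6 hx))
  have hf1 : f (b 1) = 0 := by
    simp only [hf, thetaDiff_apply hq hb0, div_self h10, one_mul, ← hT₁, sub_self]
  have hf1' : f (b 1)⁻¹ = 0 := by
    have e := theta_inv hq (pow_ne_zero 2 (hb0 1))
    rw [← inv_pow] at e
    have : f (b 1)⁻¹ = -(b 1 ^ 4)⁻¹ * f (b 1) := by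
      have := hb0 1
      simp only [hf, thetaDiff_inv hq0 hq hb hb0 (hb0 1), thetaPair_inv_left hq (hb0 1) (hb0 0), e]
      field_simp
      ring
    rw [this, hf1, mul_zero]
  have hsqa : ∀ x : ℂ, x ≠ 0 → AnalyticAt ℂ (fun x => theta q (x ^ 2)) x := fun x hx =>
    analyticAt_theta_comp hq (analyticAt_id.pow 2) (pow_ne_zero 2 hx)
  have hgz : ∀ x, x ≠ 0 → theta q (x ^ 2) * thetaPair q x (b 1) = 0 →
      f x = 0 ∧ deriv (fun x => theta q (x ^ 2) * thetaPair q x (b 1)) x ≠ 0 := by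
    intro x hx h0
    -- A common zero would make `b 1 * b 1` a power of `q`; its absence ensures that the zeros of
    -- the product are simple.
    have hex : theta q (x ^ 2) = 0 → thetaPair q x (b 1) = 0 → False := by
      intro h1 h2
      obtain ⟨m, hm⟩ := theta_eq_zero hq0 hq (pow_ne_zero 2 hx) h1
      have hb1 := hb0 1
      obtain ⟨n, hn | hn⟩ := thetaPair_eq_zero hq0 hq hx (hb0 1) h2
      · refine h.mul_ne 1 1 (2 * n - m) ?_
        have := zpow_ne_zero n hq0
        rw [zpow_sub₀ hq0, ← hm, hn, two_mul, zpow_add₀ hq0]; field_simp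
      · refine h.mul_ne 1 1 (m - 2 * n) ?_
        have := zpow_ne_zero n hq0
        rw [zpow_sub₀ hq0, ← hm, hn, two_mul, zpow_add₀ hq0]; field_simp
    have hd := ((hsqa x hx).differentiableAt.hasDerivAt.mul
      (analyticAt_thetaPair_left hq hx (hb0 1)).differentiableAt.hasDerivAt).deriv
    rw [show (fun x => theta q (x ^ 2) * thetaPair q x (b 1)) =
      (fun x => theta q (x ^ 2)) * fun x => thetaPair q x (b 1) from rfl, hd]
    rcases mul_eq_zero.mp h0 with h1 | h1
    · refine ⟨by simp only [hf, h1, zero_mul, sub_zero, thetaDiff_eq_zero hq0 hq hb hb0 hx h1], ?_⟩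
      rw [h1, zero_mul, add_zero]
      exact mul_ne_zero (deriv_theta_sq_ne_zero hq0 hq hx h1) fun h2 => hex h1 h2
    · refine ⟨?_, ?_⟩
      · obtain ⟨n, rfl | rfl⟩ := thetaPair_eq_zero hq0 hq hx (hb0 1) h1
        · exact eq_zero_mul_zpow hq0 hfm hm (inv_ne_zero (hb0 1)) hf1' n
        · exact eq_zero_mul_zpow hq0 hfm hm (hb0 1) hf1 n
      · rw [h1, mul_zero, zero_add]
        exact mul_ne_zero (fun h2 => hex h2 h1)
          (deriv_thetaPair_left_ne_zero hq0 hq hx (hb0 1) (h.mul_ne 1 1) h1)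
  obtain ⟨c, hc⟩ := exists_eq_const_mul hq0 hq (f := f)
    (g := fun x => theta q (x ^ 2) * thetaPair q x (b 1)) (m := fun x => (q * x ^ 6)⁻¹)
    (fun x hx => (analyticAt_thetaDiff hq hb0 hx).sub ((hsqa x hx).mul
      (((analyticAt_thetaPair_left hq hx (hb0 0)).div_const).mul analyticAt_const)))
    (fun x hx => (hsqa x hx).mul (analyticAt_thetaPair_left hq hx (hb0 1))) hfm
    (fun x hx => by
      simp only [thetaPair_mul_left hq0 hq hx (hb0 1), theta_sq_mul hq0 hq hx]
      field_simp) hm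
    hgz
  have h1 := hc (b 0) (hb0 0)
  have h2 := hc l hl
  simp only [hf, thetaPair_self hq (hb0 0), zero_div, zero_mul, mul_zero, sub_zero,
    thetaDiff_apply hq hb0, ← hT₀] at h1 h2
  have h3 : T₀ = c * thetaPair q (b 0) (b 1) := mul_left_cancel₀ (hsq 0) (by rw [h1]; ring)
  rw [sub_eq_iff_eq_add] at h2
  rw [h2, h3]
  field_simp

lemma Generic.thetaDiff_ne_zero (hq0 : q ≠ 0) (hq : ‖q‖ < 1) (h : Generic q b) (m : Fin 6) :
    thetaDiff q b (b m) ≠ 0 := by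
  rw [thetaDiff_apply hq (h.ne_zero hq0), sq]
  exact mul_ne_zero (h.theta_mul_ne_zero hq0 hq m m)
    (Finset.prod_ne_zero_iff.mpr fun j _ => h.theta_mul_ne_zero hq0 hq _ _)

/-- The zeros of `D` are discrete in `ℂ ∖ {0}`. -/
lemma eventually_thetaDiff_ne_zero (hq0 : q ≠ 0) (hq : ‖q‖ < 1) (h : Generic q b) :
    ∀ᶠ l in Filter.codiscreteWithin ({0}ᶜ : Set ℂ), thetaDiff q b l ≠ 0 := by
  have hb0 := h.ne_zero hq0
  -- Identity theorem on the connected set `ℂ ∖ {0}`, with `D(b 0) ≠ 0`.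
  have ha : AnalyticOnNhd ℂ (thetaDiff q b) {0}ᶜ := fun l hl => analyticAt_thetaDiff hq hb0 hl
  refine ha.preimage_zero_mem_codiscreteWithin (x := b 0) (h.thetaDiff_ne_zero hq0 hq 0) (hb0 0)
    (isConnected_compl_singleton_of_one_lt_rank (by simp) 0)

variable {P Q : Set ℂ} {γ : ℝ → ℂ}

lemma Generic.mul_mul_pow_ne_one (h : Generic q b) (i j : Fin 6) (n : ℕ) :
    b i * b j * q ^ n ≠ 1 := by
  intro h1
  refine h.mul_ne i j (-n) ?_
  rw [zpow_neg, zpow_natCast]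
  exact eq_inv_of_mul_eq_one_left h1

lemma goodOn_weight (hq0 : q ≠ 0) (hq : ‖q‖ < 1) (h : Generic q b) {l : ℂ} (hl : l ≠ 0) :
    GoodOn (poleSeq q b ∪ poleSeqInv q b) (weight q b l) :=
  goodOn_quotient hq0 hq (h.ne_zero hq0) (h.ne_zero hq0) h.mul_mul_pow_ne_one h.ne_mul h.ne_mul
    fun _ hz => (analyticAt_weight hq hz).mul (analyticAt_thetaPair_right hq hl hz)

/-- The integral of the weight function. -/
theorem logIntegral_weight_eq (hq0 : q ≠ 0) (hq : ‖q‖ < 1) (h : Generic q b)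
    (hγ : Separates P Q γ) (hP : poleSeq q b ⊆ P) (hQ : poleSeqInv q b ⊆ Q) {l : ℂ} (hl : l ≠ 0) :
    logIntegral γ (weight q b l) * qPochInf q q * theta q (l ^ 2) * pairProd q b =
      2 * (2 * Real.pi * Complex.I) * thetaDiff q b l := by
  have hb0 := h.ne_zero hq0
  have h01 : thetaPair q (b 0) (b 1) ≠ 0 := by
    intro h0
    obtain ⟨n, hn | hn⟩ := thetaPair_eq_zero hq0 hq (hb0 0) (hb0 1) h0
    · refine h.mul_ne 0 1 n ?_
      have := hb0 1
      rw [hn]; field_simp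
    · exact h.ne_mul 0 1 (by decide) n hn
  set α := thetaPair q l (b 1) / thetaPair q (b 0) (b 1) with hα
  set β := thetaPair q l (b 0) / thetaPair q (b 1) (b 0) with hβ
  have hc : ∀ m, ContinuousOn (weight q b (b m)) (γ '' Icc 0 1) := fun m =>
    (goodOn_weight hq0 hq h (hb0 m)).continuousOn_image hγ (union_subset_union hP hQ)
  have h1 : logIntegral γ (weight q b l) =
      α * logIntegral γ (weight q b (b 0)) + β * logIntegral γ (weight q b (b 1)) := by
    rw [← logIntegral_const_mul, ← logIntegral_const_mul, ← logIntegral_add hγ.isClosedPath hγ.ne_zero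
      ((hc 0).const_mul α) ((hc 1).const_mul β)]
    refine logIntegral_congr fun t ht => ?_
    have h2 := thetaPair_three_term hq0 hq hl (hb0 0) (hb0 1) (hγ.ne_zero t ht) (h.mul_ne 0 0) h01
    simp only [weight]
    rw [← thetaPair, ← thetaPair, ← thetaPair, h2]
    ring
  have e0 := logIntegral_weight_apply hq0 hq h hγ hP hQ (m := 0) (Or.inl rfl)
  have e1 := logIntegral_weight_apply hq0 hq h hγ hP hQ (m := 1) (Or.inr rfl)
  rw [thetaDiff_eq hq0 hq h hl, h1, ← hα, ← hβ]
  linear_combination theta q (l ^ 2) * (α * e0 + β * e1)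

end ThetaDiff

/-! ### Rational functions of `(z + z⁻¹)/2` and the spanning statement. -/

section RationalFunctions

open Polynomial Lagrange

lemma evalAt_eq (f : RatFunc ℂ) (z : ℂ) :
    evalAt f z = f.num.eval (joukowski z) / f.denom.eval (joukowski z) := by
  simp [evalAt, RatFunc.eval, Polynomial.eval₂_id]

lemma evalAt_div (N : ℂ[X]) {D : ℂ[X]} {z : ℂ} (hD : D.eval (joukowski z) ≠ 0) :
    evalAt (algebraMap _ (RatFunc ℂ) N / algebraMap _ (RatFunc ℂ) D) z =
      N.eval (joukowski z) / D.eval (joukowski z) := by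
  have hD0 : D ≠ 0 := by rintro rfl; simp at hD
  set f := algebraMap _ (RatFunc ℂ) N / algebraMap _ (RatFunc ℂ) D with hf
  have h1 : f.num * D = N * f.denom := (RatFunc.num_mul_eq_mul_denom_iff hD0).mpr hf
  have h2 : f.denom.eval (joukowski z) ≠ 0 := by
    obtain ⟨m, hm⟩ := RatFunc.denom_div_dvd N D
    intro h
    rw [hm, eval_mul, h, zero_mul] at hD
    exact hD rfl
  rw [evalAt_eq, div_eq_div_iff h2 hD, ← eval_mul, h1, eval_mul]

lemma joukowski_eq_iff {z w : ℂ} (hz : z ≠ 0) (hw : w ≠ 0) :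
    joukowski z = joukowski w ↔ z = w ∨ z⁻¹ = w := by
  have h : joukowski z - joukowski w = (z - w) * (1 - z⁻¹ * w⁻¹) / 2 := by
    rw [joukowski, joukowski]; field_simp; ring
  rw [← sub_eq_zero, h, div_eq_zero_iff, mul_eq_zero, sub_eq_zero, sub_eq_zero]
  constructor
  · rintro ((h | h) | h)
    · exact Or.inl h
    · right; field_simp at h ⊢; exact h.symm
    · exact absurd h two_ne_zero
  · rintro (h | h)
    · exact Or.inl (Or.inl h)
    · left; right; rw [h, mul_inv_cancel₀ hw]

lemma countable_joukowski_fiber (x : ℂ) : {z : ℂ | z ≠ 0 ∧ joukowski z = x}.Countable := by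
  rcases Set.eq_empty_or_nonempty {z : ℂ | z ≠ 0 ∧ joukowski z = x} with h | ⟨w, hw, rfl⟩
  · rw [h]; exact countable_empty
  · refine ((countable_singleton w).union (countable_singleton w⁻¹)).mono ?_
    rintro z ⟨hz, hzw⟩
    rcases (joukowski_eq_iff hz hw).mp hzw with h | h
    · exact Or.inl h
    · exact Or.inr (by rw [← h, inv_inv]; rfl)

/-- Rational functions that agree at `(z + z⁻¹)/2` for all but countably many `z` are equal. -/
lemma eq_of_evalAt_eq {f g : RatFunc ℂ} {E : Set ℂ} (hE : E.Countable)
    (h : ∀ z, z ≠ 0 → z ∉ E → evalAt f z = evalAt g z) : f = g := by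
  by_contra hne
  -- The additional factor `f.denom * g.denom` makes this polynomial vanish also where a denominator
  -- does, so no case has to be excluded before counting roots.
  have hp : f.num * g.denom * (f.denom * g.denom) - g.num * f.denom * (f.denom * g.denom) ≠ 0 := by
    rw [← sub_mul]
    refine mul_ne_zero (fun h0 => hne ?_) (mul_ne_zero f.denom_ne_zero g.denom_ne_zero)
    rw [sub_eq_zero] at h0
    rw [(RatFunc.num_mul_eq_mul_denom_iff g.denom_ne_zero).mp h0, RatFunc.num_div_denom]
  have hc : (Set.univ : Set ℂ).Countable := by
    refine ((hE.insert 0).union (((f.num * g.denom * (f.denom * g.denom) -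
      g.num * f.denom * (f.denom * g.denom)).roots.toFinset.finite_toSet.countable).biUnion
      fun x _ => countable_joukowski_fiber x)).mono fun z _ => ?_
    by_cases hz : z ∈ insert 0 E
    · exact Or.inl hz
    · rw [mem_insert_iff, not_or] at hz
      refine Or.inr (mem_biUnion (x := joukowski z) ?_ ⟨hz.1, rfl⟩)
      have h1 := h z hz.1 hz.2
      rw [evalAt_eq, evalAt_eq] at h1
      simp only [Finset.mem_coe, Multiset.mem_toFinset, mem_roots hp, IsRoot.def, eval_sub, eval_mul]
      by_cases h2 : f.denom.eval (joukowski z) = 0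
      · simp [h2]
      by_cases h3 : g.denom.eval (joukowski z) = 0
      · simp [h3]
      rw [div_eq_div_iff h2 h3] at h1
      rw [h1, sub_self]
  exact not_countable_complex hc

lemma memV_div_nodal {q : ℂ} {b : Fin 6 → ℂ} {S : Finset ℂ} (hS : ∀ x ∈ S, x ∈ poleSet q b)
    {N : ℂ[X]} (hN : N.natDegree ≤ S.card) :
    MemV q b (algebraMap _ (RatFunc ℂ) N / algebraMap _ (RatFunc ℂ) (nodal S id)) := by
  have hD0 : nodal S (id : ℂ → ℂ) ≠ 0 := nodal_ne_zero
  set f := algebraMap _ (RatFunc ℂ) N / algebraMap _ (RatFunc ℂ) (nodal S id) with hf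
  have hd : f.denom ∣ nodal S id := RatFunc.denom_div_dvd N _
  have hr : (nodal S (id : ℂ → ℂ)).roots = S.val := roots_prod_X_sub_C S
  refine ⟨?_, fun x hx => ⟨?_, ?_⟩⟩
  · by_cases h0 : N = 0
    · simp [hf, h0]
    have h1 : f.num * nodal S id = N * f.denom := (RatFunc.num_mul_eq_mul_denom_iff hD0).mpr hf
    have hn0 : f.num ≠ 0 := by
      rintro h; rw [h, zero_mul] at h1
      exact mul_ne_zero h0 f.denom_ne_zero h1.symm
    have h2 := congrArg natDegree h1
    rw [natDegree_mul hn0 hD0, natDegree_mul h0 f.denom_ne_zero, natDegree_nodal] at h2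
    omega
  · have h1 : x ∈ (nodal S (id : ℂ → ℂ)).roots := (mem_roots hD0).mpr (hx.dvd hd)
    rw [hr] at h1
    exact hS x h1
  · refine (rootMultiplicity_le_rootMultiplicity_of_dvd hD0 hd x).trans ?_
    rw [← count_roots, hr]
    exact Multiset.nodup_iff_count_le_one.mp S.nodup x

/-- The reduced denominator is monic and splits, and simple poles mean that its roots are distinct.
-/
lemma MemV.denom_eq {q : ℂ} {b : Fin 6 → ℂ} {f : RatFunc ℂ} (hf : MemV q b f) :
    f.denom = nodal f.denom.roots.toFinset id := by
  have h1 : f.denom.roots.Nodup := by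
    rw [Multiset.nodup_iff_count_le_one]
    intro x
    rw [count_roots]
    by_cases hx : f.denom.IsRoot x
    · exact (hf.2 x hx).2
    · rw [rootMultiplicity_eq_zero hx]; omega
  conv_lhs => rw [(IsAlgClosed.splits f.denom).eq_prod_roots_of_monic f.monic_denom]
  rw [nodal, Finset.prod, Multiset.toFinset_val, h1.dedup]
  rfl

/-- Splitting off one simple pole. -/
lemma exists_partialFraction {S : Finset ℂ} {a : ℂ} (ha : a ∉ S) {N : ℂ[X]}
    (hN : N.natDegree ≤ S.card + 1) :
    ∃ M : ℂ[X], M.natDegree ≤ S.card ∧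
      algebraMap _ (RatFunc ℂ) N / algebraMap _ (RatFunc ℂ) (nodal (insert a S) id) =
        (N.eval a / (nodal S id).eval a) • (algebraMap _ (RatFunc ℂ) (X - C a))⁻¹ +
          algebraMap _ (RatFunc ℂ) M / algebraMap _ (RatFunc ℂ) (nodal S id) := by
  classical
  have hPa : (nodal S id).eval a ≠ 0 := by
    rw [eval_nodal]
    exact Finset.prod_ne_zero_iff.mpr fun x hx => sub_ne_zero.mpr fun h => ha (h ▸ hx)
  set r := N.eval a / (nodal S id).eval a with hr
  have h1 : (N - C r * nodal S id).IsRoot a := by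
    rw [IsRoot.def, eval_sub, eval_mul, eval_C, hr, div_mul_cancel₀ _ hPa, sub_self]
  obtain ⟨M, hM⟩ := dvd_iff_isRoot.mpr h1
  refine ⟨M, ?_, ?_⟩
  · by_cases hM0 : M = 0
    · simp [hM0]
    have h2 := congrArg natDegree hM
    rw [natDegree_mul (X_sub_C_ne_zero a) hM0, natDegree_X_sub_C] at h2
    have h3 : (N - C r * nodal S id).natDegree ≤ S.card + 1 := by
      refine (natDegree_sub_le _ _).trans (max_le hN ?_)
      exact (natDegree_C_mul_le _ _).trans (by rw [natDegree_nodal]; omega)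
    omega
  · have e : N = C r * nodal S id + (X - C a) * M := by rw [← hM]; ring
    have hn : nodal (insert a S) (id : ℂ → ℂ) = (X - C a) * nodal S id := nodal_insert_eq_nodal ha
    have a1 : algebraMap ℂ[X] (RatFunc ℂ) (X - C a) ≠ 0 :=
      RatFunc.algebraMap_ne_zero (X_sub_C_ne_zero a)
    have a2 : algebraMap ℂ[X] (RatFunc ℂ) (nodal S id) ≠ 0 :=
      RatFunc.algebraMap_ne_zero nodal_ne_zero
    conv_lhs => rw [e, hn, map_add, map_mul, map_mul, map_mul]
    rw [RatFunc.smul_eq_C_mul, RatFunc.algebraMap_C]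
    field_simp

lemma div_nodal_mem (U : Submodule ℂ (RatFunc ℂ)) (h1 : (1 : RatFunc ℂ) ∈ U) (S : Finset ℂ)
    (hS : ∀ x ∈ S, (algebraMap _ (RatFunc ℂ) (X - C x))⁻¹ ∈ U) :
    ∀ N : ℂ[X], N.natDegree ≤ S.card →
      algebraMap _ (RatFunc ℂ) N / algebraMap _ (RatFunc ℂ) (nodal S id) ∈ U := by
  classical
  induction S using Finset.induction_on with
  | empty =>
    intro N hN
    rw [Finset.card_empty, Nat.le_zero] at hN
    obtain ⟨c, rfl⟩ := natDegree_eq_zero.mp hN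
    have : algebraMap ℂ[X] (RatFunc ℂ) (C c) / algebraMap ℂ[X] (RatFunc ℂ) (nodal ∅ id) =
        c • (1 : RatFunc ℂ) := by
      rw [nodal_empty, map_one, div_one, RatFunc.smul_eq_C_mul, RatFunc.algebraMap_C, mul_one]
    rw [this]
    exact U.smul_mem c h1
  | insert a S ha ih =>
    intro N hN
    rw [Finset.card_insert_of_notMem ha] at hN
    obtain ⟨M, hM, e⟩ := exists_partialFraction ha hN
    rw [e]
    exact U.add_mem (U.smul_mem _ (hS a (Finset.mem_insert_self a S)))
      (ih (fun x hx => hS x (Finset.mem_insert_of_mem hx)) M hM)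

/-- The quadratic factor: at `(z + z⁻¹)/2` it takes the value `(1 - c z)(1 - c / z)`. -/
def quad (c : ℂ) : ℂ[X] := C (1 + c ^ 2) - C (2 * c) * X

lemma eval_quad (c : ℂ) {z : ℂ} (hz : z ≠ 0) :
    (quad c).eval (joukowski z) = (1 - c * z) * (1 - c / z) := by
  simp only [quad, eval_sub, eval_mul, eval_C, eval_X, joukowski]
  field_simp
  ring

lemma quad_eq {c : ℂ} (hc : c ≠ 0) : quad c = C (-2 * c) * (X - C (joukowski c)) := by
  rw [quad, mul_sub, ← C_mul, show -2 * c * joukowski c = -(1 + c ^ 2) by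
    rw [joukowski]; field_simp; ring]
  simp only [neg_mul, C_neg]
  ring

lemma natDegree_quad_le (c : ℂ) : (quad c).natDegree ≤ 1 := by
  refine (natDegree_sub_le _ _).trans (max_le ?_ ?_)
  · rw [natDegree_C]; exact zero_le_one
  · exact (natDegree_C_mul_le _ _).trans natDegree_X_le

lemma prod_quad {ι : Type*} (T : Finset ι) {c : ι → ℂ} (hc : ∀ t ∈ T, c t ≠ 0)
    (hinj : Set.InjOn (fun t => joukowski (c t)) T) :
    ∃ k : ℂ, k ≠ 0 ∧ ∏ t ∈ T, quad (c t) =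
      C k * nodal (T.image fun t => joukowski (c t)) id := by
  refine ⟨∏ t ∈ T, (-2 * c t), Finset.prod_ne_zero_iff.mpr fun t ht => mul_ne_zero (by norm_num) (hc t ht), ?_⟩
  rw [nodal, Finset.prod_image hinj, map_prod, ← Finset.prod_mul_distrib]
  exact Finset.prod_congr rfl fun t ht => quad_eq (hc t ht)

variable {q : ℂ} {b : Fin 6 → ℂ}

lemma qPoch_eq (q a : ℂ) (k : ℤ) : qPoch q a k = (∏ i ∈ Finset.range k.toNat, (1 - a * q ^ i)) /
    ∏ i ∈ Finset.range (-k).toNat, (1 - a * (q ^ (i + 1))⁻¹) := by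
  cases k with
  | ofNat n => simp [qPoch]
  | negSucc n =>
    rw [Int.neg_negSucc]
    simp [qPoch]

/-- The numerator of the product function. -/
def prodNum (q : ℂ) (b : Fin 6 → ℂ) (k : Fin 6 → ℤ) : ℂ[X] :=
  ∏ j, ∏ i ∈ Finset.range (k j).toNat, quad (b j * q ^ i)

/-- The denominator of the product function. -/
def prodDen (q : ℂ) (b : Fin 6 → ℂ) (k : Fin 6 → ℤ) : ℂ[X] :=
  ∏ j, ∏ i ∈ Finset.range (-k j).toNat, quad (b j * (q ^ (i + 1))⁻¹)

/-- The rational function `∏_j (b_j z^±)_{k_j}` of `(z + z⁻¹)/2`. -/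
def prodFun (q : ℂ) (b : Fin 6 → ℂ) (k : Fin 6 → ℤ) : RatFunc ℂ :=
  algebraMap _ (RatFunc ℂ) (prodNum q b k) / algebraMap _ (RatFunc ℂ) (prodDen q b k)

lemma isProductFun_prodFun (q : ℂ) (b : Fin 6 → ℂ) (k : Fin 6 → ℤ) :
    IsProductFun q b k (prodFun q b k) := by
  intro z hz hgood
  have hne : ∀ (j : Fin 6) (i : ℕ),
      1 - b j * (q ^ (i + 1))⁻¹ * z ≠ 0 ∧ 1 - b j * (q ^ (i + 1))⁻¹ / z ≠ 0 := by
    intro j i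
    have h := hgood j (-((i + 1 : ℕ) : ℤ)) (by omega)
    rw [zpow_neg, zpow_natCast] at h
    refine ⟨fun h0 => h.2 (inv_eq_of_mul_eq_one_left (by linear_combination -h0)), fun h0 => h.1 ?_⟩
    rw [sub_eq_zero, eq_div_iff hz, one_mul] at h0
    exact h0
  rw [prodFun, evalAt_div]
  · simp only [prodNum, prodDen, eval_prod, eval_quad _ hz, qPoch_eq, Finset.prod_mul_distrib,
      Finset.prod_div_distrib, mul_right_comm _ z, div_mul_eq_mul_div]
    ring
  · simp only [prodDen, eval_prod, eval_quad _ hz]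
    exact Finset.prod_ne_zero_iff.mpr fun j _ => Finset.prod_ne_zero_iff.mpr fun i _ =>
      mul_ne_zero (hne j i).1 (hne j i).2

lemma IsProductFun.eq_prodFun {k : Fin 6 → ℤ} {f : RatFunc ℂ} (hf : IsProductFun q b k f) :
    f = prodFun q b k := by
  have hE : (⋃ (j : Fin 6) (n : ℤ), ({b j * q ^ n, (b j * q ^ n)⁻¹} : Set ℂ)).Countable :=
    countable_iUnion fun j => countable_iUnion fun n => Set.Countable.insert _ (countable_singleton _)
  refine eq_of_evalAt_eq hE fun z hz hzE => ?_
  have hgood : ∀ (j : Fin 6) (n : ℤ), n < 0 → z ≠ b j * q ^ n ∧ z⁻¹ ≠ b j * q ^ n := by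
    intro j n _
    simp only [mem_iUnion, mem_insert_iff, mem_singleton_iff, not_exists, not_or] at hzE
    exact ⟨(hzE j n).1, fun h => (hzE j n).2 (by rw [← h, inv_inv])⟩
  rw [hf z hz hgood, isProductFun_prodFun q b k z hz hgood]

lemma Generic.mul_zpow_injective (hq0 : q ≠ 0) (hq : ‖q‖ < 1) (h : Generic q b) {i j : Fin 6}
    {m n : ℤ} (he : b i * q ^ m = b j * q ^ n) : i = j ∧ m = n := by
  have hm := zpow_ne_zero m hq0
  have h2 : b i = b j * q ^ (n - m) := by
    rw [zpow_sub₀ hq0]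
    field_simp
    exact he
  have hij : i = j := by
    by_contra hij
    exact h.ne_mul i j hij _ h2
  subst hij
  exact ⟨rfl, zpow_injective hq0 hq (mul_left_cancel₀ (h.ne_zero hq0 i) he)⟩

lemma Generic.inv_mul_zpow_ne (hq0 : q ≠ 0) (h : Generic q b) (i j : Fin 6) (m n : ℤ) :
    (b i * q ^ m)⁻¹ ≠ b j * q ^ n := by
  intro he
  refine h.mul_ne i j (-(m + n)) ?_
  have h1 := h.ne_zero hq0 i
  have hm := zpow_ne_zero m hq0
  have hn := zpow_ne_zero n hq0
  rw [zpow_neg, zpow_add₀ hq0]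
  field_simp at he ⊢
  linear_combination -he

/-- The map `z ↦ (z + z⁻¹)/2` identifies only `z` and `z⁻¹`, and genericity forbids `b_i q^m = (b_j
q^n)⁻¹`. -/
lemma Generic.joukowski_injective (hq0 : q ≠ 0) (hq : ‖q‖ < 1) (h : Generic q b) {i j : Fin 6}
    {m n : ℤ} (he : joukowski (b i * q ^ m) = joukowski (b j * q ^ n)) : i = j ∧ m = n := by
  rcases (joukowski_eq_iff (mul_ne_zero (h.ne_zero hq0 i) (zpow_ne_zero m hq0))
    (mul_ne_zero (h.ne_zero hq0 j) (zpow_ne_zero n hq0))).mp he with h1 | h1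
  · exact h.mul_zpow_injective hq0 hq h1
  · exact absurd h1 (h.inv_mul_zpow_ne hq0 i j m n)

lemma joukowski_pole_injective (hq0 : q ≠ 0) (hq : ‖q‖ < 1) (h : Generic q b) {i j : Fin 6} {m n : ℕ}
    (he : joukowski (b i * (q ^ (m + 1))⁻¹) = joukowski (b j * (q ^ (n + 1))⁻¹)) : i = j ∧ m = n := by
  rw [← zpow_natCast, ← zpow_natCast, ← zpow_neg, ← zpow_neg] at he
  obtain ⟨h1, h2⟩ := h.joukowski_injective hq0 hq he
  exact ⟨h1, by omega⟩

lemma joukowski_pole_mem (j : Fin 6) (n : ℕ) : joukowski (b j * (q ^ (n + 1))⁻¹) ∈ poleSet q b :=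
  ⟨j, -((n + 1 : ℕ) : ℤ), by omega, by rw [zpow_neg, zpow_natCast]⟩

lemma prodFun_eq_of_prodDen_eq {k : Fin 6 → ℤ} {c : ℂ} {P : ℂ[X]} (h : prodDen q b k = C c * P) :
    prodFun q b k =
      algebraMap _ (RatFunc ℂ) (C c⁻¹ * prodNum q b k) / algebraMap _ (RatFunc ℂ) P := by
  have hc : algebraMap ℂ[X] (RatFunc ℂ) (C c⁻¹) = (algebraMap ℂ[X] (RatFunc ℂ) (C c))⁻¹ := by
    rw [RatFunc.algebraMap_C, RatFunc.algebraMap_C, map_inv₀]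
  rw [prodFun, h, map_mul, map_mul, hc]
  ring

lemma memV_prodFun (hq0 : q ≠ 0) (hq : ‖q‖ < 1) (h : Generic q b) {k : Fin 6 → ℤ}
    (hk : ∑ j, k j = 0) : prodFun q b k ∈ V q b := by
  set T : Finset (Σ _ : Fin 6, ℕ) := Finset.univ.sigma fun j => Finset.range (-k j).toNat with hT
  have hinj : Function.Injective fun t : Σ _ : Fin 6, ℕ => joukowski (b t.1 * (q ^ (t.2 + 1))⁻¹) := by
    rintro ⟨i, m⟩ ⟨j, n⟩ he
    obtain ⟨rfl, rfl⟩ := joukowski_pole_injective hq0 hq h he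
    rfl
  obtain ⟨c, hc, e⟩ := prod_quad T (c := fun t => b t.1 * (q ^ (t.2 + 1))⁻¹)
    (fun t _ => mul_ne_zero (h.ne_zero hq0 _) (inv_ne_zero (pow_ne_zero _ hq0))) hinj.injOn
  have e1 : prodDen q b k = C c * nodal (T.image fun t => joukowski (b t.1 * (q ^ (t.2 + 1))⁻¹)) id := by
    rw [← e, hT, Finset.prod_sigma]; rfl
  have e2 : prodFun q b k = algebraMap _ (RatFunc ℂ) (C c⁻¹ * prodNum q b k) / algebraMap _ (RatFunc ℂ)
      (nodal (T.image fun t => joukowski (b t.1 * (q ^ (t.2 + 1))⁻¹)) id) :=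
    prodFun_eq_of_prodDen_eq e1
  rw [e2]
  refine memV_div_nodal (fun x hx => ?_) ?_
  · obtain ⟨t, -, rfl⟩ := Finset.mem_image.mp hx
    exact joukowski_pole_mem _ _
  · rw [Finset.card_image_of_injective _ hinj, hT, Finset.card_sigma]
    refine (natDegree_C_mul_le _ _).trans ((natDegree_prod_le _ _).trans ?_)
    have h1 : ∑ j, ((k j).toNat : ℤ) = ∑ j, ((-k j).toNat : ℤ) := by
      rw [← sub_eq_zero, ← Finset.sum_sub_distrib, ← hk]
      exact Finset.sum_congr rfl fun j _ => by omega
    have h2 : ∑ j, (k j).toNat = ∑ j, (-k j).toNat := by exact_mod_cast h1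
    simp only [Finset.card_range]
    rw [← h2]
    refine Finset.sum_le_sum fun j _ => (natDegree_prod_le _ _).trans ?_
    refine (Finset.sum_le_card_nsmul _ _ 1 fun i _ => natDegree_quad_le _).trans ?_
    simp

/-- The span of the product functions. -/
def prodSpan (q : ℂ) (b : Fin 6 → ℂ) : Submodule ℂ (RatFunc ℂ) :=
  Submodule.span ℂ {f | ∃ k : Fin 6 → ℤ, ∑ j, k j = 0 ∧ IsProductFun q b k f}

lemma prodFun_mem_prodSpan {k : Fin 6 → ℤ} (hk : ∑ j, k j = 0) : prodFun q b k ∈ prodSpan q b :=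
  Submodule.subset_span ⟨k, hk, isProductFun_prodFun q b k⟩

lemma one_mem_prodSpan : (1 : RatFunc ℂ) ∈ prodSpan q b := by
  have := prodFun_mem_prodSpan (q := q) (b := b) (k := 0) (by simp)
  simpa [prodFun, prodNum, prodDen] using this

/-- A suitable product function has simple poles at the first `n + 1` points of the `j`-th sequence
only. Its other partial fractions lie in the span by induction, and the coefficient at the last pole
is nonzero. -/
lemma inv_mem_prodSpan (hq0 : q ≠ 0) (hq : ‖q‖ < 1) (h : Generic q b) (j : Fin 6) (n : ℕ) :
    (algebraMap _ (RatFunc ℂ) (X - C (joukowski (b j * (q ^ (n + 1))⁻¹))))⁻¹ ∈ prodSpan q b := by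
  induction n using Nat.strong_induction_on with
  | _ n ih =>
  have hb := h.ne_zero hq0
  obtain ⟨i, hij⟩ : ∃ i : Fin 6, i ≠ j := exists_ne j
  -- The entry at `j` produces the poles; the opposite entry at another index `i` only restores the
  -- zero sum.
  set k : Fin 6 → ℤ := Pi.single i ((n : ℤ) + 1) + Pi.single j (-((n : ℤ) + 1)) with hk
  have hki : k i = n + 1 := by simp [hk, hij]
  have hkj : k j = -((n : ℤ) + 1) := by simp [hk, hij.symm]
  have hk0 : ∀ m, m ≠ i → m ≠ j → k m = 0 := fun m h1 h2 => by simp [hk, h1, h2]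
  have hksum : ∑ m, k m = 0 := by simp [hk, Finset.sum_add_distrib]
  have hN : prodNum q b k = ∏ m ∈ Finset.range (n + 1), quad (b i * q ^ m) := by
    rw [prodNum, Finset.prod_eq_single i, hki]
    · rfl
    · intro m _ hmi
      by_cases hmj : m = j
      · subst hmj
        rw [hkj, show (-((n : ℤ) + 1)).toNat = 0 by omega]; rfl
      · rw [hk0 m hmi hmj]; rfl
    · simp
  have hD : prodDen q b k = ∏ m ∈ Finset.range (n + 1), quad (b j * (q ^ (m + 1))⁻¹) := by
    rw [prodDen, Finset.prod_eq_single j, hkj, neg_neg]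
    · rfl
    · intro m _ hmj
      by_cases hmi : m = i
      · subst hmi
        rw [hki, show (-((n : ℤ) + 1)).toNat = 0 by omega]; rfl
      · rw [hk0 m hmi hmj]; rfl
    · simp
  have hinj : Function.Injective fun m : ℕ => joukowski (b j * (q ^ (m + 1))⁻¹) :=
    fun m m' he => (joukowski_pole_injective hq0 hq h he).2
  obtain ⟨c, hc, e⟩ := prod_quad (Finset.range (n + 1)) (c := fun m => b j * (q ^ (m + 1))⁻¹)
    (fun m _ => mul_ne_zero (hb _) (inv_ne_zero (pow_ne_zero _ hq0))) hinj.injOn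
  set S := (Finset.range n).image fun m => joukowski (b j * (q ^ (m + 1))⁻¹) with hS
  set a := joukowski (b j * (q ^ (n + 1))⁻¹) with ha
  have haS : a ∉ S := by
    intro hm
    obtain ⟨m, hm, he⟩ := Finset.mem_image.mp hm
    exact absurd (hinj he) (Finset.mem_range.mp hm).ne
  rw [Finset.range_add_one, Finset.image_insert, ← hS, ← ha, ← Finset.range_add_one, ← hD] at e
  have hdeg : (C c⁻¹ * prodNum q b k).natDegree ≤ S.card + 1 := by
    rw [hS, Finset.card_image_of_injective _ hinj, Finset.card_range, hN]
    refine (natDegree_C_mul_le _ _).trans ((natDegree_prod_le _ _).trans ?_)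
    refine (Finset.sum_le_card_nsmul _ _ 1 fun i _ => natDegree_quad_le _).trans ?_
    simp
  obtain ⟨M, hM, e1⟩ := exists_partialFraction haS hdeg
  have e2 : prodFun q b k = algebraMap _ (RatFunc ℂ) (C c⁻¹ * prodNum q b k) / algebraMap _ (RatFunc ℂ)
      (nodal (insert a S) id) := prodFun_eq_of_prodDen_eq e
  have hMm := div_nodal_mem (prodSpan q b) one_mem_prodSpan S (fun x hx => by
    obtain ⟨m, hm, rfl⟩ := Finset.mem_image.mp hx
    exact ih m (Finset.mem_range.mp hm)) M hM
  -- A zero of the numerator at the last pole would put `b i * b j` or `b j / b i` in `q^ℤ`.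
  have hNa : (C c⁻¹ * prodNum q b k).eval a ≠ 0 := by
    have hw : b j * (q ^ (n + 1))⁻¹ ≠ 0 := mul_ne_zero (hb j) (inv_ne_zero (pow_ne_zero _ hq0))
    rw [eval_mul, eval_C, hN, eval_prod]
    refine mul_ne_zero (inv_ne_zero hc) (Finset.prod_ne_zero_iff.mpr fun m _ => ?_)
    rw [ha, eval_quad _ hw]
    have hqn := pow_ne_zero (n + 1) hq0
    refine mul_ne_zero (fun h0 => ?_) fun h0 => ?_
    · refine h.mul_ne i j (((n + 1 : ℕ) : ℤ) - m) ?_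
      have hqm := pow_ne_zero m hq0
      rw [zpow_sub₀ hq0, zpow_natCast, zpow_natCast]
      field_simp at h0 ⊢
      linear_combination -h0
    · refine h.ne_mul j i hij.symm (((n + 1 : ℕ) : ℤ) + m) ?_
      have hbj := hb j
      rw [zpow_add₀ hq0, zpow_natCast, zpow_natCast]
      field_simp at h0
      linear_combination h0
  have hPa : (nodal S id).eval a ≠ 0 := by
    rw [eval_nodal]
    exact Finset.prod_ne_zero_iff.mpr fun x hx => sub_ne_zero.mpr fun h => haS (h ▸ hx)
  have hr := div_ne_zero hNa hPa
  rw [← e2] at e1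
  have h3 : ((C c⁻¹ * prodNum q b k).eval a / (nodal S id).eval a) •
      (algebraMap ℂ[X] (RatFunc ℂ) (X - C a))⁻¹ ∈ prodSpan q b := by
    rw [← sub_eq_iff_eq_add.mpr e1]
    exact Submodule.sub_mem _ (prodFun_mem_prodSpan hksum) hMm
  exact (Submodule.smul_mem_iff _ hr).mp h3

/-- The space `V` is spanned by the product functions. -/
theorem prodSpan_eq (hq0 : q ≠ 0) (hq : ‖q‖ < 1) (h : Generic q b) : prodSpan q b = V q b := by
  apply le_antisymm
  · refine Submodule.span_le.mpr ?_
    rintro f ⟨k, hk, hf⟩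
    rw [hf.eq_prodFun]
    exact memV_prodFun hq0 hq h hk
  · intro f hf
    have hf' : MemV q b f := hf
    have e := hf'.denom_eq
    rw [← RatFunc.num_div_denom f, e]
    refine div_nodal_mem _ one_mem_prodSpan _ (fun x hx => ?_) _ ?_
    · rw [Multiset.mem_toFinset, mem_roots f.denom_ne_zero] at hx
      obtain ⟨j, n, hn, rfl⟩ := (hf'.2 x hx).1
      have := inv_mem_prodSpan hq0 hq h j (-n - 1).toNat
      rwa [← zpow_natCast, show (((-n - 1).toNat + 1 : ℕ) : ℤ) = -n by omega, zpow_neg, inv_inv] at this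
    · have h1 := hf'.1
      rw [e, natDegree_nodal] at h1
      exact h1

end RationalFunctions

/-! ### Shifting the parameters by integer powers of `q`. -/

section Shifts

variable {q : ℂ} {b : Fin 6 → ℂ}

/-- For negative `k` the factors of `(a q^k)_∞` not in `(a)_∞` are those of the reciprocal finite
product in reverse order; the hypothesis keeps them nonzero. -/
lemma qPochInf_eq_qPoch_mul (hq0 : q ≠ 0) (hq : ‖q‖ < 1) {a : ℂ} (ha : ∀ n : ℤ, a ≠ q ^ n) (k : ℤ) :
    qPochInf q a = qPoch q a k * qPochInf q (a * q ^ k) := by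
  rcases Int.eq_nat_or_neg k with ⟨n, rfl | rfl⟩
  · rw [qPoch_eq, qPochInf_eq_prod_mul hq a n]
    simp
  · have h1 : ∏ i ∈ Finset.range n, (1 - a * (q ^ (i + 1))⁻¹) ≠ 0 := by
      refine Finset.prod_ne_zero_iff.mpr fun i _ h0 => ha ((i + 1 : ℕ) : ℤ) ?_
      have := pow_ne_zero (i + 1) hq0
      rw [zpow_natCast]
      field_simp at h0
      linear_combination -h0
    have h2 : ∏ i ∈ Finset.range n, (1 - a * q ^ (-(n : ℤ)) * q ^ i) =
        ∏ i ∈ Finset.range n, (1 - a * (q ^ (i + 1))⁻¹) := by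
      rw [← Finset.prod_range_reflect]
      refine Finset.prod_congr rfl fun i hi => ?_
      have hi' := Finset.mem_range.mp hi
      rw [mul_assoc, ← zpow_natCast, ← zpow_add₀ hq0, ← zpow_natCast, ← zpow_neg]
      congr 3
      omega
    rw [qPoch_eq, qPochInf_eq_prod_mul hq (a * q ^ (-(n : ℤ))) n, h2, zpow_neg, zpow_natCast,
      inv_mul_cancel_right₀ (pow_ne_zero n hq0), neg_neg, Int.toNat_natCast,
      show (-(n : ℤ)).toNat = 0 by omega, Finset.range_zero, Finset.prod_empty, div_mul_eq_mul_div,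
      one_mul, mul_div_cancel_left₀ _ h1]

lemma triangular_succ (k : ℤ) : (k + 1) * (k + 1 - 1) / 2 = k * (k - 1) / 2 + k := by
  rw [show (k + 1) * (k + 1 - 1) = k * (k - 1) + k * 2 by ring,
    Int.add_mul_ediv_right _ _ two_ne_zero]

lemma theta_mul_zpow (hq0 : q ≠ 0) (hq : ‖q‖ < 1) {x : ℂ} (hx : x ≠ 0) (k : ℤ) :
    theta q (x * q ^ k) * (x ^ k * q ^ (k * (k - 1) / 2)) = (-1) ^ k * theta q x := by
  have step : ∀ k : ℤ, theta q (x * q ^ (k + 1)) * (x ^ (k + 1) * q ^ ((k + 1) * (k + 1 - 1) / 2)) =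
      -(theta q (x * q ^ k) * (x ^ k * q ^ (k * (k - 1) / 2))) := by
    intro k
    have hk := zpow_ne_zero k hq0
    rw [triangular_succ, zpow_add_one₀ hq0, show x * (q ^ k * q) = q * (x * q ^ k) by ring,
      theta_mul_left hq0 hq (mul_ne_zero hx hk), zpow_add₀ hq0, zpow_add_one₀ hx]
    field_simp
  induction k with
  | zero => simp
  | succ n ih => rw [step, ih, zpow_add_one₀ (by norm_num)]; ring
  | pred n ih =>
    have h1 := step (-(n : ℤ) - 1)
    rw [sub_add_cancel, ih] at h1
    rw [zpow_sub_one₀ (a := (-1 : ℂ)) (by norm_num)]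
    linear_combination h1

lemma prod_zpow_eq {ι : Type*} (s : Finset ι) {a : ℂ} (ha : a ≠ 0) (k : ι → ℤ) :
    ∏ j ∈ s, a ^ k j = a ^ ∑ j ∈ s, k j := by
  classical
  induction s using Finset.induction_on with
  | empty => simp
  | insert i s hi ih => rw [Finset.prod_insert hi, Finset.sum_insert hi, zpow_add₀ ha, ih]

lemma prod_theta_mul_zpow (hq0 : q ≠ 0) (hq : ‖q‖ < 1) {c : Fin 6 → ℂ} (hc : ∀ j, c j ≠ 0)
    {k : Fin 6 → ℤ} (hk : ∑ j, k j = 0) :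
    (∏ j, theta q (c j * q ^ k j)) * ∏ j, (c j ^ k j * q ^ (k j * (k j - 1) / 2)) =
      ∏ j, theta q (c j) := by
  rw [← Finset.prod_mul_distrib, Finset.prod_congr rfl fun j _ => theta_mul_zpow hq0 hq (hc j) (k j),
    Finset.prod_mul_distrib, prod_zpow_eq _ (by norm_num), hk, zpow_zero, one_mul]

lemma Generic.mul_zpow (hq0 : q ≠ 0) (h : Generic q b) {k : Fin 6 → ℤ} (hk : ∑ j, k j = 0) :
    Generic q (fun j => b j * q ^ k j) where
  prod_eq := by rw [Finset.prod_mul_distrib, h.prod_eq, prod_zpow_eq _ hq0, hk, zpow_zero, mul_one]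
  ne_mul i j hij n he := by
    refine h.ne_mul i j hij (k j + n - k i) ?_
    have := zpow_ne_zero (k i) hq0
    rw [zpow_sub₀ hq0, zpow_add₀ hq0]
    field_simp
    linear_combination he
  mul_ne i j n he := by
    refine h.mul_ne i j (n - k i - k j) ?_
    have := zpow_ne_zero (k i) hq0
    have := zpow_ne_zero (k j) hq0
    rw [zpow_sub₀ hq0, zpow_sub₀ hq0]
    field_simp
    linear_combination he

/-- The products in `D` are shifted by `k` and by `-k`. Because `∑ k j = 0`, signs and powers of `l`
drop out and both products acquire the same factor, which is the denominator of `productValue`. -/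
lemma thetaDiff_mul_zpow (hq0 : q ≠ 0) (hq : ‖q‖ < 1) (h : Generic q b) {k : Fin 6 → ℤ}
    (hk : ∑ j, k j = 0) {l : ℂ} (hl : l ≠ 0) :
    thetaDiff q (fun j => b j * q ^ k j) l * ∏ j, (q ^ (k j * (k j - 1) / 2) * b j ^ k j) =
      thetaDiff q b l := by
  have hb := h.ne_zero hq0
  have h1 := prod_theta_mul_zpow hq0 hq (c := fun j => l * b j) (fun j => mul_ne_zero hl (hb j)) hk
  have h2 := prod_theta_mul_zpow hq0 hq (c := fun j => l / b j) (fun j => div_ne_zero hl (hb j))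
    (k := fun j => -k j) (by rw [Finset.sum_neg_distrib, hk, neg_zero])
  have e1 : ∏ j, ((l * b j) ^ k j * q ^ (k j * (k j - 1) / 2)) =
      ∏ j, (q ^ (k j * (k j - 1) / 2) * b j ^ k j) := by
    rw [← one_mul (∏ j, (q ^ _ * _)), ← zpow_zero l, ← hk, ← prod_zpow_eq _ hl,
      ← Finset.prod_mul_distrib]
    exact Finset.prod_congr rfl fun j _ => by rw [mul_zpow]; ring
  -- The triangular exponent at `-k` exceeds that at `k` by `k`; the surplus powers of `q` multiply
  -- to `1`.
  have e2 : ∏ j, ((l / b j) ^ (-k j) * q ^ (-k j * (-k j - 1) / 2)) =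
      ∏ j, (q ^ (k j * (k j - 1) / 2) * b j ^ k j) := by
    have h3 : (∏ j, q ^ k j) * ∏ j, (l⁻¹) ^ k j = 1 := by
      rw [prod_zpow_eq _ hq0, prod_zpow_eq _ (inv_ne_zero hl), hk, zpow_zero, zpow_zero, one_mul]
    rw [← one_mul (∏ j, (q ^ _ * _)), ← h3, ← Finset.prod_mul_distrib, ← Finset.prod_mul_distrib]
    refine Finset.prod_congr rfl fun j _ => ?_
    rw [show -k j * (-k j - 1) = (k j + 1) * (k j + 1 - 1) by ring, triangular_succ, zpow_add₀ hq0,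
      zpow_neg, ← inv_zpow, inv_div, div_eq_mul_inv, mul_zpow]
    ring
  rw [e1] at h1
  rw [e2] at h2
  have e3 : ∀ j, l * (b j * q ^ k j) = l * b j * q ^ k j := fun j => by ring
  have e4 : ∀ j, l / (b j * q ^ k j) = l / b j * q ^ (-k j) := fun j => by
    rw [zpow_neg, div_mul_eq_div_div, div_eq_mul_inv _ (q ^ k j)]
  simp only [thetaDiff, e3, e4]
  rw [← h1, ← h2]
  ring

lemma pairProd_mul_zpow (hq0 : q ≠ 0) (hq : ‖q‖ < 1) (h : Generic q b) (k : Fin 6 → ℤ) :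
    pairProd q b = (∏ i, ∏ j ∈ Finset.Ioi i, qPoch q (b i * b j) (k i + k j)) *
      pairProd q (fun j => b j * q ^ k j) := by
  rw [pairProd, pairProd, ← Finset.prod_mul_distrib]
  refine Finset.prod_congr rfl fun i _ => ?_
  rw [← Finset.prod_mul_distrib]
  refine Finset.prod_congr rfl fun j _ => ?_
  rw [qPochInf_eq_qPoch_mul hq0 hq (h.mul_ne i j) (k i + k j), zpow_add₀ hq0]
  congr 2
  ring

/-- The product functions shift the parameters of the weight. -/
lemma evalAt_mul_weight (hq0 : q ≠ 0) (hq : ‖q‖ < 1) (b : Fin 6 → ℂ) {k : Fin 6 → ℤ} {f : RatFunc ℂ}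
    (hf : IsProductFun q b k f) (l : ℂ) {z : ℂ} (hz : z ≠ 0)
    (hzb : ∀ (j : Fin 6) (n : ℤ), z ≠ b j * q ^ n ∧ z⁻¹ ≠ b j * q ^ n) :
    evalAt f z * weight q b l z = weight q (fun j => b j * q ^ k j) l z := by
  have h1 : ∀ (j : Fin 6) (n : ℤ), b j * z ≠ q ^ n := fun j n he => (hzb j (-n)).2 (by
    have := zpow_ne_zero n hq0
    rw [zpow_neg, ← he]
    rw [← he] at this
    have := right_ne_zero_of_mul this
    have := left_ne_zero_of_mul (a := b j) (b := z) (by assumption)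
    field_simp)
  have h2 : ∀ (j : Fin 6) (n : ℤ), b j / z ≠ q ^ n := fun j n he => (hzb j (-n)).1 (by
    have := zpow_ne_zero n hq0
    rw [zpow_neg, ← he]
    rw [← he] at this
    have := (div_ne_zero_iff.mp this).1
    field_simp)
  have hne : ∀ {a : ℂ}, (∀ n : ℤ, a ≠ q ^ n) → qPochInf q a ≠ 0 := by
    intro a ha
    refine qPochInf_ne_zero hq fun n hn => ha (-n) ?_
    rw [zpow_neg, zpow_natCast]
    exact eq_inv_of_mul_eq_one_left hn
  rw [hf z hz fun j n _ => hzb j n, weight, weight, mul_div_left_comm, ← Finset.prod_div_distrib]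
  rw [div_eq_mul_inv (_ * _) (∏ j, _), ← Finset.prod_inv_distrib]
  congr 1
  refine Finset.prod_congr rfl fun j _ => ?_
  have p1 := qPochInf_eq_qPoch_mul hq0 hq (h1 j) (k j)
  have p2 := qPochInf_eq_qPoch_mul hq0 hq (h2 j) (k j)
  have n1 := hne (h1 j)
  have n2 := hne (h2 j)
  rw [p1] at n1
  rw [p2] at n2
  rw [p1, p2, show b j * q ^ k j * z = b j * z * q ^ k j by ring,
    show b j * q ^ k j / z = b j / z * q ^ k j by ring]
  have := left_ne_zero_of_mul n1
  have := right_ne_zero_of_mul n1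
  have := left_ne_zero_of_mul n2
  have := right_ne_zero_of_mul n2
  field_simp

end Shifts

/-! ### Poles of `f` times the weight. -/

section Poles

variable {q : ℂ} {b : Fin 6 → ℂ}

/-- The parameters `b_j q^{-N}`. -/
def shiftParam (q : ℂ) (b : Fin 6 → ℂ) (N : ℕ) (j : Fin 6) : ℂ := b j * (q ^ N)⁻¹

lemma mem_poleSeq_shiftParam (hq0 : q ≠ 0) {N : ℕ} {z : ℂ} :
    z ∈ poleSeq q (shiftParam q b N) ↔ ∃ (j : Fin 6) (n : ℤ), -(N : ℤ) ≤ n ∧ z = b j * q ^ n := by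
  constructor
  · rintro ⟨j, n, rfl⟩
    refine ⟨j, n - N, by omega, ?_⟩
    rw [shiftParam, zpow_sub₀ hq0, zpow_natCast, zpow_natCast]
    ring
  · rintro ⟨j, n, hn, rfl⟩
    refine ⟨j, (n + N).toNat, ?_⟩
    rw [shiftParam, ← zpow_natCast, ← zpow_natCast, ← zpow_neg, mul_assoc, ← zpow_add₀ hq0]
    congr 2
    omega

lemma mem_poleSeqInv_shiftParam (hq0 : q ≠ 0) {N : ℕ} {z : ℂ} :
    z ∈ poleSeqInv q (shiftParam q b N) ↔
      ∃ (j : Fin 6) (n : ℤ), -(N : ℤ) ≤ n ∧ z⁻¹ = b j * q ^ n :=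
  mem_poleSeq_shiftParam hq0

lemma shiftParam_zero : shiftParam q b 0 = b := by
  funext j; simp [shiftParam]

lemma poleSeq_shiftParam_subset (hq0 : q ≠ 0) {M N : ℕ} (h : M ≤ N) :
    poleSeq q (shiftParam q b M) ⊆ poleSeq q (shiftParam q b N) := by
  intro z hz
  obtain ⟨j, n, hn, rfl⟩ := (mem_poleSeq_shiftParam hq0).mp hz
  exact (mem_poleSeq_shiftParam hq0).mpr ⟨j, n, by omega, rfl⟩

lemma poleSeqInv_shiftParam_subset (hq0 : q ≠ 0) {M N : ℕ} (h : M ≤ N) :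
    poleSeqInv q (shiftParam q b M) ⊆ poleSeqInv q (shiftParam q b N) :=
  fun _ hz => poleSeq_shiftParam_subset hq0 h hz

lemma shiftParam_ne_zero (hq0 : q ≠ 0) (h : Generic q b) (N : ℕ) (j : Fin 6) :
    shiftParam q b N j ≠ 0 :=
  mul_ne_zero (h.ne_zero hq0 j) (inv_ne_zero (pow_ne_zero N hq0))

lemma locFin_shiftParam (hq0 : q ≠ 0) (hq : ‖q‖ < 1) (h : Generic q b) (N : ℕ) :
    LocFin (poleSeq q (shiftParam q b N) ∪ poleSeqInv q (shiftParam q b N)) :=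
  locFin_poleSeq hq0 hq (shiftParam_ne_zero hq0 h N) (shiftParam_ne_zero hq0 h N)

lemma exists_separates_shiftParam (hq0 : q ≠ 0) (hq : ‖q‖ < 1) (h : Generic q b) (N : ℕ) :
    ∃ γ, Separates (poleSeq q (shiftParam q b N)) (poleSeqInv q (shiftParam q b N)) γ := by
  refine exists_separates (locFin_shiftParam hq0 hq h N) ?_ (fun ρ hρ => finite_poleSeq hq _ hρ)
    (fun R => finite_poleSeqInv hq0 hq (shiftParam_ne_zero hq0 h N) R)
  rw [disjoint_left]
  intro z h1 h2
  obtain ⟨i, m, -, rfl⟩ := (mem_poleSeq_shiftParam hq0).mp h1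
  obtain ⟨j, n, -, he⟩ := (mem_poleSeqInv_shiftParam hq0).mp h2
  exact h.inv_mul_zpow_ne hq0 i j m n he

/-- All the poles of `f` are at points `(z + z⁻¹)/2` with `z = b_j q^n`, `n ≥ -N`. -/
def PoleBound (q : ℂ) (b : Fin 6 → ℂ) (N : ℕ) (f : RatFunc ℂ) : Prop :=
  ∀ x, f.denom.IsRoot x → ∃ (j : Fin 6) (n : ℤ), -(N : ℤ) ≤ n ∧ x = joukowski (b j * q ^ n)

lemma PoleBound.mono {M N : ℕ} {f : RatFunc ℂ} (hf : PoleBound q b M f) (h : M ≤ N) :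
    PoleBound q b N f := fun x hx => by
  obtain ⟨j, n, hn, e⟩ := hf x hx
  exact ⟨j, n, by omega, e⟩

lemma MemV.exists_poleBound {f : RatFunc ℂ} (hf : MemV q b f) : ∃ N, PoleBound q b N f := by
  classical
  have h : ∀ x : ℂ, ∃ N : ℕ, f.denom.IsRoot x →
      ∃ (j : Fin 6) (n : ℤ), -(N : ℤ) ≤ n ∧ x = joukowski (b j * q ^ n) := by
    intro x
    by_cases hx : f.denom.IsRoot x
    · obtain ⟨j, n, -, e⟩ := (hf.2 x hx).1
      exact ⟨(-n).toNat, fun _ => ⟨j, n, by omega, e⟩⟩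
    · exact ⟨0, fun h => absurd h hx⟩
  choose N hN using h
  refine ⟨f.denom.roots.toFinset.sup N, fun x hx => ?_⟩
  obtain ⟨j, n, hn, e⟩ := hN x hx
  have : N x ≤ f.denom.roots.toFinset.sup N :=
    Finset.le_sup (Multiset.mem_toFinset.mpr ((Polynomial.mem_roots f.denom_ne_zero).mpr hx))
  exact ⟨j, n, by omega, e⟩

lemma PoleBound.eval_denom_ne_zero (hq0 : q ≠ 0) (h : Generic q b) {N : ℕ} {f : RatFunc ℂ}
    (hf : PoleBound q b N f) {z : ℂ} (hz : z ≠ 0)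
    (hzP : z ∉ poleSeq q (shiftParam q b N) ∪ poleSeqInv q (shiftParam q b N)) :
    f.denom.eval (joukowski z) ≠ 0 := by
  intro h0
  obtain ⟨j, n, hn, e⟩ := hf _ h0
  rcases (joukowski_eq_iff hz (mul_ne_zero (h.ne_zero hq0 j) (zpow_ne_zero n hq0))).mp e with e | e
  · exact hzP (Or.inl ((mem_poleSeq_shiftParam hq0).mpr ⟨j, n, hn, e⟩))
  · exact hzP (Or.inr ((mem_poleSeqInv_shiftParam hq0).mpr ⟨j, n, hn, e⟩))

/-- Functions in `V` have poles at `b_j q^n` only for `n < 0`, the weight only for `n ≥ 0`, and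
likewise at the inverses, so the poles never collide. -/
lemma MemV.eval_denom_ne_zero (hq0 : q ≠ 0) (hq : ‖q‖ < 1) (h : Generic q b) {f : RatFunc ℂ}
    (hf : MemV q b f) {z : ℂ} (hz : z ∈ poleSeq q b ∪ poleSeqInv q b) :
    f.denom.eval (joukowski z) ≠ 0 := by
  have key : ∀ w ∈ poleSeq q b, f.denom.eval (joukowski w) ≠ 0 := by
    rintro - ⟨i, m, rfl⟩ h0
    obtain ⟨j, n, hn, e⟩ := (hf.2 _ h0).1
    rw [← zpow_natCast] at e
    have := (h.joukowski_injective hq0 hq e).2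
    omega
  rcases hz with hz | hz
  · exact key z hz
  · have := key z⁻¹ hz
    rwa [show joukowski z⁻¹ = joukowski z by rw [joukowski, joukowski, inv_inv, add_comm]] at this

lemma hasDerivAt_joukowski {z : ℂ} (hz : z ≠ 0) :
    HasDerivAt joukowski ((1 + -(z ^ 2)⁻¹) / 2) z :=
  ((hasDerivAt_id z).add (hasDerivAt_inv hz)).div_const 2

lemma analyticAt_joukowski {z : ℂ} (hz : z ≠ 0) : AnalyticAt ℂ joukowski z :=
  (analyticAt_id.add (analyticAt_inv hz)).div_const

lemma analyticAt_eval_joukowski (p : Polynomial ℂ) {z : ℂ} (hz : z ≠ 0) :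
    AnalyticAt ℂ (fun z => p.eval (joukowski z)) z :=
  (p.differentiable.analyticAt (joukowski z)).comp (analyticAt_joukowski hz)

lemma analyticAt_evalAt {f : RatFunc ℂ} {z : ℂ} (hz : z ≠ 0) (h : f.denom.eval (joukowski z) ≠ 0) :
    AnalyticAt ℂ (evalAt f) z := by
  rw [show evalAt f = fun z => _ from funext (evalAt_eq f)]
  exact (analyticAt_eval_joukowski _ hz).div (analyticAt_eval_joukowski _ hz) h

/-- Away from `z² = 1` the map `z ↦ (z + z⁻¹)/2` has nonzero derivative, so simple poles in `x`
remain simple in `z`. -/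
lemma MemV.simplePoleAt_evalAt {f : RatFunc ℂ} (hf : MemV q b f) {z : ℂ} (hz : z ≠ 0)
    (hz2 : z ^ 2 ≠ 1) : SimplePoleAt (evalAt f) z := by
  have e : evalAt f = fun z => (∏ x ∈ f.denom.roots.toFinset, (joukowski z - x))⁻¹ *
      f.num.eval (joukowski z) := by
    funext w
    rw [evalAt_eq, hf.denom_eq, Lagrange.eval_nodal, ← hf.denom_eq]
    simp only [id]
    ring
  rw [e]
  refine (simplePoleAt_inv_prod _ (φ := fun x z => joukowski z - x)
    (fun x _ => (analyticAt_joukowski hz).sub analyticAt_const) (fun x _ _ => ?_)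
    fun x _ y _ hx hy => ?_).mul_analytic (analyticAt_eval_joukowski _ hz)
  · rw [((hasDerivAt_joukowski hz).sub_const x).deriv]
    intro h0
    apply hz2
    field_simp at h0
    linear_combination h0
  · rw [sub_eq_zero] at hx hy
    rw [← hx, hy]

lemma goodOn_evalAt_mul_weight (hq0 : q ≠ 0) (hq : ‖q‖ < 1) (h : Generic q b) {f : RatFunc ℂ}
    (hf : MemV q b f) {N : ℕ} (hN : PoleBound q b N f) {l : ℂ} (hl : l ≠ 0) :
    GoodOn (poleSeq q (shiftParam q b N) ∪ poleSeqInv q (shiftParam q b N))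
      (fun z => evalAt f z * weight q b l z) := by
  have hw := goodOn_weight hq0 hq h hl
  have hsub : poleSeq q b ∪ poleSeqInv q b ⊆
      poleSeq q (shiftParam q b N) ∪ poleSeqInv q (shiftParam q b N) := by
    have h1 := poleSeq_shiftParam_subset (b := b) hq0 (Nat.zero_le N)
    have h2 := poleSeqInv_shiftParam_subset (b := b) hq0 (Nat.zero_le N)
    rw [shiftParam_zero] at h1 h2
    exact union_subset_union h1 h2
  refine ⟨fun z hz hzP => (analyticAt_evalAt hz (hN.eval_denom_ne_zero hq0 h hz hzP)).mul
    (hw.analyticAt z hz fun hm => hzP (hsub hm)), fun z hzP => ?_⟩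
  have hz : z ≠ 0 := fun h0 => (locFin_shiftParam hq0 hq h N).zero_notMem (h0 ▸ hzP)
  by_cases hm : z ∈ poleSeq q b ∪ poleSeqInv q b
  · have := (hw.simplePoleAt z hm).mul_analytic
      (analyticAt_evalAt hz (hf.eval_denom_ne_zero hq0 hq h hm))
    simpa only [mul_comm] using this
  · refine (hf.simplePoleAt_evalAt hz fun h2 => ?_).mul_analytic (hw.analyticAt z hz hm)
    have h3 : z⁻¹ = z := inv_eq_of_mul_eq_one_left (by rw [← sq, h2])
    have : ∃ (j : Fin 6) (n : ℤ), z = b j * q ^ n := by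
      rcases hzP with hzP | hzP
      · obtain ⟨j, n, -, e⟩ := (mem_poleSeq_shiftParam hq0).mp hzP
        exact ⟨j, n, e⟩
      · obtain ⟨j, n, -, e⟩ := (mem_poleSeqInv_shiftParam hq0).mp hzP
        exact ⟨j, n, h3.symm.trans e⟩
    obtain ⟨j, n, e⟩ := this
    exact h.inv_mul_zpow_ne hq0 j j n n (by rw [← e, h3])

end Poles

/-! ### The functional on `V`. -/

section Functional

variable {q : ℂ} {b : Fin 6 → ℂ} {γ : ℕ → ℝ → ℂ}

/-- The integral against the weight, as a linear functional on `V`. -/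
lemma exists_linear_logIntegral (hq0 : q ≠ 0) (hq : ‖q‖ < 1) (h : Generic q b)
    (hγ : ∀ N, Separates (poleSeq q (shiftParam q b N)) (poleSeqInv q (shiftParam q b N)) (γ N))
    {l : ℂ} (hl : l ≠ 0) :
    ∃ L : V q b →ₗ[ℂ] ℂ, ∀ (f : V q b) (N : ℕ), PoleBound q b N f →
      L f = logIntegral (γ N) (fun z => evalAt f z * weight q b l z) := by
  -- No single path serves all of `V`. Each `f` is integrated along a path adapted to its poles, and
  -- any larger bound gives the same integral, so sums can be compared on a common path.
  choose B hB using fun f : V q b => MemV.exists_poleBound (f := (f : RatFunc ℂ)) f.2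
  have hmono : ∀ (f : V q b) (M N : ℕ), M ≤ N → PoleBound q b M f →
      logIntegral (γ M) (fun z => evalAt f z * weight q b l z) =
        logIntegral (γ N) (fun z => evalAt f z * weight q b l z) := fun f M N hMN hM =>
    (hγ M).logIntegral_eq (locFin_shiftParam hq0 hq h M) (goodOn_evalAt_mul_weight hq0 hq h f.2 hM hl)
      (hγ N) (poleSeq_shiftParam_subset hq0 hMN) (poleSeqInv_shiftParam_subset hq0 hMN)
  have hval : ∀ (f : V q b) (N : ℕ), PoleBound q b N f →
      logIntegral (γ (B f)) (fun z => evalAt f z * weight q b l z) =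
        logIntegral (γ N) (fun z => evalAt f z * weight q b l z) := fun f N hN =>
    (hmono f _ _ (le_max_left (B f) N) (hB f)).trans (hmono f _ _ (le_max_right (B f) N) hN).symm
  have hden : ∀ (f : V q b) (N : ℕ), PoleBound q b N f → ∀ t ∈ Icc (0 : ℝ) 1,
      (f : RatFunc ℂ).denom.eval (joukowski (γ N t)) ≠ 0 := fun f N hN t ht =>
    hN.eval_denom_ne_zero hq0 h ((hγ N).ne_zero t ht) (by
      rintro (hm | hm)
      · exact (hγ N).avoid_left _ hm t ht rfl
      · exact (hγ N).avoid_right _ hm t ht rfl)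
  have hcont : ∀ (f : V q b) (N : ℕ), PoleBound q b N f →
      ContinuousOn (fun z => evalAt f z * weight q b l z) (γ N '' Icc 0 1) := fun f N hN =>
    (goodOn_evalAt_mul_weight hq0 hq h f.2 hN hl).continuousOn_image (hγ N) subset_rfl
  refine ⟨⟨⟨fun f => logIntegral (γ (B f)) (fun z => evalAt f z * weight q b l z), fun f g => ?_⟩,
    fun c f => ?_⟩, fun f N hN => hval f N hN⟩
  · set N := max (max (B f) (B g)) (B (f + g)) with hN
    have hf := (hB f).mono (show B f ≤ N by omega)
    have hg := (hB g).mono (show B g ≤ N by omega)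
    have hfg := (hB (f + g)).mono (show B (f + g) ≤ N by omega)
    rw [hval _ N hfg, hval _ N hf, hval _ N hg, ← logIntegral_add (hγ N).isClosedPath (hγ N).ne_zero
      (hcont f N hf) (hcont g N hg)]
    refine logIntegral_congr fun t ht => ?_
    rw [← add_mul, evalAt, Submodule.coe_add, RatFunc.eval_add]
    · rfl
    · simpa [Polynomial.eval₂_id] using hden f N hf t ht
    · simpa [Polynomial.eval₂_id] using hden g N hg t ht
  · set N := max (B f) (B (c • f)) with hN
    have hf := (hB f).mono (show B f ≤ N by omega)
    have hg := (hB (c • f)).mono (show B (c • f) ≤ N by omega)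
    change logIntegral (γ (B (c • f))) (fun z => evalAt (c • f : V q b) z * weight q b l z) =
      c * logIntegral (γ (B f)) (fun z => evalAt f z * weight q b l z)
    rw [hval _ N hf, hval _ N hg, ← logIntegral_const_mul]
    refine logIntegral_congr fun t ht => ?_
    rw [← mul_assoc, evalAt, Submodule.coe_smul, RatFunc.smul_eq_C_mul, RatFunc.eval_mul,
      RatFunc.eval_C]
    · rfl
    · simp
    · simpa [Polynomial.eval₂_id] using hden f N hf t ht

/-- The integral of a product function against the weight. -/
lemma logIntegral_prodFun (hq0 : q ≠ 0) (hq : ‖q‖ < 1) (h : Generic q b) {η : ℝ → ℂ} {N : ℕ}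
    (hη : Separates (poleSeq q (shiftParam q b N)) (poleSeqInv q (shiftParam q b N)) η)
    {k : Fin 6 → ℤ} (hk : ∑ j, k j = 0) (hN : ∀ j, -(N : ℤ) ≤ k j) {f : RatFunc ℂ}
    (hf : IsProductFun q b k f) {l : ℂ} (hl : l ≠ 0) (hD : thetaDiff q b l ≠ 0) :
    qPochInf q q * theta q (l ^ 2) * pairProd q b / (2 * thetaDiff q b l) *
      (logIntegral η (fun z => evalAt f z * weight q b l z) / (2 * Real.pi * Complex.I)) =
      productValue q b k := by
  have hg := h.mul_zpow hq0 hk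
  have hsub : poleSeq q (fun j => b j * q ^ k j) ⊆ poleSeq q (shiftParam q b N) := by
    rintro z ⟨j, n, rfl⟩
    refine (mem_poleSeq_shiftParam hq0).mpr ⟨j, k j + n, ?_, ?_⟩
    · have := hN j; omega
    · rw [zpow_add₀ hq0, zpow_natCast, mul_assoc]
  have hsubI : poleSeqInv q (fun j => b j * q ^ k j) ⊆ poleSeqInv q (shiftParam q b N) :=
    fun _ hz => hsub hz
  -- The evaluation is applied to the shifted parameters; `k j ≥ -N` guarantees that the path
  -- separates their poles too.
  have h1 := logIntegral_weight_eq hq0 hq hg hη hsub hsubI hl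
  have hE : (⋃ (j : Fin 6) (n : ℤ), ({b j * q ^ n, (b j * q ^ n)⁻¹} : Set ℂ)).Countable :=
    countable_iUnion fun j => countable_iUnion fun n => Set.Countable.insert _ (countable_singleton _)
  have h2 : logIntegral η (fun z => evalAt f z * weight q b l z) =
      logIntegral η (weight q (fun j => b j * q ^ k j) l) := by
    refine contourIntegral_congr hE fun t ht htE => ?_
    change evalAt f (η t) * weight q b l (η t) / η t = _
    rw [evalAt_mul_weight hq0 hq b hf l (hη.ne_zero t ht)]
    intro j n
    simp only [mem_iUnion, mem_insert_iff, mem_singleton_iff, not_exists, not_or] at htE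
    exact ⟨(htE j n).1, fun he => (htE j n).2 (by rw [← he, inv_inv])⟩
  have h3 := thetaDiff_mul_zpow hq0 hq h hk hl
  have hD' := hD
  rw [← h3] at hD'
  have hB := right_ne_zero_of_mul hD'
  have hD2 := left_ne_zero_of_mul hD'
  have hpi := Complex.two_pi_I_ne_zero
  rw [h2, pairProd_mul_zpow hq0 hq h k, ← h3, productValue, div_mul_div_comm, div_eq_div_iff
    (mul_ne_zero (mul_ne_zero two_ne_zero hD') hpi) hB]
  linear_combination (∏ i, ∏ j ∈ Finset.Ioi i, qPoch q (b i * b j) (k i + k j)) *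
    (∏ j, (q ^ (k j * (k j - 1) / 2) * b j ^ k j)) * h1

lemma MemV.of_isProductFun (hq0 : q ≠ 0) (hq : ‖q‖ < 1) (h : Generic q b) {k : Fin 6 → ℤ}
    (hk : ∑ j, k j = 0) {f : RatFunc ℂ} (hf : IsProductFun q b k f) : f ∈ V q b := by
  rw [hf.eq_prodFun]; exact memV_prodFun hq0 hq h hk

/-- There is a functional on `V` given by all the integrals with `D(l) ≠ 0`. -/
lemma exists_functional (hq0 : q ≠ 0) (hq : ‖q‖ < 1) (h : Generic q b)
    (hγ : ∀ N, Separates (poleSeq q (shiftParam q b N)) (poleSeqInv q (shiftParam q b N)) (γ N)) :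
    ∃ J : V q b →ₗ[ℂ] ℂ,
      (∀ (k : Fin 6 → ℤ), ∑ j, k j = 0 → ∀ f : V q b, IsProductFun q b k f →
        J f = productValue q b k) ∧
      ∀ l, l ≠ 0 → thetaDiff q b l ≠ 0 → ∀ (f : V q b) (N : ℕ), PoleBound q b N f →
        J f = qPochInf q q * theta q (l ^ 2) * pairProd q b / (2 * thetaDiff q b l) *
          (logIntegral (γ N) (fun z => evalAt f z * weight q b l z) / (2 * Real.pi * Complex.I)) := by
  have hL : ∀ l, l ≠ 0 → thetaDiff q b l ≠ 0 → ∃ J : V q b →ₗ[ℂ] ℂ,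
      (∀ (k : Fin 6 → ℤ), ∑ j, k j = 0 → ∀ f : V q b, IsProductFun q b k f →
        J f = productValue q b k) ∧
      ∀ (f : V q b) (N : ℕ), PoleBound q b N f →
        J f = qPochInf q q * theta q (l ^ 2) * pairProd q b / (2 * thetaDiff q b l) *
          (logIntegral (γ N) (fun z => evalAt f z * weight q b l z) /
            (2 * Real.pi * Complex.I)) := by
    intro l hl hD
    obtain ⟨L, hL⟩ := exists_linear_logIntegral hq0 hq h hγ hl
    have hJ : ∀ (f : V q b) (N : ℕ), PoleBound q b N f →
        ((qPochInf q q * theta q (l ^ 2) * pairProd q b / (2 * thetaDiff q b l) /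
          (2 * Real.pi * Complex.I)) • L) f =
        qPochInf q q * theta q (l ^ 2) * pairProd q b / (2 * thetaDiff q b l) *
          (logIntegral (γ N) (fun z => evalAt f z * weight q b l z) /
            (2 * Real.pi * Complex.I)) := by
      intro f N hN
      rw [LinearMap.smul_apply, hL f N hN, smul_eq_mul]
      ring
    refine ⟨_, fun k hk f hf => ?_, hJ⟩
    obtain ⟨N, hN⟩ := MemV.exists_poleBound (f := (f : RatFunc ℂ)) f.2
    -- Large enough both for the actual poles of `f` and for the pole sequences of the shifted
    -- parameters, some of which may cancel in `f`.
    set M := max N (Finset.univ.sup fun j => (-k j).toNat) with hM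
    rw [hJ f M (hN.mono (le_max_left _ _))]
    refine logIntegral_prodFun hq0 hq h (hγ M) hk (fun j => ?_) hf hl hD
    have : (-k j).toNat ≤ M :=
      (Finset.le_sup (f := fun j => (-k j).toNat) (Finset.mem_univ j)).trans (le_max_right _ _)
    omega
  -- Any `l` with `D(l) ≠ 0` defines the functional; `b 0` is one. The functional for another `l`
  -- has the same values on the product functions and hence on their span.
  obtain ⟨J, hJ1, hJ2⟩ := hL (b 0) (h.ne_zero hq0 0) (h.thetaDiff_ne_zero hq0 hq 0)
  refine ⟨J, hJ1, fun l hl hD f N hN => ?_⟩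
  obtain ⟨J', hJ1', hJ2'⟩ := hL l hl hD
  rw [← hJ2' f N hN]
  have hspan : ∀ g ∈ prodSpan q b, ∃ hg : g ∈ V q b, J ⟨g, hg⟩ = J' ⟨g, hg⟩ := by
    intro g hg
    induction hg using Submodule.span_induction with
    | mem g hg =>
      obtain ⟨k, hk, hgk⟩ := hg
      refine ⟨MemV.of_isProductFun hq0 hq h hk hgk, ?_⟩
      rw [hJ1 k hk _ hgk, hJ1' k hk _ hgk]
    | zero => exact ⟨zero_mem _, by rw [show (⟨0, zero_mem _⟩ : V q b) = 0 from rfl, map_zero, map_zero]⟩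
    | add x y _ _ hx hy =>
      obtain ⟨hx, ex⟩ := hx
      obtain ⟨hy, ey⟩ := hy
      refine ⟨add_mem hx hy, ?_⟩
      rw [show (⟨x + y, add_mem hx hy⟩ : V q b) = ⟨x, hx⟩ + ⟨y, hy⟩ from rfl, map_add, map_add, ex, ey]
    | smul c x _ hx =>
      obtain ⟨hx, ex⟩ := hx
      refine ⟨Submodule.smul_mem _ c hx, ?_⟩
      rw [show (⟨c • x, Submodule.smul_mem _ c hx⟩ : V q b) = c • ⟨x, hx⟩ from rfl, map_smul, map_smul, ex]
  obtain ⟨_, e⟩ := hspan f (by rw [prodSpan_eq hq0 hq h]; exact f.2)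
  exact e

end Functional

/-! ### Contours defined by the actual poles of the integrand. -/

section Contours

variable {q : ℂ} {b : Fin 6 → ℂ}

lemma integrand_eq (q : ℂ) (b : Fin 6 → ℂ) (l : ℂ) (f : RatFunc ℂ) (z : ℂ) : integrand q b l f z =
    (2 * Real.pi * Complex.I)⁻¹ * (evalAt f z * weight q b l z / z) := by
  rw [integrand, ← weight, one_div, mul_inv]
  ring

lemma contourIntegral_integrand (q : ℂ) (b : Fin 6 → ℂ) (l : ℂ) (f : RatFunc ℂ) (γ : ℝ → ℂ) :
    contourIntegral γ (integrand q b l f) =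
      logIntegral γ (fun z => evalAt f z * weight q b l z) / (2 * Real.pi * Complex.I) := by
  rw [show integrand q b l f = fun z => _ from funext (integrand_eq q b l f), contourIntegral_const_mul,
    logIntegral, inv_mul_eq_div]

lemma goodOn_integrand (hq0 : q ≠ 0) (hq : ‖q‖ < 1) (h : Generic q b) {f : RatFunc ℂ}
    (hf : MemV q b f) {N : ℕ} (hN : PoleBound q b N f) {l : ℂ} (hl : l ≠ 0) :
    GoodOn (poleSeq q (shiftParam q b N) ∪ poleSeqInv q (shiftParam q b N))
      (integrand q b l f) := by
  have h0 := (locFin_shiftParam hq0 hq h N).zero_notMem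
  have := ((goodOn_evalAt_mul_weight hq0 hq h hf hN hl).div_id h0).mul_analytic h0
    (G := fun _ => (2 * Real.pi * Complex.I)⁻¹) fun z _ => analyticAt_const
  rw [show integrand q b l f = fun z => _ from funext (integrand_eq q b l f)]
  simpa only [mul_comm _ (2 * (Real.pi : ℂ) * Complex.I)⁻¹] using this

/-- The separating path is a contour for the integrand. -/
lemma isContour_of_separates (hq0 : q ≠ 0) (hq : ‖q‖ < 1) (h : Generic q b) {f : RatFunc ℂ}
    (hf : MemV q b f) {N : ℕ} (hN : PoleBound q b N f) {l : ℂ} (hl : l ≠ 0) {γ : ℝ → ℂ}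
    (hγ : Separates (poleSeq q (shiftParam q b N)) (poleSeqInv q (shiftParam q b N)) γ) :
    IsContour q b (integrand q b l f) γ := by
  have hgood := goodOn_integrand hq0 hq h hf hN hl
  have hpole : ∀ a, a ≠ 0 → IsPole (integrand q b l f) a →
      a ∈ poleSeq q (shiftParam q b N) ∪ poleSeqInv q (shiftParam q b N) := by
    intro a ha hp
    by_contra hm
    exact not_isPole_of_analyticAt (hgood.analyticAt a ha hm) hp
  refine ⟨hγ.isClosedPath, fun t ht => ⟨hγ.ne_zero t ht, fun hp => ?_⟩, fun j n => ⟨fun hp => ?_, fun hp => ?_⟩⟩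
  · rcases hpole _ (hγ.ne_zero t ht) hp with hm | hm
    · exact hγ.avoid_left _ hm t ht rfl
    · exact hγ.avoid_right _ hm t ht rfl
  · rcases hpole _ (mul_ne_zero (h.ne_zero hq0 j) (zpow_ne_zero n hq0)) hp with hm | hm
    · exact hγ.winding_left _ hm
    · obtain ⟨i, m, -, e⟩ := (mem_poleSeqInv_shiftParam hq0).mp hm
      exact absurd e (h.inv_mul_zpow_ne hq0 j i n m)
  · rcases hpole _ (mul_ne_zero (inv_ne_zero (h.ne_zero hq0 j)) (zpow_ne_zero n hq0)) hp with hm | hm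
    · obtain ⟨i, m, -, e⟩ := (mem_poleSeq_shiftParam hq0).mp hm
      refine absurd ?_ (h.inv_mul_zpow_ne hq0 j i (-n) m)
      rw [← e, mul_inv, zpow_neg, inv_inv]
    · exact hγ.winding_right _ hm

/-- The winding number is constant in a disc around `0` that the path avoids. -/
lemma windingNumber_eq_zero_of_norm_lt {γ : ℝ → ℂ} (hγ : IsClosedPath γ) {a : ℂ}
    (ha : ∀ t ∈ Icc (0 : ℝ) 1, ‖a‖ < ‖γ t‖) : windingNumber γ a = windingNumber γ 0 := by
  have hne : ∀ w ∈ γ '' Icc 0 1, w ≠ 0 ∧ w - a ≠ 0 := by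
    rintro - ⟨t, ht, rfl⟩
    have := ha t ht
    refine ⟨fun h0 => ?_, fun h0 => ?_⟩
    · rw [h0, norm_zero] at this
      exact absurd this (norm_nonneg a).not_gt
    · rw [sub_eq_zero.mp h0] at this
      exact lt_irrefl _ this
  have c1 : ContinuousOn (fun z : ℂ => (z - a)⁻¹) (γ '' Icc 0 1) :=
    ContinuousOn.inv₀ (by fun_prop) fun w hw => (hne w hw).2
  have c2 : ContinuousOn (fun z : ℂ => (-1) * (z - 0)⁻¹) (γ '' Icc 0 1) :=
    continuousOn_const.mul (ContinuousOn.inv₀ (by fun_prop) fun w hw => by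
      rw [sub_zero]; exact (hne w hw).1)
  -- Since `|a/z| < 1` on the path, `log (1 - a/z)` is a single-valued primitive of `1/(z - a) -
  -- 1/z`.
  have h1 := hγ.integral_deriv (F := fun z => (z - a)⁻¹ + (-1) * (z - 0)⁻¹)
    (M := fun z => Complex.log (1 - a / z)) (c1.add c2) fun t ht => by
      obtain ⟨hz, hza⟩ := hne _ (mem_image_of_mem γ ht)
      have h2 : HasDerivAt (fun z : ℂ => 1 - a / z) (a / γ t ^ 2) (γ t) := by
        have := ((hasDerivAt_inv hz).const_mul a).const_sub 1
        refine this.congr_deriv ?_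
        ring
      have hs : 1 - a / γ t ∈ Complex.slitPlane := by
        refine Complex.mem_slitPlane_of_norm_lt_one (z := -(a / γ t)) ?_
        rw [norm_neg, norm_div, div_lt_one (norm_pos_iff.mpr hz)]
        exact ha t ht
      refine (h2.clog hs).congr_deriv ?_
      have h3 : 1 - a / γ t = (γ t - a) / γ t := by field_simp
      rw [h3]
      field_simp
      ring
  rw [contourIntegral_add hγ c1 c2, contourIntegral_const_mul] at h1
  rw [windingNumber, windingNumber]
  linear_combination (2 * Real.pi * Complex.I)⁻¹ * h1

lemma isPole_div {G φ : ℂ → ℂ} {a : ℂ} (hG : AnalyticAt ℂ G a) (hG0 : G a ≠ 0)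
    (hφ : AnalyticAt ℂ φ a) (hφ0 : φ a = 0) (hd : deriv φ a ≠ 0) :
    IsPole (fun z => G z / φ z) a := by
  have h1 : AnalyticAt ℂ (dslope φ a) a := by
    obtain ⟨p, hp⟩ := hφ
    exact ⟨_, hp.has_fpower_series_dslope_fslope⟩
  have h2 : dslope φ a a ≠ 0 := by rwa [dslope_same]
  refine (isPole_iff_of_eventually_eq (hG.div h1 h2) ?_).mpr (div_ne_zero hG0 h2)
  filter_upwards [self_mem_nhdsWithin] with z hz
  have := sub_ne_zero.mpr hz
  rw [Pi.div_apply, dslope_of_ne _ hz, slope_def_field, hφ0, sub_zero]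
  field_simp

/-- The poles of the integrand accumulate at `0`. -/
lemma exists_isPole_integrand (hq0 : q ≠ 0) (hq : ‖q‖ < 1) (h : Generic q b) {f : RatFunc ℂ}
    (hf : MemV q b f) (hf0 : f ≠ 0) {l : ℂ} (hl : l ≠ 0) {ρ : ℝ} (hρ : 0 < ρ) :
    ∃ (j : Fin 6) (n : ℕ), IsPole (integrand q b l f) (b j * q ^ n) ∧ ‖b j * q ^ n‖ < ρ := by
  have hb := h.ne_zero hq0
  -- If `l` lies in `b_m^{±1} q^ℤ`, the theta factors cancel almost all poles of the `m`-th family.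
  -- By genericity this cannot happen for both `m = 0` and `m = 1`.
  obtain ⟨m, hm⟩ : ∃ m : Fin 6, ∀ n : ℤ, l ≠ (b m)⁻¹ * q ^ n ∧ l ≠ b m * q ^ n := by
    by_contra hcon
    push Not at hcon
    obtain ⟨n, hn⟩ := hcon 0
    obtain ⟨n', hn'⟩ := hcon 1
    have key : l = b 0 * q ^ n ∨ l⁻¹ = b 0 * q ^ (-n) := by
      by_cases h1 : l = (b 0)⁻¹ * q ^ n
      · right; rw [h1, mul_inv, inv_inv, zpow_neg]
      · exact Or.inl (hn h1)
    have key' : l = b 1 * q ^ n' ∨ l⁻¹ = b 1 * q ^ (-n') := by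
      by_cases h1 : l = (b 1)⁻¹ * q ^ n'
      · right; rw [h1, mul_inv, inv_inv, zpow_neg]
      · exact Or.inl (hn' h1)
    have h01 : (0 : Fin 6) ≠ 1 := by decide
    rcases key with e | e <;> rcases key' with e' | e'
    · exact h01 (h.mul_zpow_injective hq0 hq (e.symm.trans e')).1
    · exact h.inv_mul_zpow_ne hq0 0 1 _ _ (by rw [← e, e'])
    · exact h.inv_mul_zpow_ne hq0 1 0 _ _ (by rw [← e', e])
    · exact h01 (h.mul_zpow_injective hq0 hq (e.symm.trans e')).1
  have hev1 : ∀ᶠ n : ℕ in Filter.atTop, ‖b m * q ^ n‖ < ρ := by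
    have := ((tendsto_pow_atTop_nhds_zero_of_norm_lt_one hq).const_mul (b m)).norm
    rw [mul_zero, norm_zero] at this
    exact this.eventually_lt_const hρ
  -- The numerator of `f` has finitely many roots, so it can cancel only finitely many poles of the
  -- chosen family.
  have hev2 : ∀ᶠ n : ℕ in Filter.atTop, f.num.eval (joukowski (b m * q ^ n)) ≠ 0 := by
    rw [← Nat.cofinite_eq_atTop]
    have hinj : Function.Injective fun n : ℕ => joukowski (b m * q ^ n) := by
      intro n n' he
      simp only [← zpow_natCast] at he
      exact_mod_cast (h.joukowski_injective hq0 hq he).2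
    have hnum : f.num ≠ 0 := RatFunc.num_ne_zero hf0
    refine Filter.eventually_cofinite.mpr
      ((f.num.roots.toFinset.finite_toSet.preimage hinj.injOn).subset fun n hn => ?_)
    simp only [mem_ofPred_eq, not_not] at hn
    simpa [hnum] using hn
  obtain ⟨n, h1, h2⟩ := (hev1.and hev2).exists
  refine ⟨m, n, ?_, h1⟩
  set a := b m * q ^ n with ha
  have ha0 : a ≠ 0 := mul_ne_zero (hb m) (pow_ne_zero n hq0)
  have haP : a ∈ poleSeq q b := ⟨m, n, rfl⟩
  have haz : a = b m * q ^ (n : ℤ) := by rw [ha, zpow_natCast]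
  have hzero : ∀ {x : ℂ}, qPochInf q x = 0 → ∃ i : ℤ, x = q ^ i := by
    intro x hx
    obtain ⟨i, hi⟩ := (qPochInf_eq_zero_iff hq).mp hx
    exact ⟨-i, by rw [zpow_neg, zpow_natCast]; exact eq_inv_of_mul_eq_one_left hi⟩
  have hden := hf.eval_denom_ne_zero hq0 hq h (Or.inl haP)
  have hmulne : ∀ (i : Fin 6) (r : ℤ), b i * a ≠ q ^ r := by
    intro i r he
    refine h.inv_mul_zpow_ne hq0 i m (-r) n ?_
    have := hb i
    have := zpow_ne_zero r hq0
    rw [← haz, zpow_neg, ← he]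
    field_simp
  have hdivne : ∀ (i : Fin 6) (r : ℤ), i ≠ m → b i / a ≠ q ^ r := by
    intro i r hi he
    refine hi (h.mul_zpow_injective hq0 hq (m := 0) (n := n + r) ?_).1
    rw [zpow_zero, mul_one, zpow_add₀ hq0, ← mul_assoc, ← haz, ← he]
    field_simp
  have hsq : ∀ r : ℤ, a ^ 2 ≠ q ^ r := by
    intro r he
    refine h.inv_mul_zpow_ne hq0 m m (n - r) n ?_
    have := hb m
    have := zpow_ne_zero r hq0
    have := pow_ne_zero n hq0
    rw [← haz, zpow_sub₀ hq0, ← he, zpow_natCast, ha]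
    field_simp
  -- The denominator of the weight without its only factor vanishing at `a`, namely `(b_m/z)_∞`.
  set D : ℂ → ℂ := fun z => qPochInf q (b m * z) *
    ∏ j ∈ Finset.univ.erase m, (qPochInf q (b j * z) * qPochInf q (b j / z)) with hD
  have hDa : D a ≠ 0 := by
    refine mul_ne_zero (fun h0 => ?_) (Finset.prod_ne_zero_iff.mpr fun j hj => mul_ne_zero
      (fun h0 => ?_) fun h0 => ?_)
    · obtain ⟨r, hr⟩ := hzero h0
      exact hmulne m r hr
    · obtain ⟨r, hr⟩ := hzero h0
      exact hmulne j r hr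
    · obtain ⟨r, hr⟩ := hzero h0
      exact hdivne j r (Finset.ne_of_mem_erase hj) hr
  have hDan : AnalyticAt ℂ D a := (analyticAt_qPochInf_mul hq _ a).mul
    (Finset.analyticAt_fun_prod _ fun j _ =>
      (analyticAt_qPochInf_mul hq _ a).mul (analyticAt_qPochInf_div hq _ ha0))
  set G : ℂ → ℂ := fun z => (2 * Real.pi * Complex.I)⁻¹ * (evalAt f z *
    ((qPochInf q (z ^ 2) * qPochInf q ((z ^ 2)⁻¹)) * thetaPair q l z / D z) / z) with hG
  have e : integrand q b l f = fun z => G z / qPochInf q (b m / z) := by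
    funext z
    rw [integrand_eq, weight, ← Finset.mul_prod_erase _ _ (Finset.mem_univ m), hG, hD]
    simp only [thetaPair, div_eq_mul_inv, mul_inv]
    ring
  rw [e]
  have hda : HasDerivAt (fun z => b m / z) (-b m / a ^ 2) a := by
    simpa [div_eq_mul_inv] using (hasDerivAt_inv ha0).const_mul (b m)
  have hz0 : qPochInf q (b m / a) = 0 := by
    refine (qPochInf_eq_zero_iff hq).mpr ⟨n, ?_⟩
    rw [ha]
    have := hb m
    have := pow_ne_zero n hq0
    field_simp
  refine isPole_div ?_ ?_ (analyticAt_qPochInf_div hq _ ha0) hz0 ?_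
  · exact analyticAt_const.mul (((analyticAt_evalAt ha0 hden).mul (((analyticAt_weight hq ha0).mul
      (analyticAt_thetaPair_right hq hl ha0)).div hDan hDa)).div analyticAt_id ha0)
  · refine mul_ne_zero (inv_ne_zero Complex.two_pi_I_ne_zero) (div_ne_zero (mul_ne_zero ?_
      (div_ne_zero (mul_ne_zero (mul_ne_zero (fun h0 => ?_) fun h0 => ?_) fun h0 => ?_) hDa)) ha0)
    · rw [evalAt_eq]
      exact div_ne_zero h2 hden
    · obtain ⟨r, hr⟩ := hzero h0
      exact hsq r hr
    · obtain ⟨r, hr⟩ := hzero h0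
      exact hsq (-r) (by rw [zpow_neg, ← hr, inv_inv])
    · obtain ⟨r, hr | hr⟩ := thetaPair_eq_zero hq0 hq hl ha0 h0
      · refine (hm (r - n)).1 ?_
        have := hb m
        have := pow_ne_zero n hq0
        rw [hr, ha, zpow_sub₀ hq0, zpow_natCast]
        field_simp
      · refine (hm (n + r)).2 ?_
        rw [hr, haz, zpow_add₀ hq0, mul_assoc]
  · have h3 := (differentiable_qPochInf hq (b m / a)).hasDerivAt.comp a hda
    rw [show (fun z => qPochInf q (b m / z)) = qPochInf q ∘ fun z => b m / z from rfl, h3.deriv]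
    exact mul_ne_zero (deriv_qPochInf_ne_zero hq0 hq hz0)
      (div_ne_zero (neg_ne_zero.mpr (hb m)) (pow_ne_zero 2 ha0))

/-- All contours give the same integral. -/
lemma IsContour.contourIntegral_eq (hq0 : q ≠ 0) (hq : ‖q‖ < 1) (h : Generic q b) {f : RatFunc ℂ}
    (hf : MemV q b f) {N : ℕ} (hN : PoleBound q b N f) {l : ℂ} (hl : l ≠ 0) {γ η : ℝ → ℂ}
    (hη : IsContour q b (integrand q b l f) η)
    (hγ : Separates (poleSeq q (shiftParam q b N)) (poleSeqInv q (shiftParam q b N)) γ) :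
    contourIntegral η (integrand q b l f) = contourIntegral γ (integrand q b l f) := by
  -- For `f = 0` there are no poles and the winding number around `0` is unconstrained, but both
  -- integrals vanish.
  by_cases hf0 : f = 0
  · subst hf0
    have e : integrand q b l 0 = fun z => (0 : ℂ) * 0 := by
      funext z
      simp [integrand, evalAt]
    rw [e, contourIntegral_const_mul, contourIntegral_const_mul, zero_mul, zero_mul]
  have hη0 : ∀ t ∈ Icc (0 : ℝ) 1, η t ≠ 0 := fun t ht => (hη.2.1 t ht).1
  -- Choose a genuine pole `b_j q^n` closer to `0` than the whole path: the winding number around it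
  -- is `1` by assumption and equals that around `0`.
  have hw : windingNumber η 0 = 1 := by
    obtain ⟨ρ, R, hρ, hb⟩ := hη.1.exists_norm_bounds hη0
    obtain ⟨j, n, hp, hn⟩ := exists_isPole_integrand hq0 hq h hf hf0 hl hρ
    rw [← windingNumber_eq_zero_of_norm_lt hη.1 fun t ht => hn.trans (hb t ht).1, ← zpow_natCast]
    rw [← zpow_natCast] at hp
    exact (hη.2.2 j n).1 hp
  have hav : ∀ a ∈ poleSeq q (shiftParam q b N) ∪ poleSeqInv q (shiftParam q b N),
      IsPole (integrand q b l f) a → (∀ t ∈ Icc (0 : ℝ) 1, η t ≠ a ∧ γ t ≠ a) ∧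
        windingNumber η a = 1 * windingNumber γ a := by
    rintro a (ha | ha) hp
    · refine ⟨fun t ht => ⟨fun he => (hη.2.1 t ht).2 (he ▸ hp), hγ.avoid_left a ha t ht⟩, ?_⟩
      rw [hγ.winding_left a ha, mul_one]
      obtain ⟨j, n, -, rfl⟩ := (mem_poleSeq_shiftParam hq0).mp ha
      exact (hη.2.2 j n).1 hp
    · refine ⟨fun t ht => ⟨fun he => (hη.2.1 t ht).2 (he ▸ hp), hγ.avoid_right a ha t ht⟩, ?_⟩
      rw [hγ.winding_right a ha, mul_zero]
      obtain ⟨j, n, -, e⟩ := (mem_poleSeqInv_shiftParam hq0).mp ha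
      have e' : a = (b j)⁻¹ * q ^ (-n) := by rw [← inv_inv a, e, mul_inv, zpow_neg]
      rw [e'] at hp ⊢
      exact (hη.2.2 j (-n)).2 hp
  rw [contourIntegral_eq_mul (locFin_shiftParam hq0 hq h N) (goodOn_integrand hq0 hq h hf hN hl) hη.1
    hγ.isClosedPath 1 (fun t ht => ⟨hη0 t ht, hγ.ne_zero t ht⟩) hav
    (by rw [hw, hγ.winding_zero, one_mul]), one_mul]

end Contours

end Rahman

end

theorem mainTheorem6 (q : ℂ) (hq0 : 0 < ‖q‖) (hq1 : ‖q‖ < 1) (b : Fin 6 → ℂ)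
    (hbal : ∏ j, b j = q)
    (hratio : ∀ i j : Fin 6, i < j → ∀ n : ℤ, b i / b j ≠ q ^ n)
    (hprod : ∀ i j : Fin 6, i ≤ j → ∀ n : ℤ, b i * b j ≠ q ^ n) :
    -- the product functions span the space
    Submodule.span ℂ {f : RatFunc ℂ | ∃ k : Fin 6 → ℤ, ∑ j, k j = 0 ∧ Rahman.IsProductFun q b k f}
        = Rahman.V q b ∧
    ∃ J : Rahman.V q b →ₗ[ℂ] ℂ,
      -- the values on the product functions
      (∀ k : Fin 6 → ℤ, ∑ j, k j = 0 →
        ∃ f : Rahman.V q b, Rahman.IsProductFun q b k f ∧ J f = Rahman.productValue q b k) ∧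
      -- the denominator of the prefactor vanishes only on a closed discrete subset of `ℂ ∖ {0}`
      (∀ᶠ l in Filter.codiscreteWithin ({0}ᶜ : Set ℂ), Rahman.thetaDiff q b l ≠ 0) ∧
      -- the integral formula
      ∀ l : ℂ, l ≠ 0 → Rahman.thetaDiff q b l ≠ 0 → ∀ f : Rahman.V q b,
        (∃ γ : ℝ → ℂ, Rahman.IsContour q b (Rahman.integrand q b l f) γ) ∧
        ∀ γ : ℝ → ℂ, Rahman.IsContour q b (Rahman.integrand q b l f) γ →
          J f = Rahman.qPochInf q q * Rahman.theta q (l ^ 2) *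
              (∏ i, ∏ j ∈ Finset.Ioi i, Rahman.qPochInf q (b i * b j)) /
              (2 * Rahman.thetaDiff q b l) *
            Rahman.contourIntegral γ (Rahman.integrand q b l f) := by
  have hq0' : q ≠ 0 := norm_pos_iff.mp hq0
  have hb0 : ∀ j, b j ≠ 0 := by
    have h1 : ∏ j, b j ≠ 0 := by rw [hbal]; exact hq0'
    exact fun j => Finset.prod_ne_zero_iff.mp h1 j (Finset.mem_univ j)
  have h : Rahman.Generic q b := by
    refine ⟨hbal, fun i j hij n he => ?_, fun i j n he => ?_⟩
    · have hj := hb0 j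
      rcases lt_or_gt_of_ne hij with hlt | hlt
      · exact hratio i j hlt n (by rw [he]; field_simp)
      · refine hratio j i hlt (-n) ?_
        have hn := zpow_ne_zero n hq0'
        rw [he, zpow_neg]
        field_simp
    · rcases le_total i j with hle | hle
      · exact hprod i j hle n he
      · exact hprod j i hle n ((mul_comm _ _).trans he)
  choose γ hγ using Rahman.exists_separates_shiftParam hq0' hq1 h
  obtain ⟨J, hJ1, hJ2⟩ := Rahman.exists_functional hq0' hq1 h hγ
  refine ⟨Rahman.prodSpan_eq hq0' hq1 h, J, fun k hk => ?_,
    Rahman.eventually_thetaDiff_ne_zero hq0' hq1 h, fun l hl hD f => ?_⟩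
  · exact ⟨⟨_, Rahman.memV_prodFun hq0' hq1 h hk⟩, Rahman.isProductFun_prodFun q b k,
      hJ1 k hk _ (Rahman.isProductFun_prodFun q b k)⟩
  · obtain ⟨N, hN⟩ := Rahman.MemV.exists_poleBound (f := (f : RatFunc ℂ)) f.2
    refine ⟨⟨γ N, Rahman.isContour_of_separates hq0' hq1 h f.2 hN hl (hγ N)⟩, fun η hη => ?_⟩
    rw [hη.contourIntegral_eq hq0' hq1 h f.2 hN hl (hγ N), Rahman.contourIntegral_integrand,
      hJ2 l hl hD f N hN, Rahman.pairProd]
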